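/- All von Neumann algebras act on complex Hilbert spaces, and all states below are faithful and normal. The free product $(M_1,\varphi_1)\ast(M_2,\varphi_2)$ is the von Neumann algebra $(M,\varphi)$ with faithful normal state, unique up to state-preserving $\ast$-isomorphism, into which $(M_1,\varphi_1)$ and $(M_2,\varphi_2)$ embed unitally and state-preservingly, such that the images of $M_1$ and $M_2$ are free with respect to $\varphi$ and together generate $M$ as a von Neumann algebra. Here two unital subalgebras are free with respect to $\varphi$ if $\varphi(x_1x_2\cdots x_n)=0$ for all $n\ge 1$ whenever the $x_k$ come alternately from the two subalgebras and $\varphi(x_k)=0$ for all $k$. **Proposition.** Let $(A,\varphi_A)$, $(B,\varphi_B)$ and $(C,\varphi_C)$ be three von Neumann algebras endowed with faithful normal states, such that $A$ is a factor of type $\mathrm{I}$. Let $$(\mathcal M,\psi)=\big((C,\varphi_C)\otimes(A,\varphi_A)\big)\ast(B,\varphi_B),$$ where $\otimes$ is the von Neumann algebra tensor product with the product state, and let $$(\mathcal N,\psi)=(A,\varphi_A)\ast(B,\varphi_B)\subset(\mathcal M,\psi)$$ be the von Neumann subalgebra of $\mathcal M$ generated by $1\otimes A$ and $B$, with the restriction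 of $\psi$. Let $e$ be a minimal projection of $A$ (identified with $1\otimes e\in\mathcal N\subset\mathcal M$), and put $\psi_e=\frac1{\psi(e)}\psi$ on the corners $e\mathcal Ne\subset e\mathcal Me$, whose unit is $e$. Then the subalgebras $e\mathcal Ne$ and $C\otimes e=\{c\otimes e: c\in C\}$ of $e\mathcal Me$ are free with respect to $\psi_e$, and together they generate $e\mathcal Me$ as a von Neumann algebra. The map $c\mapsto c\otimes e$ and the inclusion of $e\mathcal Ne$ preserve the states, so that $$(e\mathcal Me,\psi_e)\cong(C,\varphi_C)\ast(e\mathcal Ne,\psi_e)$$ by a state-preserving $\ast$-isomorphism. -/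

import Mathlib

open scoped InnerProductSpace TensorProduct ComplexOrder

noncomputable section

namespace VonNeumannAlgebra

universe u v w

set_option linter.unusedSectionVars false

variable {H : Type u} [NormedAddCommGroup H] [InnerProductSpace ℂ H] [CompleteSpace H]
variable {K : Type v} [NormedAddCommGroup K] [InnerProductSpace ℂ K] [CompleteSpace K]
variable {L : Type w} [NormedAddCommGroup L] [InnerProductSpace ℂ L] [CompleteSpace L]

/-- The unital `*`-algebra of elements of a von Neumann algebra `M ⊆ B(H)`. -/
abbrev Elem (M : VonNeumannAlgebra H) : Type u := M.toStarSubalgebra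

/-! ### Generated von Neumann algebras -/

/-- `W*(S)`: the von Neumann algebra generated by a set `S ⊆ B(H)`, i.e. the bicommutant of
`S ∪ S*`. -/
def wstar (S : Set (H →L[ℂ] H)) : VonNeumannAlgebra H where
  toStarSubalgebra :=
    StarSubalgebra.centralizer ℂ (StarSubalgebra.centralizer ℂ S : Set (H →L[ℂ] H))
  centralizer_centralizer' := by
    change Set.centralizer (Set.centralizer ((StarSubalgebra.centralizer ℂ
      (StarSubalgebra.centralizer ℂ S : Set (H →L[ℂ] H))) : Set (H →L[ℂ] H))) =
      ((StarSubalgebra.centralizer ℂ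
      (StarSubalgebra.centralizer ℂ S : Set (H →L[ℂ] H))) : Set (H →L[ℂ] H))
    rw [StarSubalgebra.coe_centralizer_centralizer, Set.centralizer_centralizer_centralizer]

lemma coe_wstar (S : Set (H →L[ℂ] H)) :
    (wstar S : Set (H →L[ℂ] H)) = Set.centralizer (Set.centralizer (S ∪ star S)) :=
  StarSubalgebra.coe_centralizer_centralizer ℂ S

lemma subset_wstar (S : Set (H →L[ℂ] H)) : S ⊆ (wstar S : Set (H →L[ℂ] H)) := by
  rw [coe_wstar]
  exact Set.subset_union_left.trans Set.subset_centralizer_centralizer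

lemma wstar_le {S : Set (H →L[ℂ] H)} {M : VonNeumannAlgebra H}
    (h : S ⊆ (M : Set (H →L[ℂ] H))) : (wstar S).toStarSubalgebra ≤ M.toStarSubalgebra := by
  intro x hx
  have hx' : x ∈ Set.centralizer (Set.centralizer (S ∪ star S)) := by
    rw [← coe_wstar]; exact hx
  have hS : S ∪ star S ⊆ (M : Set (H →L[ℂ] H)) := by
    rintro y (hy | hy)
    · exact h hy
    · have hy' : star y ∈ M := h hy
      have := star_mem hy'
      rwa [star_star] at this
  have := Set.centralizer_subset (Set.centralizer_subset hS) hx'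
  rw [centralizer_centralizer] at this
  exact this

/-! ### States -/

/-- `φ` is a normal state on `M ⊆ B(H)`: it is positive, `φ 1 = 1`, and it is given by a density
operator, i.e. `φ x = ∑ₙ ⟨ξₙ, x ξₙ⟩` for some vectors `ξₙ` (the case `x = 1` shows that
`∑ₙ ‖ξₙ‖² = 1`). -/
structure IsNormalState (M : VonNeumannAlgebra H) (φ : M.Elem →ₗ[ℂ] ℂ) : Prop where
  nonneg : ∀ x : M.Elem, 0 ≤ φ (star x * x)
  map_one : φ 1 = 1
  normal : ∃ ξ : ℕ → H, ∀ x : M.Elem,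
    HasSum (fun n ↦ ⟪ξ n, (x : H →L[ℂ] H) (ξ n)⟫_ℂ) (φ x)

/-- `φ` is a faithful normal state on `M`. -/
structure IsFaithfulNormalState (M : VonNeumannAlgebra H) (φ : M.Elem →ₗ[ℂ] ℂ) : Prop
    extends IsNormalState M φ where
  faithful : ∀ x : M.Elem, φ (star x * x) = 0 → x = 0

/-! ### Factors of type I -/

/-- `e` is a minimal projection of `M`. -/
structure IsMinimalProjection (M : VonNeumannAlgebra H) (e : M.Elem) : Prop where
  isStarProjection : IsStarProjection e
  ne_zero : e ≠ 0
  minimal : ∀ f : M.Elem, IsStarProjection f →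
    (f : H →L[ℂ] H) ≤ (e : H →L[ℂ] H) → f = 0 ∨ f = e

/-- `M` is a factor: its center consists of the scalars. -/
def IsFactor (M : VonNeumannAlgebra H) : Prop :=
  ∀ x : H →L[ℂ] H, x ∈ M → x ∈ M.commutant → ∃ c : ℂ, x = c • (1 : H →L[ℂ] H)

/-- `M` is a factor of type I: a factor which has a minimal projection. -/
def IsTypeIFactor (M : VonNeumannAlgebra H) : Prop :=
  M.IsFactor ∧ ∃ e : M.Elem, M.IsMinimalProjection e

/-! ### Free products -/

/-- A family of subsets (in practice: unital subalgebras) `S i` of `R` is free with respect to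
`φ`: `φ (x₁ x₂ ⋯ xₙ) = 0` whenever `n ≥ 1`, `xₖ ∈ S (iₖ)`, `φ xₖ = 0` and
`i₁ ≠ i₂`, `i₂ ≠ i₃`, …, `iₙ₋₁ ≠ iₙ`. -/
def IsFree {R ι : Type*} [Ring R] (φ : R → ℂ) (S : ι → Set R) : Prop :=
  ∀ l : List (ι × R), l ≠ [] → l.IsChain (fun a b ↦ a.1 ≠ b.1) →
    (∀ a ∈ l, a.2 ∈ S a.1 ∧ φ a.2 = 0) → φ (l.map Prod.snd).prod = 0

section generatedBy

variable {M₁ : VonNeumannAlgebra H} {M₂ : VonNeumannAlgebra K} {M : VonNeumannAlgebra L}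

/-- The von Neumann subalgebra of `M` generated by the images of `f` and `g`. -/
def generatedBy (f : M₁.Elem →⋆ₐ[ℂ] M.Elem) (g : M₂.Elem →⋆ₐ[ℂ] M.Elem) :
    VonNeumannAlgebra L :=
  wstar ((Set.range fun x ↦ (f x : L →L[ℂ] L)) ∪ Set.range fun y ↦ (g y : L →L[ℂ] L))

variable (f : M₁.Elem →⋆ₐ[ℂ] M.Elem) (g : M₂.Elem →⋆ₐ[ℂ] M.Elem)

lemma generatedBy_le : (generatedBy f g).toStarSubalgebra ≤ M.toStarSubalgebra :=
  wstar_le (by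
    rintro _ (⟨x, rfl⟩ | ⟨x, rfl⟩)
    · exact (f x).2
    · exact (g x).2)

lemma left_mem_generatedBy (x : M₁.Elem) :
    (f x : L →L[ℂ] L) ∈ (generatedBy f g).toStarSubalgebra :=
  subset_wstar _ (Or.inl ⟨x, rfl⟩)

lemma right_mem_generatedBy (y : M₂.Elem) :
    (g y : L →L[ℂ] L) ∈ (generatedBy f g).toStarSubalgebra :=
  subset_wstar _ (Or.inr ⟨y, rfl⟩)

/-- `f`, viewed as a map into the algebra generated by the images of `f` and `g`. -/
def toGeneratedLeft : M₁.Elem →⋆ₐ[ℂ] (generatedBy f g).Elem :=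
  StarAlgHom.codRestrict (M.toStarSubalgebra.subtype.comp f) _ (left_mem_generatedBy f g)

/-- `g`, viewed as a map into the algebra generated by the images of `f` and `g`. -/
def toGeneratedRight : M₂.Elem →⋆ₐ[ℂ] (generatedBy f g).Elem :=
  StarAlgHom.codRestrict (M.toStarSubalgebra.subtype.comp g) _ (right_mem_generatedBy f g)

/-- `(M, φ)` is the free product `(M₁, φ₁) ∗ (M₂, φ₂)`, with embeddings `ι₁` and `ι₂`:
`φ` is a faithful normal state on `M`, the unital `*`-homomorphisms `ιₖ : Mₖ → M` preserve the
states, their images are free with respect to `φ`, and together they generate the von Neumann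
algebra `M`. (When the `φₖ` are faithful normal states, state-preserving unital
`*`-homomorphisms `ιₖ` are automatically injective and normal.) -/
structure IsFreeProduct (φ₁ : M₁.Elem →ₗ[ℂ] ℂ) (φ₂ : M₂.Elem →ₗ[ℂ] ℂ) (φ : M.Elem →ₗ[ℂ] ℂ)
    (ι₁ : M₁.Elem →⋆ₐ[ℂ] M.Elem) (ι₂ : M₂.Elem →⋆ₐ[ℂ] M.Elem) : Prop where
  state : IsFaithfulNormalState M φ
  map_left : ∀ x, φ (ι₁ x) = φ₁ x
  map_right : ∀ y, φ (ι₂ y) = φ₂ y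
  free : IsFree φ ![Set.range ι₁, Set.range ι₂]
  generate : generatedBy ι₁ ι₂ = M

end generatedBy

/-! ### Tensor products -/

/-- The Hilbert space tensor product. -/
abbrev HilbertTensor (H : Type u) (K : Type v) [NormedAddCommGroup H] [InnerProductSpace ℂ H]
    [NormedAddCommGroup K] [InnerProductSpace ℂ K] : Type (max u v) :=
  UniformSpace.Completion (H ⊗[ℂ] K)

/-- The operator `x ⊗ y` on the Hilbert space tensor product. -/
def opTensor (x : H →L[ℂ] H) (y : K →L[ℂ] K) : HilbertTensor H K →L[ℂ] HilbertTensor H K :=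
  (TensorProduct.mapL x y).completion

/-- The von Neumann algebra tensor product of `M₁ ⊆ B(H)` and `M₂ ⊆ B(K)`: the von Neumann
algebra on the Hilbert space tensor product generated by the operators `x ⊗ y`. -/
def tensor (M₁ : VonNeumannAlgebra H) (M₂ : VonNeumannAlgebra K) :
    VonNeumannAlgebra (HilbertTensor H K) :=
  wstar {t | ∃ x ∈ M₁, ∃ y ∈ M₂, t = opTensor x y}

/-- The elementary tensor `x ⊗ y`, as an element of the von Neumann algebra tensor product. -/
def tmul {M₁ : VonNeumannAlgebra H} {M₂ : VonNeumannAlgebra K} (x : M₁.Elem) (y : M₂.Elem) :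
    (M₁.tensor M₂).Elem :=
  ⟨opTensor (x : H →L[ℂ] H) (y : K →L[ℂ] K), subset_wstar _ ⟨x, x.2, y, y.2, rfl⟩⟩

lemma opTensor_coe (x : H →L[ℂ] H) (y : K →L[ℂ] K) (t : H ⊗[ℂ] K) :
    opTensor x y (t : HilbertTensor H K) = (TensorProduct.mapL x y t : H ⊗[ℂ] K) := by
  simp [opTensor]

lemma opTensor_ext {S T : HilbertTensor H K →L[ℂ] HilbertTensor H K}
    (h : ∀ t : H ⊗[ℂ] K, S (t : HilbertTensor H K) = T (t : HilbertTensor H K)) : S = T := by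
  ext t
  exact congrFun (UniformSpace.Completion.ext S.continuous T.continuous h) t

lemma opTensor_mul (x x' : H →L[ℂ] H) (y y' : K →L[ℂ] K) :
    opTensor (x * x') (y * y') = opTensor x y * opTensor x' y' := by
  apply opTensor_ext
  intro t
  rw [mul_apply_eq_comp, opTensor_coe, opTensor_coe, opTensor_coe,
    TensorProduct.mapL_mul, mul_apply_eq_comp]

lemma opTensor_one_one : opTensor (1 : H →L[ℂ] H) (1 : K →L[ℂ] K) = 1 := by
  apply opTensor_ext
  intro t
  rw [opTensor_coe, ContinuousLinearMap.one_def, ContinuousLinearMap.one_def,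
    TensorProduct.mapL_id_id]
  rfl

lemma opTensor_star (x : H →L[ℂ] H) (y : K →L[ℂ] K) :
    opTensor (star x) (star y) = star (opTensor x y) := by
  rw [ContinuousLinearMap.star_eq_adjoint (opTensor x y), ContinuousLinearMap.eq_adjoint_iff]
  intro s t
  induction s using UniformSpace.Completion.induction_on with
  | hp => exact isClosed_eq (by fun_prop) (by fun_prop)
  | ih s =>
  induction t using UniformSpace.Completion.induction_on with
  | hp => exact isClosed_eq (by fun_prop) (by fun_prop)
  | ih t =>
  rw [opTensor_coe, opTensor_coe, UniformSpace.Completion.inner_coe,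
    UniformSpace.Completion.inner_coe]
  induction s using TensorProduct.induction_on with
  | zero => simp
  | add s s' hs hs' => rw [map_add, inner_add_left, hs, hs', inner_add_left]
  | tmul a b =>
  induction t using TensorProduct.induction_on with
  | zero => simp
  | add t t' ht ht' => rw [map_add, inner_add_right, ht, ht', inner_add_right]
  | tmul c d =>
  simp [ContinuousLinearMap.star_eq_adjoint, ContinuousLinearMap.adjoint_inner_left]

lemma opTensor_one_add (y y' : K →L[ℂ] K) :
    opTensor (1 : H →L[ℂ] H) (y + y') = opTensor 1 y + opTensor 1 y' := by
  apply opTensor_ext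
  intro t
  rw [add_apply, opTensor_coe, opTensor_coe, opTensor_coe,
    TensorProduct.mapL_add_right, add_apply, UniformSpace.Completion.coe_add]

lemma opTensor_one_smul (c : ℂ) (y : K →L[ℂ] K) :
    opTensor (1 : H →L[ℂ] H) (c • y) = c • opTensor 1 y := by
  apply opTensor_ext
  intro t
  rw [smul_apply, opTensor_coe, opTensor_coe,
    TensorProduct.mapL_smul_right, smul_apply,
    UniformSpace.Completion.coe_smul]

lemma opTensor_one_zero : opTensor (1 : H →L[ℂ] H) (0 : K →L[ℂ] K) = 0 := by
  simpa using opTensor_one_smul (H := H) 0 (0 : K →L[ℂ] K)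

lemma opTensor_one_algebraMap (c : ℂ) :
    opTensor (1 : H →L[ℂ] H) (algebraMap ℂ (K →L[ℂ] K) c) = algebraMap ℂ _ c := by
  rw [Algebra.algebraMap_eq_smul_one, opTensor_one_smul, opTensor_one_one,
    Algebra.algebraMap_eq_smul_one]

/-- The embedding `y ↦ 1 ⊗ y` of `M₂` into the tensor product of `M₁` and `M₂`. -/
def tensorRight (M₁ : VonNeumannAlgebra H) (M₂ : VonNeumannAlgebra K) :
    M₂.Elem →⋆ₐ[ℂ] (M₁.tensor M₂).Elem where
  toFun y := tmul 1 y
  map_one' := Subtype.ext opTensor_one_one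
  map_mul' y y' := Subtype.ext <|
    (congrArg (opTensor · ((y : K →L[ℂ] K) * (y' : K →L[ℂ] K)))
      (one_mul (1 : H →L[ℂ] H)).symm).trans (opTensor_mul 1 1 (y : K →L[ℂ] K) (y' : K →L[ℂ] K))
  map_zero' := Subtype.ext opTensor_one_zero
  map_add' _ _ := Subtype.ext (opTensor_one_add _ _)
  commutes' c := Subtype.ext (opTensor_one_algebraMap c)
  map_star' y := Subtype.ext <|
    (congrArg (opTensor · (star (y : K →L[ℂ] K))) (star_one (H →L[ℂ] H)).symm).trans
      (opTensor_star 1 (y : K →L[ℂ] K))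

/-- `χ` is the product state `φ₁ ⊗ φ₂` on the von Neumann algebra tensor product: the (unique)
normal state with `χ (x ⊗ y) = φ₁ x * φ₂ y`. -/
structure IsProductState {M₁ : VonNeumannAlgebra H} {M₂ : VonNeumannAlgebra K}
    (φ₁ : M₁.Elem →ₗ[ℂ] ℂ) (φ₂ : M₂.Elem →ₗ[ℂ] ℂ) (χ : (M₁.tensor M₂).Elem →ₗ[ℂ] ℂ) : Prop where
  state : IsNormalState (M₁.tensor M₂) χ
  map_tmul : ∀ x y, χ (tmul x y) = φ₁ x * φ₂ y

/-! ### Corners -/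

/-- The closed subspace `pH = {ξ | p ξ = ξ}` for a projection `p`. -/
abbrev cornerSpace (p : H →L[ℂ] H) : Submodule ℂ H :=
  p.toLinearMap.eqLocus (1 : H →L[ℂ] H).toLinearMap

/-- An operator `y` on `pH`, extended by `0` on the orthogonal complement of `pH`; this identifies
`B(pH)` with `p B(H) p`. -/
def cornerLift (p : H →L[ℂ] H) (y : cornerSpace p →L[ℂ] cornerSpace p) : H →L[ℂ] H :=
  (cornerSpace p).subtypeL ∘L y ∘L ContinuousLinearMap.adjoint (cornerSpace p).subtypeL

section corner

variable (p : H →L[ℂ] H)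

lemma adjoint_subtypeL_coe (v : cornerSpace p) :
    ContinuousLinearMap.adjoint (cornerSpace p).subtypeL (v : H) = v := by
  refine ext_inner_right ℂ fun w ↦ ?_
  rw [ContinuousLinearMap.adjoint_inner_left]
  rfl

variable {p} in
lemma coe_adjoint_subtypeL (hp : IsStarProjection p) (x : H) :
    ((ContinuousLinearMap.adjoint (cornerSpace p).subtypeL x : cornerSpace p) : H) = p x := by
  have hpp : ∀ z, p (p z) = p z := fun z ↦ congr($(hp.isIdempotentElem.eq) z)
  have hmem : p x ∈ cornerSpace p := by
    rw [LinearMap.mem_eqLocus]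
    exact hpp x
  suffices h : ContinuousLinearMap.adjoint (cornerSpace p).subtypeL x = ⟨p x, hmem⟩ by rw [h]
  refine ext_inner_right ℂ fun w ↦ ?_
  rw [ContinuousLinearMap.adjoint_inner_left]
  change ⟪x, (w : H)⟫_ℂ = ⟪p x, (w : H)⟫_ℂ
  have hw : p (w : H) = w := w.2
  conv_lhs => rw [← hw]
  rw [← ContinuousLinearMap.adjoint_inner_left, ← ContinuousLinearMap.star_eq_adjoint,
    hp.isSelfAdjoint.star_eq]

lemma cornerLift_mul (y z : cornerSpace p →L[ℂ] cornerSpace p) :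
    cornerLift p (y * z) = cornerLift p y * cornerLift p z := by
  ext x
  simp [cornerLift, adjoint_subtypeL_coe]

lemma cornerLift_add (y z : cornerSpace p →L[ℂ] cornerSpace p) :
    cornerLift p (y + z) = cornerLift p y + cornerLift p z := by
  ext x
  simp [cornerLift]

lemma cornerLift_smul (c : ℂ) (y : cornerSpace p →L[ℂ] cornerSpace p) :
    cornerLift p (c • y) = c • cornerLift p y := by
  ext x
  simp [cornerLift]

lemma cornerLift_star (y : cornerSpace p →L[ℂ] cornerSpace p) :
    cornerLift p (star y) = star (cornerLift p y) := by
  simp only [cornerLift, ContinuousLinearMap.star_eq_adjoint, ContinuousLinearMap.adjoint_comp,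
    ContinuousLinearMap.adjoint_adjoint]
  rfl

lemma cornerLift_injective : Function.Injective (cornerLift p) := by
  intro y z h
  ext v
  have := congr($h (v : H))
  simpa [cornerLift, adjoint_subtypeL_coe] using this

variable {p}

lemma cornerLift_one (hp : IsStarProjection p) : cornerLift p 1 = p := by
  ext x
  exact coe_adjoint_subtypeL hp x

lemma cornerLift_mul_proj (hp : IsStarProjection p) (y : cornerSpace p →L[ℂ] cornerSpace p) :
    cornerLift p y * p = cornerLift p y := by
  calc cornerLift p y * p = cornerLift p y * cornerLift p 1 := by rw [cornerLift_one hp]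
    _ = cornerLift p y := by rw [← cornerLift_mul, mul_one]

lemma proj_mul_cornerLift (hp : IsStarProjection p) (y : cornerSpace p →L[ℂ] cornerSpace p) :
    p * cornerLift p y = cornerLift p y := by
  calc p * cornerLift p y = cornerLift p 1 * cornerLift p y := by rw [cornerLift_one hp]
    _ = cornerLift p y := by rw [← cornerLift_mul, one_mul]

/-- The compression of an operator on `H` to `pH`. -/
def compress (p x : H →L[ℂ] H) : cornerSpace p →L[ℂ] cornerSpace p :=
  ContinuousLinearMap.adjoint (cornerSpace p).subtypeL ∘L x ∘L (cornerSpace p).subtypeL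

lemma cornerLift_compress (hp : IsStarProjection p) (x : H →L[ℂ] H) :
    cornerLift p (compress p x) = p * x * p := by
  ext v
  simp [cornerLift, compress, coe_adjoint_subtypeL hp]

/-- The `*`-algebra of all operators on `pH` whose extension by `0` lies in `M`. -/
def cornerSubalgebra (M : VonNeumannAlgebra H) (hp : IsStarProjection p) (hpM : p ∈ M) :
    StarSubalgebra ℂ (cornerSpace p →L[ℂ] cornerSpace p) where
  carrier := {y | cornerLift p y ∈ M.toStarSubalgebra}
  mul_mem' {y z} hy hz := by
    change cornerLift p (y * z) ∈ M.toStarSubalgebra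
    rw [cornerLift_mul]; exact mul_mem hy hz
  add_mem' {y z} hy hz := by
    change cornerLift p (y + z) ∈ M.toStarSubalgebra
    rw [cornerLift_add]; exact add_mem hy hz
  algebraMap_mem' c := by
    change cornerLift p (algebraMap ℂ _ c) ∈ M.toStarSubalgebra
    rw [Algebra.algebraMap_eq_smul_one, cornerLift_smul, cornerLift_one hp]
    exact M.toStarSubalgebra.smul_mem hpM c
  star_mem' {y} hy := by
    change cornerLift p (star y) ∈ M.toStarSubalgebra
    rw [cornerLift_star]; exact star_mem (show cornerLift p y ∈ M.toStarSubalgebra from hy)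

/-- The corner `pMp` of a von Neumann algebra `M ⊆ B(H)` at a projection `p ∈ M`, as a von Neumann
algebra on `pH`: it consists of the operators on `pH` whose extension by `0` lies in `M`. -/
def corner (M : VonNeumannAlgebra H) (hp : IsStarProjection p) (hpM : p ∈ M) :
    VonNeumannAlgebra (cornerSpace p) where
  toStarSubalgebra := cornerSubalgebra M hp hpM
  centralizer_centralizer' := by
    refine Set.Subset.antisymm ?_ Set.subset_centralizer_centralizer
    intro y hy
    change cornerLift p y ∈ M
    rw [← commutant_commutant M, mem_commutant_iff]
    intro x hx
    rw [mem_commutant_iff] at hx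
    have hxp : p * x = x * p := hx p hpM
    have hpp : p * p = p := hp.isIdempotentElem.eq
    have hc : cornerLift p (compress p x) = x * p := by
      rw [cornerLift_compress hp, hxp, mul_assoc, hpp]
    have hz : compress p x ∈ Set.centralizer (cornerSubalgebra M hp hpM).carrier := by
      rw [Set.mem_centralizer_iff]
      intro s hs
      apply cornerLift_injective p
      rw [cornerLift_mul, cornerLift_mul, hc, ← hxp, ← mul_assoc, cornerLift_mul_proj hp,
        hx _ hs, hxp, mul_assoc, proj_mul_cornerLift hp]
    have h := congrArg (cornerLift p) (Set.mem_centralizer_iff.1 hy _ hz)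
    rw [cornerLift_mul, cornerLift_mul, hc, mul_assoc, proj_mul_cornerLift hp, ← hxp,
      ← mul_assoc, cornerLift_mul_proj hp] at h
    exact h

/-- The identification of `pMp`, acting on `pH`, with a subspace of `M`. -/
def cornerIncl (M : VonNeumannAlgebra H) (hp : IsStarProjection p) (hpM : p ∈ M) :
    (M.corner hp hpM).Elem →ₗ[ℂ] M.Elem where
  toFun y := ⟨cornerLift p y, y.2⟩
  map_add' y z := Subtype.ext (cornerLift_add p y z)
  map_smul' c y := Subtype.ext (cornerLift_smul p c y)

/-- The normalized restriction `φ_p = φ(p)⁻¹ φ` of `φ` to the corner `pMp`. -/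
def cornerState {M : VonNeumannAlgebra H} (φ : M.Elem →ₗ[ℂ] ℂ) (hp : IsStarProjection p)
    (hpM : p ∈ M) : (M.corner hp hpM).Elem →ₗ[ℂ] ℂ :=
  (φ ⟨p, hpM⟩)⁻¹ • φ ∘ₗ cornerIncl M hp hpM

end corner

end VonNeumannAlgebra

end

open scoped InnerProductSpace TensorProduct ComplexOrder

noncomputable section

namespace VonNeumannAlgebra

universe u v w

set_option linter.unusedSectionVars false

variable {H : Type u} [NormedAddCommGroup H] [InnerProductSpace ℂ H] [CompleteSpace H]
variable {K : Type v} [NormedAddCommGroup K] [InnerProductSpace ℂ K] [CompleteSpace K]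
variable {L : Type w} [NormedAddCommGroup L] [InnerProductSpace ℂ L] [CompleteSpace L]

/-! Write `p` for the image of `e` in `M`, `𝔸` and `𝔹` for the images of `A` and `B`, and `𝔻` for
the image of `C ⊗ A`.

Freeness. The algebra generated by `𝔸` and `𝔹` is `𝔸` plus the span of the products `a m a'`, where
`m` is an alternating centered word that begins and ends in `𝔹`. Since `e` is minimal, `p 𝔸 p = ℂ
p`, so compressing by `p` and subtracting the scalar part leaves only such products
(`compress_sub_mem_span_sandwich`). The elements `c ⊗ a` with `φC c = 0` form an `𝔸`-bimodule of
centered elements of `𝔻`. In an alternating product of these with sandwiches `a m a'`, every outer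
factor `a` or `a'` adjacent to some `c ⊗ e` is absorbed, and one gets words alternating between
centered `𝔻` and centered `𝔹`, up to a first and a last factor in `𝔻`; `ψ` vanishes on them because
`𝔻` and `𝔹` are free. General centered elements of `pNp` are limits of sandwiches. The limits are
taken one letter at a time, acting on a fixed vector, so that joint continuity of multiplication is
never needed (`map_prod_eq_zero_of_corner`).

Generation. By the bicommutant theorem it suffices that a unitary `T` on `pH` commuting with `pNp`
and `C ⊗ e` commutes with `pMp`. Put `x p v ↦ x T v` for `x ∈ N`. This is isometric because `T`
commutes with `pNp`, and is densely defined because `A` is a factor (`total_of_statePreserving`).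
The extension commutes with `N` and with `C ⊗ 1`, hence with `M` (`corner_commute`,
`generate_commute`).

Uniqueness of the free product. Freeness determines all moments of the generators, and generating
`*`-semigroups with equal moments give isomorphic algebras (`exists_statePreserving_equiv`). Normal
states become vector states after infinite amplification. Their vectors are separating but need not
be cyclic, so a partial isometry replaces the usual GNS unitary. -/

lemma inner_star_apply_left (T : H →L[ℂ] H) (a b : H) : ⟪star T a, b⟫_ℂ = ⟪a, T b⟫_ℂ := by
  rw [ContinuousLinearMap.star_eq_adjoint, ContinuousLinearMap.adjoint_inner_left]

lemma inner_star_apply_right (T : H →L[ℂ] H) (a b : H) : ⟪a, star T b⟫_ℂ = ⟪T a, b⟫_ℂ := by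
  rw [ContinuousLinearMap.star_eq_adjoint, ContinuousLinearMap.adjoint_inner_right]

/-! ### Partial isometries and projections determined by families of vectors. -/

section Gram

variable {I : Type*}

/-- Two operators agree if they agree on a family of vectors and on its orthogonal complement. -/
lemma clm_eq_of_family {u : I → H} {S T : H →L[ℂ] L} (h : ∀ i, S (u i) = T (u i))
    (h0 : ∀ z, (∀ i, ⟪u i, z⟫_ℂ = 0) → S z = T z) : S = T := by
  set E : Submodule ℂ H := (Submodule.span ℂ (Set.range u)).topologicalClosure with hE
  have : CompleteSpace E := (Submodule.isClosed_topologicalClosure _).completeSpace_coe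
  have h1 : ∀ z ∈ E, S z = T z := by
    have hle : Submodule.span ℂ (Set.range u) ≤ (LinearMap.eqLocus S.toLinearMap T.toLinearMap) :=
      Submodule.span_le.2 (by rintro _ ⟨i, rfl⟩; exact h i)
    have := Submodule.topologicalClosure_minimal _ hle
      (isClosed_eq S.continuous T.continuous)
    exact fun z hz ↦ this hz
  ext z
  obtain ⟨y, hy, y', hy', rfl⟩ := E.exists_add_mem_mem_orthogonal z
  rw [map_add, map_add, h1 y hy, h0 y' fun i ↦ ?_]
  exact (Submodule.mem_orthogonal _ _).1 hy' _
    (Submodule.le_topologicalClosure _ (Submodule.subset_span ⟨i, rfl⟩))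

lemma clm_eq_of_total {u : I → H} (hu : ∀ z, (∀ i, ⟪u i, z⟫_ℂ = 0) → z = 0) {S T : H →L[ℂ] L}
    (h : ∀ i, S (u i) = T (u i)) : S = T :=
  clm_eq_of_family h fun z hz ↦ by rw [hu z hz, map_zero, map_zero]

/-- Two families of vectors with the same Gram matrix are related by a partial isometry. -/
lemma exists_partialIsometry {u : I → H} {v : I → L}
    (h : ∀ i j, ⟪u i, u j⟫_ℂ = ⟪v i, v j⟫_ℂ) :
    ∃ w : H →L[ℂ] L, (∀ i, w (u i) = v i) ∧ (∀ i, w.adjoint (v i) = u i) ∧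
      (∀ z, (∀ i, ⟪u i, z⟫_ℂ = 0) → w z = 0) ∧
      ∀ z, (∀ i, ⟪v i, z⟫_ℂ = 0) → w.adjoint z = 0 := by
  set E : Submodule ℂ H := (Submodule.span ℂ (Set.range u)).topologicalClosure with hE
  have : CompleteSpace E := (Submodule.isClosed_topologicalClosure _).completeSpace_coe
  have hmem : ∀ f : I →₀ ℂ, Finsupp.linearCombination ℂ u f ∈ E := fun f ↦
    Submodule.le_topologicalClosure _ (by
      rw [← Finsupp.range_linearCombination]; exact ⟨f, rfl⟩)
  set U : (I →₀ ℂ) →ₗ[ℂ] E := (Finsupp.linearCombination ℂ u).codRestrict E hmem with hU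
  set V : (I →₀ ℂ) →ₗ[ℂ] L := Finsupp.linearCombination ℂ v with hV
  have hinner : ∀ f g, ⟪U f, U g⟫_ℂ = ⟪V f, V g⟫_ℂ := by
    intro f g
    change ⟪Finsupp.linearCombination ℂ u f, Finsupp.linearCombination ℂ u g⟫_ℂ = _
    simp only [hV, Finsupp.linearCombination_apply, Finsupp.sum, sum_inner, inner_sum,
      inner_smul_left, inner_smul_right, h]
  have hnorm : ∀ f, ‖V f‖ = ‖U f‖ := fun f ↦ by
    rw [@norm_eq_sqrt_re_inner ℂ, @norm_eq_sqrt_re_inner ℂ _ _ _ _ (U f), hinner]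
  have hdense : DenseRange U := by
    rw [DenseRange, dense_iff_closure_eq, Set.eq_univ_iff_forall]
    rintro ⟨z, hz⟩
    rw [Metric.mem_closure_iff]
    intro ε hε
    obtain ⟨y, hy, hyz⟩ := Metric.mem_closure_iff.1 hz ε hε
    rw [SetLike.mem_coe, ← Finsupp.range_linearCombination] at hy
    obtain ⟨f, rfl⟩ := hy
    exact ⟨U f, ⟨f, rfl⟩, hyz⟩
  have hbd : ∃ c, ∀ f, ‖V f‖ ≤ c * ‖U f‖ := ⟨1, fun f ↦ by rw [hnorm, one_mul]⟩
  -- Equal Gram matrices give equal norms, so `U f ↦ V f` is well defined and isometric on a dense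
  -- subspace of `E`.
  set W : E →L[ℂ] L := V.extendOfNorm U with hW
  have hWU : ∀ f, W (U f) = V f := fun f ↦ LinearMap.extendOfNorm_eq hdense hbd f
  have hWinner : ∀ x y, ⟪W x, W y⟫_ℂ = ⟪x, y⟫_ℂ := by
    intro x y
    induction x using hdense.induction_on with
    | hp => exact isClosed_eq (by fun_prop) (by fun_prop)
    | ih f =>
    induction y using hdense.induction_on with
    | hp => exact isClosed_eq (by fun_prop) (by fun_prop)
    | ih g => rw [hWU, hWU, hinner]
  have hu : ∀ i, ∃ hi : u i ∈ E, W ⟨u i, hi⟩ = v i := by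
    intro i
    have h1 := hWU (Finsupp.single i 1)
    have h2 : ((U (Finsupp.single i 1) : E) : H) = u i := by
      simp [hU]
    refine ⟨h2 ▸ (U (Finsupp.single i 1)).2, ?_⟩
    rw [show V (Finsupp.single i 1) = v i by simp [hV]] at h1
    rw [← h1]
    congr 1
    exact Subtype.ext h2.symm
  set w : H →L[ℂ] L := W ∘L E.orthogonalProjectionOnto with hw
  have hwu : ∀ i, w (u i) = v i := by
    intro i
    obtain ⟨hi, h1⟩ := hu i
    rw [← h1]
    simp only [hw, ContinuousLinearMap.comp_apply]
    congr 1
    exact Submodule.orthogonalProjectionOnto_mem_subspace_eq_self (⟨u i, hi⟩ : E)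
  have hw0 : ∀ z, (∀ i, ⟪u i, z⟫_ℂ = 0) → w z = 0 := by
    intro z hz
    have : z ∈ Eᗮ := by
      rw [hE, Submodule.orthogonal_closure, Submodule.mem_orthogonal]
      intro y hy
      induction hy using Submodule.span_induction with
      | mem x hx => obtain ⟨i, rfl⟩ := hx; exact hz i
      | zero => simp
      | add x y _ _ hx hy => rw [inner_add_left, hx, hy, add_zero]
      | smul c x _ hx => rw [inner_smul_left, hx, mul_zero]
    simp only [hw, ContinuousLinearMap.comp_apply]
    rw [Submodule.orthogonalProjectionOnto_apply_of_mem_orthogonal this, map_zero]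
  refine ⟨w, hwu, fun i ↦ ?_, hw0, fun z hz ↦ ?_⟩
  · refine ext_inner_left ℂ fun y ↦ ?_
    obtain ⟨hi, h1⟩ := hu i
    rw [ContinuousLinearMap.adjoint_inner_right, ← h1]
    simp only [hw, ContinuousLinearMap.comp_apply]
    rw [hWinner]
    exact Submodule.inner_orthogonalProjectionOnto_eq_of_mem_right (⟨u i, hi⟩ : E) y
  · have h1 : (innerSL ℂ z) ∘L w = 0 := clm_eq_of_family (u := u)
      (fun i ↦ by
        simp only [ContinuousLinearMap.comp_apply, hwu, innerSL_apply_apply,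
          zero_apply]
        rw [← inner_conj_symm, hz i, map_zero])
      fun y hy ↦ by simp [hw0 y hy]
    refine ext_inner_right ℂ fun y ↦ ?_
    rw [ContinuousLinearMap.adjoint_inner_left, inner_zero_left]
    exact congr($h1 y)

/-- The projection onto the closed span of a family of vectors. -/
lemma exists_projection (u : I → H) :
    ∃ q : H →L[ℂ] H, star q = q ∧ q * q = q ∧ (∀ i, q (u i) = u i) ∧
      (∀ z, (∀ i, ⟪u i, z⟫_ℂ = 0) → q z = 0) ∧
      ∀ T : H →L[ℂ] H, (∀ i, q (T (u i)) = T (u i)) → (∀ i, q (star T (u i)) = star T (u i)) →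
        q * T = T * q := by
  obtain ⟨q, h1, h2, h3, h4⟩ := exists_partialIsometry (u := u) (v := u) fun _ _ ↦ rfl
  have hs : star q = q := clm_eq_of_family (u := u) (fun i ↦ (h2 i).trans (h1 i).symm)
    fun z hz ↦ (h4 z hz).trans (h3 z hz).symm
  refine ⟨q, hs, ?_, h1, h3, fun T hT hT' ↦ ?_⟩
  · exact clm_eq_of_family (u := u) (fun i ↦ by simp [h1]) fun z hz ↦ by simp [h3 z hz]
  -- Invariance of the span under `T` gives `q T q = T q`; invariance under `T*` gives `q T q = q T`
  -- after taking adjoints.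
  · have key : ∀ T : H →L[ℂ] H, (∀ i, q (T (u i)) = T (u i)) → q * T * q = T * q := fun T hT ↦
      clm_eq_of_family (u := u) (fun i ↦ by simp [h1, hT]) fun z hz ↦ by simp [h3 z hz]
    have := congrArg star (key _ hT')
    rw [star_mul, star_mul, star_mul, hs, star_star] at this
    rw [← this, ← mul_assoc, key T hT]

end Gram

/-! ### The bicommutant theorem for vector functionals. -/

section Density

/-- A set of operators closed under products and adjoints. -/
structure IsStarSemigroup (S : Set (H →L[ℂ] H)) : Prop where
  mul_mem : ∀ s ∈ S, ∀ t ∈ S, s * t ∈ S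
  star_mem : ∀ s ∈ S, star s ∈ S

lemma IsStarSemigroup.star_eq {S : Set (H →L[ℂ] H)} (hS : IsStarSemigroup S) : star S = S := by
  ext x
  exact ⟨fun h ↦ by simpa using hS.star_mem _ h, fun h ↦ hS.star_mem _ h⟩

lemma IsStarSemigroup.mem_wstar_iff {S : Set (H →L[ℂ] H)} (hS : IsStarSemigroup S)
    (x : H →L[ℂ] H) : x ∈ wstar S ↔ x ∈ Set.centralizer (Set.centralizer S) := by
  rw [← SetLike.mem_coe, coe_wstar, hS.star_eq, Set.union_self]

/-- The closed span of `S ξ` is invariant under `S = S*`, so the projection onto it lies in the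
commutant of `S`. -/
lemma exists_cyclic_projection {S : Set (H →L[ℂ] H)} (hS : IsStarSemigroup S) (ξ : H) :
    ∃ q : H →L[ℂ] H, star q = q ∧ q * q = q ∧ (∀ s ∈ S, q (s ξ) = s ξ) ∧
      (∀ z, (∀ s ∈ S, ⟪s ξ, z⟫_ℂ = 0) → q z = 0) ∧ ∀ s ∈ S, q * s = s * q := by
  obtain ⟨q, h1, h2, h3, h4, h5⟩ := exists_projection fun s : S ↦ (s : H →L[ℂ] H) ξ
  refine ⟨q, h1, h2, fun s hs ↦ h3 ⟨s, hs⟩, fun z hz ↦ h4 z fun s ↦ hz s s.2, fun s hs ↦ ?_⟩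
  exact h5 s (fun t ↦ h3 ⟨s * t, hS.mul_mem s hs t t.2⟩)
    fun t ↦ h3 ⟨star s * t, hS.mul_mem _ (hS.star_mem s hs) t t.2⟩

/-- A vector functional which vanishes on a unital `*`-semigroup vanishes on its bicommutant. -/
lemma inner_eq_zero_of_mem_wstar {S : Set (H →L[ℂ] H)} (hS : IsStarSemigroup S) (h1 : 1 ∈ S)
    {ξ η : H} (h : ∀ s ∈ S, ⟪η, s ξ⟫_ℂ = 0) {x : H →L[ℂ] H} (hx : x ∈ wstar S) :
    ⟪η, x ξ⟫_ℂ = 0 := by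
  obtain ⟨q, hq1, hq2, hq3, hq4, hq5⟩ := exists_cyclic_projection hS ξ
  rw [hS.mem_wstar_iff] at hx
  -- An element of the bicommutant commutes with `q`, so `x ξ = x q ξ = q x ξ` stays in the cyclic
  -- subspace, to which `η` is orthogonal.
  have hxq : q * x = x * q := hx q fun s hs ↦ (hq5 s hs).symm
  have hξ : q ξ = ξ := hq3 1 h1
  have hη : q η = 0 := hq4 η fun s hs ↦ by rw [← inner_conj_symm, h s hs, map_zero]
  have : x ξ = q (x ξ) := by
    have := congr($hxq ξ)
    simp only [mul_apply_eq_comp, hξ] at this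
    exact this.symm
  rw [this, ← ContinuousLinearMap.adjoint_inner_left, ← ContinuousLinearMap.star_eq_adjoint, hq1,
    hη, inner_zero_left]

/-- The commutant of a von Neumann algebra with separating vector `ξ` has cyclic vector `ξ`. -/
lemma commutant_total {M : VonNeumannAlgebra H} {ξ : H} (h : ∀ x ∈ M, x ξ = 0 → x = 0) (z : H)
    (hz : ∀ t ∈ M.commutant, ⟪t ξ, z⟫_ℂ = 0) : z = 0 := by
  have hS : IsStarSemigroup (M.commutant : Set (H →L[ℂ] H)) :=
    ⟨fun s hs t ht ↦ mul_mem hs ht, fun s hs ↦ star_mem hs⟩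
  obtain ⟨q, hq1, hq2, hq3, hq4, hq5⟩ := exists_cyclic_projection hS ξ
  -- As `q` commutes with `M'` it lies in `M`; then `1 - q` is an element of `M` that kills the
  -- separating vector `ξ`.
  have hqM : q ∈ M := by
    rw [← commutant_commutant M, mem_commutant_iff]
    exact fun g hg ↦ (hq5 g hg).symm
  have := h (1 - q) (sub_mem (one_mem M) hqM) (by
    have := hq3 1 (one_mem M.commutant)
    simp only [one_apply_eq_self] at this
    simp [this])
  have hq : q = 1 := (sub_eq_zero.1 this).symm
  have := hq4 z hz
  rwa [hq] at this

end Density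

/-! ### Isomorphisms from equal moments with respect to separating vectors. -/

section Isomorphism

lemma isClosed_coe (M : VonNeumannAlgebra H) : IsClosed (M : Set (H →L[ℂ] H)) := by
  rw [← centralizer_centralizer M]
  exact Set.isClosed_centralizer _

/-- A von Neumann algebra is spanned by its unitaries. -/
lemma mem_span_unitary {M : VonNeumannAlgebra H} {x : H →L[ℂ] H} (hx : x ∈ M) :
    x ∈ Submodule.span ℂ {u | u ∈ M ∧ star u * u = 1} := by
  have : IsClosed (M.toStarSubalgebra : Set (H →L[ℂ] H)) := M.isClosed_coe
  have h : (⟨x, hx⟩ : M.toStarSubalgebra) ∈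
      Submodule.span ℂ (unitary M.toStarSubalgebra : Set M.toStarSubalgebra) := by
    rw [CStarAlgebra.span_unitary]; trivial
  have h' := Submodule.mem_map_of_mem
    (f := (M.toStarSubalgebra.subtype.toAlgHom.toLinearMap)) h
  rw [Submodule.map_span] at h'
  refine Submodule.span_mono ?_ h'
  rintro _ ⟨u, hu, rfl⟩
  exact ⟨u.2, congrArg Subtype.val (Unitary.star_mul_self_of_mem hu)⟩

variable {M : VonNeumannAlgebra H} {P : VonNeumannAlgebra L}

/-- `G` is a set of pairs `(x, y) ∈ M × P`, closed under products and adjoints, which generates both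
algebras and on which the vector states given by `ξ` and `η` agree. -/
structure IsMatching (M : VonNeumannAlgebra H) (P : VonNeumannAlgebra L) (ξ : H) (η : L)
    (G : Set ((H →L[ℂ] H) × (L →L[ℂ] L))) : Prop where
  has_one : 1 ∈ G
  has_mul : ∀ g ∈ G, ∀ h ∈ G, g * h ∈ G
  has_star : ∀ g ∈ G, star g ∈ G
  left : wstar (Prod.fst '' G) = M
  right : wstar (Prod.snd '' G) = P
  state : ∀ g ∈ G, ⟪ξ, g.1 ξ⟫_ℂ = ⟪η, g.2 η⟫_ℂ

namespace IsMatching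

variable {ξ : H} {η : L} {G : Set ((H →L[ℂ] H) × (L →L[ℂ] L))}

lemma symm (hG : IsMatching M P ξ η G) : IsMatching P M η ξ (Prod.swap '' G) where
  has_one := ⟨1, hG.has_one, rfl⟩
  has_mul := by
    rintro _ ⟨g, hg, rfl⟩ _ ⟨h, hh, rfl⟩
    exact ⟨g * h, hG.has_mul g hg h hh, rfl⟩
  has_star := by
    rintro _ ⟨g, hg, rfl⟩
    exact ⟨star g, hG.has_star g hg, rfl⟩
  left := by rw [Set.image_image]; exact hG.right
  right := by rw [Set.image_image]; exact hG.left
  state := by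
    rintro _ ⟨g, hg, rfl⟩
    exact (hG.state g hg).symm

lemma isStarSemigroup_fst (hG : IsMatching M P ξ η G) : IsStarSemigroup (Prod.fst '' G) where
  mul_mem := by
    rintro _ ⟨g, hg, rfl⟩ _ ⟨h, hh, rfl⟩
    exact ⟨g * h, hG.has_mul g hg h hh, rfl⟩
  star_mem := by
    rintro _ ⟨g, hg, rfl⟩
    exact ⟨star g, hG.has_star g hg, rfl⟩

lemma mem_right (hG : IsMatching M P ξ η G) {g} (hg : g ∈ G) : g.2 ∈ P := by
  rw [← hG.right]; exact subset_wstar _ ⟨g, hg, rfl⟩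

/-- The partial isometry `x ξ ↦ y η`, for `(x, y) ∈ G`. -/
lemma exists_intertwiner (hG : IsMatching M P ξ η G) :
    ∃ w : H →L[ℂ] L, (∀ g ∈ G, w (g.1 ξ) = g.2 η) ∧ (∀ g ∈ G, w.adjoint (g.2 η) = g.1 ξ) ∧
      (∀ z, (∀ g ∈ G, ⟪g.1 ξ, z⟫_ℂ = 0) → w z = 0) ∧
      (∀ z, (∀ g ∈ G, ⟪g.2 η, z⟫_ℂ = 0) → w.adjoint z = 0) := by
  obtain ⟨w, h1, h2, h3, h4⟩ := exists_partialIsometry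
    (u := fun g : G ↦ g.1.1 ξ) (v := fun g : G ↦ g.1.2 η) (fun g h ↦ by
      have := hG.state _ (hG.has_mul _ (hG.has_star _ g.2) _ h.2)
      simpa [ContinuousLinearMap.star_eq_adjoint, ContinuousLinearMap.adjoint_inner_right]
        using this)
  exact ⟨w, fun g hg ↦ h1 ⟨g, hg⟩, fun g hg ↦ h2 ⟨g, hg⟩, fun z hz ↦ h3 z fun g ↦ hz g g.2,
    fun z hz ↦ h4 z fun g ↦ hz g g.2⟩

/-- The properties of the partial isometry given by `exists_intertwiner`. -/
structure IsIntertwiner (ξ : H) (η : L) (G : Set ((H →L[ℂ] H) × (L →L[ℂ] L)))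
    (w : H →L[ℂ] L) : Prop where
  map : ∀ g ∈ G, w (g.1 ξ) = g.2 η
  adjoint_map : ∀ g ∈ G, w.adjoint (g.2 η) = g.1 ξ
  map_orthogonal : ∀ z, (∀ g ∈ G, ⟪g.1 ξ, z⟫_ℂ = 0) → w z = 0
  adjoint_orthogonal : ∀ z, (∀ g ∈ G, ⟪g.2 η, z⟫_ℂ = 0) → w.adjoint z = 0

lemma IsIntertwiner.symm {w : H →L[ℂ] L} (hw : IsIntertwiner ξ η G w) :
    IsIntertwiner η ξ (Prod.swap '' G) w.adjoint where
  map := by rintro _ ⟨g, hg, rfl⟩; exact hw.adjoint_map g hg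
  adjoint_map := by
    rintro _ ⟨g, hg, rfl⟩
    rw [ContinuousLinearMap.adjoint_adjoint]; exact hw.map g hg
  map_orthogonal := fun z hz ↦ hw.adjoint_orthogonal z fun g hg ↦ hz g.swap ⟨g, hg, rfl⟩
  adjoint_orthogonal := fun z hz ↦ by
    rw [ContinuousLinearMap.adjoint_adjoint]
    exact hw.map_orthogonal z fun g hg ↦ hz g.swap ⟨g, hg, rfl⟩

variable {w : H →L[ℂ] L}

lemma IsIntertwiner.comp_initial (hw : IsIntertwiner ξ η G w) :
    w ∘L (w.adjoint ∘L w) = w :=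
  clm_eq_of_family (u := fun g : G ↦ g.1.1 ξ)
    (fun g ↦ by simp [hw.map _ g.2, hw.adjoint_map _ g.2])
    fun z hz ↦ by simp [hw.map_orthogonal z fun g hg ↦ hz ⟨g, hg⟩]

/-- The span of the vectors `g.1 ξ` is invariant under the first components of `G`, and since `G` is
closed under adjoints so is its orthogonal complement, where `w` vanishes. -/
lemma comp_eq (hG : IsMatching M P ξ η G) (hw : IsIntertwiner ξ η G w) {g} (hg : g ∈ G) :
    w ∘L g.1 = g.2 ∘L w := by
  refine clm_eq_of_family (u := fun g : G ↦ g.1.1 ξ) (fun h ↦ ?_) fun z hz ↦ ?_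
  · have := hw.map _ (hG.has_mul g hg h h.2)
    simpa [hw.map _ h.2] using this
  · have hz' : ∀ g ∈ G, ⟪g.1 ξ, z⟫_ℂ = 0 := fun g hg ↦ hz ⟨g, hg⟩
    rw [ContinuousLinearMap.comp_apply, ContinuousLinearMap.comp_apply, hw.map_orthogonal z hz',
      map_zero]
    refine hw.map_orthogonal _ fun h hh ↦ ?_
    have := hz' _ (hG.has_mul _ (hG.has_star g hg) h hh)
    simpa [ContinuousLinearMap.star_eq_adjoint, ContinuousLinearMap.adjoint_inner_left] using this

lemma adjoint_comp_eq (hG : IsMatching M P ξ η G) (hw : IsIntertwiner ξ η G w) {g} (hg : g ∈ G) :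
    w.adjoint ∘L g.2 = g.1 ∘L w.adjoint :=
  comp_eq hG.symm hw.symm (g := g.swap) (Set.mem_image_of_mem _ hg)

/-- Operators of the form `w* r w`, with `r` in the commutant of `P`, commute with `M`. -/
lemma compress_commute (hG : IsMatching M P ξ η G) (hw : IsIntertwiner ξ η G w)
    {r : L →L[ℂ] L} (hr : r ∈ P.commutant) {x : H →L[ℂ] H} (hx : x ∈ M) (z : H) :
    w.adjoint (r (w (x z))) = x (w.adjoint (r (w z))) := by
  rw [← hG.left, hG.isStarSemigroup_fst.mem_wstar_iff] at hx
  have := hx (w.adjoint ∘L r ∘L w) (by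
    rintro _ ⟨g, hg, rfl⟩
    have h1 := hG.comp_eq hw hg
    have h2 := hG.adjoint_comp_eq hw hg
    have h3 := mem_commutant_iff.1 hr _ (hG.mem_right hg)
    ext v
    have e1 := congr($h1 v)
    have e2 := congr($h2 (r (w v)))
    have e3 := congr($h3 (w v))
    simp only [ContinuousLinearMap.comp_apply, mul_apply_eq_comp] at e1 e2 e3 ⊢
    rw [e1, ← e3, e2])
  exact congr($this z)

lemma initial_commute (hG : IsMatching M P ξ η G) (hw : IsIntertwiner ξ η G w)
    {x : H →L[ℂ] H} (hx : x ∈ M) (z : H) :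
    w.adjoint (w (x z)) = x (w.adjoint (w z)) :=
  compress_commute hG hw (one_mem P.commutant) hx z

/-- As `η` is separating for `P`, it is cyclic for `P'`, so `y` may be prescribed by `t g.2 η ↦ t w
x g.1 ξ` with `t ∈ P'` and `g ∈ G`. The Gram matrices agree because `w* t* t' w` commutes with `x`
and `x` is isometric. The formula commutes with `P'` by construction, which puts `y` in `P'' = P`.
-/
lemma exists_right_of_unitary (hG : IsMatching M P ξ η G) (hw : IsIntertwiner ξ η G w)
    (hη : ∀ y ∈ P, y η = 0 → y = 0) {x : H →L[ℂ] H} (hx : x ∈ M) (hxu : star x * x = 1) :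
    ∃ y ∈ P, w ∘L x = y ∘L w := by
  have hx_inner : ∀ z z', ⟪x z, x z'⟫_ℂ = ⟪z, z'⟫_ℂ := fun z z' ↦ by
    rw [← ContinuousLinearMap.adjoint_inner_right, ← ContinuousLinearMap.star_eq_adjoint]
    exact congr(⟪z, $hxu z'⟫_ℂ)
  obtain ⟨y, hy, -⟩ := exists_partialIsometry
    (u := fun i : P.commutant × G ↦ (i.1 : L →L[ℂ] L) (i.2.1.2 η))
    (v := fun i : P.commutant × G ↦ (i.1 : L →L[ℂ] L) (w (x (i.2.1.1 ξ)))) (by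
      rintro ⟨t, g⟩ ⟨t', g'⟩
      have hr : star (t : L →L[ℂ] L) * t' ∈ P.commutant := mul_mem (star_mem t.2) t'.2
      have h1 := compress_commute hG hw hr hx (g'.1.1 ξ)
      have h2 : ∀ a b : H, ⟪(t : L →L[ℂ] L) (w a), (t' : L →L[ℂ] L) (w b)⟫_ℂ
          = ⟪a, w.adjoint ((star (t : L →L[ℂ] L) * t') (w b))⟫_ℂ := fun a b ↦ by
        rw [ContinuousLinearMap.adjoint_inner_right, mul_apply_eq_comp,
          ContinuousLinearMap.star_eq_adjoint, ContinuousLinearMap.adjoint_inner_right]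
      change ⟪(t : L →L[ℂ] L) (g.1.2 η), (t' : L →L[ℂ] L) (g'.1.2 η)⟫_ℂ =
        ⟪(t : L →L[ℂ] L) (w (x (g.1.1 ξ))), (t' : L →L[ℂ] L) (w (x (g'.1.1 ξ)))⟫_ℂ
      rw [← hw.map _ g.2, ← hw.map _ g'.2, h2, h2, h1, hx_inner])
  have htot : ∀ z : L, (∀ i : P.commutant × G, ⟪(i.1 : L →L[ℂ] L) (i.2.1.2 η), z⟫_ℂ = 0) →
      z = 0 := fun z hz ↦ commutant_total hη z fun t ht ↦ hz (⟨t, ht⟩, ⟨1, hG.has_one⟩)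
  refine ⟨y, ?_, ?_⟩
  · rw [← commutant_commutant P, mem_commutant_iff]
    intro t ht
    refine clm_eq_of_total htot ?_
    rintro ⟨s, g⟩
    have h1 := hy (s, g)
    have h2 := hy (⟨t * s, mul_mem ht s.2⟩, g)
    simp only [mul_apply_eq_comp] at h1 h2 ⊢
    rw [h1, h2]
  · refine clm_eq_of_family (u := fun g : G ↦ g.1.1 ξ) (fun g ↦ ?_) fun z hz ↦ ?_
    · have h1 := hy (1, g)
      simp only [ContinuousLinearMap.comp_apply, hw.map _ g.2]
      exact h1.symm
    -- Here `w z = 0`, and since `w* w` commutes with `x`, also `w x z = w (w* w) x z = w x w* w z =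
    -- 0`.
    · have h0 : w z = 0 := hw.map_orthogonal z fun g hg ↦ hz ⟨g, hg⟩
      have h1 := initial_commute hG hw hx z
      rw [h0, map_zero, map_zero] at h1
      have h2 := congr($(hw.comp_initial) (x z))
      simp only [ContinuousLinearMap.comp_apply, h1, map_zero] at h2
      simp only [ContinuousLinearMap.comp_apply, h0, map_zero, ← h2]

lemma exists_right (hG : IsMatching M P ξ η G) (hw : IsIntertwiner ξ η G w)
    (hη : ∀ y ∈ P, y η = 0 → y = 0) {x : H →L[ℂ] H} (hx : x ∈ M) :
    ∃ y ∈ P, w ∘L x = y ∘L w := by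
  have hx' := mem_span_unitary hx
  clear hx
  induction hx' using Submodule.span_induction with
  | mem u hu => exact exists_right_of_unitary hG hw hη hu.1 hu.2
  | zero => exact ⟨0, zero_mem P, by simp⟩
  | add a b _ _ ha hb =>
    obtain ⟨y, hy, h⟩ := ha
    obtain ⟨y', hy', h'⟩ := hb
    exact ⟨y + y', add_mem hy hy', by rw [ContinuousLinearMap.comp_add, h, h',
      ContinuousLinearMap.add_comp]⟩
  | smul c a _ ha =>
    obtain ⟨y, hy, h⟩ := ha
    exact ⟨c • y, P.toStarSubalgebra.smul_mem hy c, by rw [ContinuousLinearMap.comp_smul, h,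
      ContinuousLinearMap.smul_comp]⟩

lemma eq_of_comp_eq (hG : IsMatching M P ξ η G) (hw : IsIntertwiner ξ η G w)
    (hη : ∀ y ∈ P, y η = 0 → y = 0) {y y' : L →L[ℂ] L} (hy : y ∈ P) (hy' : y' ∈ P)
    (h : y ∘L w = y' ∘L w) : y = y' := by
  have h1 := congr($h ξ)
  have h2 : w ξ = η := by simpa using hw.map 1 hG.has_one
  simp only [ContinuousLinearMap.comp_apply, h2] at h1
  exact sub_eq_zero.1 (hη _ (sub_mem hy hy') (by simp [h1]))

/-- Adjoints turn `w x = y w` into `x* w* = w* y*`. Since `w* w` commutes with `M`, `w w*` commutes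
with `P` and `w w* w = w`, this yields `w x* = w x* w* w = w w* y* w = y* w`. -/
lemma comp_star_eq (hG : IsMatching M P ξ η G) (hw : IsIntertwiner ξ η G w)
    {x : H →L[ℂ] H} (hx : x ∈ M) {y : L →L[ℂ] L} (hy : y ∈ P) (h : w ∘L x = y ∘L w) :
    w ∘L star x = star y ∘L w := by
  have h1 : star x ∘L w.adjoint = w.adjoint ∘L star y := by
    have := congrArg ContinuousLinearMap.adjoint h
    rwa [ContinuousLinearMap.adjoint_comp, ContinuousLinearMap.adjoint_comp] at this
  ext z
  have h2 := congr($(hw.comp_initial) (star x z))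
  have h3 := initial_commute hG hw (star_mem hx) z
  have h4 := congr($h1 (w z))
  have h5 := initial_commute hG.symm hw.symm (star_mem hy) (w z)
  rw [ContinuousLinearMap.adjoint_adjoint] at h5
  have h6 := congr($(hw.comp_initial) z)
  simp only [ContinuousLinearMap.comp_apply] at *
  rw [← h2, h3, h4, h5, h6]

/-- A state-preserving matching of generators extends to an isomorphism. -/
theorem exists_equiv (hG : IsMatching M P ξ η G) (hξ : ∀ x ∈ M, x ξ = 0 → x = 0)
    (hη : ∀ y ∈ P, y η = 0 → y = 0) :
    ∃ α : M.Elem ≃⋆ₐ[ℂ] P.Elem, ∀ x : M.Elem,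
      ⟪η, (α x : L →L[ℂ] L) η⟫_ℂ = ⟪ξ, (x : H →L[ℂ] H) ξ⟫_ℂ := by
  obtain ⟨w, h1, h2, h3, h4⟩ := hG.exists_intertwiner
  have hw : IsIntertwiner ξ η G w := ⟨h1, h2, h3, h4⟩
  have hex : ∀ x : M.Elem, ∃ y : P.Elem, w ∘L (x : H →L[ℂ] H) = (y : L →L[ℂ] L) ∘L w := fun x ↦ by
    obtain ⟨y, hy, h⟩ := exists_right hG hw hη x.2
    exact ⟨⟨y, hy⟩, h⟩
  choose f hf using hex
  have huniq : ∀ (x : M.Elem) (y : P.Elem), w ∘L (x : H →L[ℂ] H) = (y : L →L[ℂ] L) ∘L w →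
      f x = y := fun x y h ↦
    Subtype.ext (eq_of_comp_eq hG hw hη (f x).2 y.2 ((hf x).symm.trans h))
  let F : M.Elem →⋆ₐ[ℂ] P.Elem :=
    { toFun := f
      map_one' := huniq _ _ (by ext; simp)
      map_zero' := huniq _ _ (by ext; simp)
      map_mul' := fun x y ↦ huniq _ _ (by
        ext z
        have e1 := congr($(hf x) ((y : H →L[ℂ] H) z))
        have e2 := congr($(hf y) z)
        simp only [ContinuousLinearMap.comp_apply] at e1 e2
        simp [e1, e2])
      map_add' := fun x y ↦ huniq _ _ (by
        ext z
        have e1 := congr($(hf x) z)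
        have e2 := congr($(hf y) z)
        simp only [ContinuousLinearMap.comp_apply] at e1 e2
        simp [e1, e2])
      commutes' := fun c ↦ huniq _ _ (by
        ext z
        simp [Algebra.algebraMap_eq_smul_one])
      map_star' := fun x ↦ huniq _ _ (comp_star_eq hG hw x.2 (f x).2 (hf x)) }
  -- Equal images give `w x = w x'`, hence `w x* = w x'*`, hence `x w* = x' w*`; now `w* η = ξ` is
  -- separating for `M`.
  have hinj : Function.Injective F := by
    intro x x' h
    have e : w ∘L (x : H →L[ℂ] H) = w ∘L (x' : H →L[ℂ] H) := by
      rw [hf, hf]; exact congrArg (fun y : P.Elem ↦ (y : L →L[ℂ] L) ∘L w) h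
    have hs := comp_star_eq hG hw x.2 (f x).2 (hf x)
    have hs' := comp_star_eq hG hw x'.2 (f x).2 (e ▸ hf x)
    have e' := congrArg ContinuousLinearMap.adjoint (hs.trans hs'.symm)
    simp only [ContinuousLinearMap.adjoint_comp, ContinuousLinearMap.star_eq_adjoint,
      ContinuousLinearMap.adjoint_adjoint] at e'
    exact Subtype.ext (eq_of_comp_eq hG.symm hw.symm hξ x.2 x'.2 e')
  -- The reversed matching, applied to `y*`, gives `w* y* = x w*`; its adjoint says that `x*` is
  -- mapped to `y`.
  have hsurj : Function.Surjective F := by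
    intro y
    obtain ⟨x, hx, h⟩ := exists_right hG.symm hw.symm hξ (star_mem y.2)
    refine ⟨⟨star x, star_mem hx⟩, huniq _ _ ?_⟩
    have := congrArg ContinuousLinearMap.adjoint h
    simp only [ContinuousLinearMap.adjoint_comp, ContinuousLinearMap.star_eq_adjoint,
      ContinuousLinearMap.adjoint_adjoint] at this
    exact this.symm
  refine ⟨StarAlgEquiv.ofBijective F ⟨hinj, hsurj⟩, fun x ↦ ?_⟩
  change ⟪η, (f x : L →L[ℂ] L) η⟫_ℂ = _
  have e1 : w ξ = η := by simpa using hw.map 1 hG.has_one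
  have e2 : w.adjoint η = ξ := by simpa using hw.adjoint_map 1 hG.has_one
  have e3 := congr($(hf x) ξ)
  simp only [ContinuousLinearMap.comp_apply, e1] at e3
  rw [← e3, ← ContinuousLinearMap.adjoint_inner_left, e2]

end IsMatching

end Isomorphism

/-! ### Amplifications and their bicommutants. -/

section Amplification

/-- The Hilbert space direct sum of copies of `H`, indexed by `ι`. -/
abbrev Amp (ι : Type*) (H : Type*) [NormedAddCommGroup H] : Type _ := lp (fun _ : ι ↦ H) 2

variable {ι : Type*}

/-- The diagonal operator `⊕ᵢ x` on `⊕ᵢ H`. -/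
def amp (ι : Type*) (x : H →L[ℂ] H) : Amp ι H →L[ℂ] Amp ι H :=
  lp.mapCLM 2 (fun _ ↦ x) (norm_nonneg x) fun _ ↦ le_rfl

@[simp]
lemma amp_apply (x : H →L[ℂ] H) (f : Amp ι H) (i : ι) : amp ι x f i = x (f i) := by
  simp [amp]

lemma amp_zero : amp ι (0 : H →L[ℂ] H) = 0 := by ext f i; simp

lemma amp_one : amp ι (1 : H →L[ℂ] H) = 1 := by ext f i; simp

lemma amp_mul (x y : H →L[ℂ] H) : amp ι (x * y) = amp ι x * amp ι y := by ext f i; simp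

lemma amp_sub (x y : H →L[ℂ] H) : amp ι (x - y) = amp ι x - amp ι y := by ext f i; simp

lemma amp_smul (c : ℂ) (x : H →L[ℂ] H) : amp ι (c • x) = c • amp ι x := by ext f i; simp

lemma amp_star (x : H →L[ℂ] H) : amp ι (star x) = star (amp ι x) := by
  rw [ContinuousLinearMap.star_eq_adjoint (amp ι x), ContinuousLinearMap.eq_adjoint_iff]
  intro f g
  simp [lp.inner_eq_tsum, ContinuousLinearMap.star_eq_adjoint,
    ContinuousLinearMap.adjoint_inner_left]

/-- The map `x ↦ ⊕ᵢ x`. -/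
def ampHom (ι : Type*) : (H →L[ℂ] H) →⋆ₐ[ℂ] (Amp ι H →L[ℂ] Amp ι H) where
  toFun := amp ι
  map_one' := amp_one
  map_mul' := amp_mul
  map_zero' := amp_zero
  map_add' x y := by ext f i; simp
  commutes' c := by ext f i; simp [Algebra.algebraMap_eq_smul_one]
  map_star' := amp_star

variable [DecidableEq ι]

/-- The inclusion of the `i`-th summand. -/
abbrev ampIncl (H : Type*) [NormedAddCommGroup H] [InnerProductSpace ℂ H] (i : ι) :
    H →L[ℂ] Amp ι H := lp.singleContinuousLinearMap ℂ (fun _ : ι ↦ H) 2 i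

/-- The projection onto the `i`-th summand. -/
abbrev ampCoord (H : Type*) [NormedAddCommGroup H] [InnerProductSpace ℂ H] (i : ι) :
    Amp ι H →L[ℂ] H := lp.evalCLM ℂ (fun _ : ι ↦ H) 2 i

lemma ampCoord_apply (i : ι) (f : Amp ι H) : ampCoord H i f = f i := rfl

lemma amp_ampIncl (x : H →L[ℂ] H) (i : ι) (z : H) :
    amp ι x (ampIncl H i z) = ampIncl H i (x z) := by
  ext j
  rw [amp_apply]
  by_cases h : j = i
  · subst h; simp
  · simp [h]

lemma amp_ext {S T : Amp ι H →L[ℂ] Amp ι H}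
    (h : ∀ i j z, S (ampIncl H j z) i = T (ampIncl H j z) i) : S = T := by
  refine lp.ext_continuousLinearMap (by simp) fun j ↦ ?_
  ext z i
  exact h i j z

lemma amp_injective [Nonempty ι] : Function.Injective (amp ι : (H →L[ℂ] H) → _) := by
  intro x y h
  obtain ⟨i⟩ := ‹Nonempty ι›
  ext z
  have := congr($h (ampIncl H i z) i)
  simpa using this

/-- The matrix entries of an operator commuting with all `⊕ᵢ s` commute with every `s ∈ S`. -/
lemma amp_commute {S : Set (H →L[ℂ] H)} {x : H →L[ℂ] H}
    (hx : x ∈ Set.centralizer (Set.centralizer S)) :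
    amp ι x ∈ Set.centralizer (Set.centralizer (amp ι '' S)) := by
  intro t ht
  have key : ∀ i j, ampCoord H i ∘L t ∘L ampIncl H j ∈ Set.centralizer S := by
    intro i j s hs
    ext z
    have := congr($(ht _ ⟨s, hs, rfl⟩) (ampIncl H j z) i)
    simp only [mul_apply_eq_comp, amp_apply, amp_ampIncl] at this
    exact this
  refine amp_ext fun i j z ↦ ?_
  have := congr($(hx _ (key i j)) z)
  simp only [mul_apply_eq_comp, amp_apply, amp_ampIncl]
  exact this

/-- The matrix units commute with all diagonal operators `⊕ᵢ s`, so `y` commutes with them and is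
therefore diagonal with constant entry. -/
lemma mem_image_amp [Nonempty ι] {S : Set (H →L[ℂ] H)} {y : Amp ι H →L[ℂ] Amp ι H}
    (hy : y ∈ Set.centralizer (Set.centralizer (amp ι '' S))) :
    ∃ x ∈ Set.centralizer (Set.centralizer S), amp ι x = y := by
  obtain ⟨i₀⟩ := ‹Nonempty ι›
  have h1 : ∀ i j, y * (ampIncl H i ∘L ampCoord H j) = (ampIncl H i ∘L ampCoord H j) * y := by
    intro i j
    refine (hy _ ?_).symm
    rintro _ ⟨s, -, rfl⟩
    ext f : 1
    simp only [mul_apply_eq_comp, ContinuousLinearMap.comp_apply, amp_ampIncl, ampCoord_apply,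
      amp_apply]
  have h2 : ∀ i j z, y (ampIncl H i z) j =
      ampIncl H i (y (ampIncl H i₀ z) i₀) j := by
    intro i j z
    have := congr($(h1 i i₀) (ampIncl H i₀ z) j)
    simpa [ContinuousLinearMap.comp_apply, ampCoord_apply] using this
  have h3 : amp ι (ampCoord H i₀ ∘L y ∘L ampIncl H i₀) = y := by
    refine amp_ext fun i j z ↦ ?_
    rw [amp_ampIncl, h2]
    rfl
  refine ⟨ampCoord H i₀ ∘L y ∘L ampIncl H i₀, fun t ht ↦ amp_injective (ι := ι) ?_, h3⟩
  rw [amp_mul, amp_mul, h3]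
  refine hy _ ?_
  rintro _ ⟨s, hs, rfl⟩
  rw [← amp_mul, ← amp_mul, ht s hs]

/-- The von Neumann algebra of the operators `⊕ᵢ x`, for `x ∈ M`. -/
def ampAlgebra (ι : Type*) [DecidableEq ι] [Nonempty ι] (M : VonNeumannAlgebra H) :
    VonNeumannAlgebra (Amp ι H) where
  toStarSubalgebra := M.toStarSubalgebra.map (ampHom ι)
  centralizer_centralizer' := by
    refine Set.Subset.antisymm (fun y hy ↦ ?_) Set.subset_centralizer_centralizer
    obtain ⟨x, hx, rfl⟩ := mem_image_amp (ι := ι) (S := (M : Set (H →L[ℂ] H))) hy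
    rw [centralizer_centralizer] at hx
    exact ⟨x, hx, rfl⟩

lemma coe_ampAlgebra [Nonempty ι] (M : VonNeumannAlgebra H) :
    (ampAlgebra ι M : Set (Amp ι H →L[ℂ] Amp ι H)) = amp ι '' M := rfl

lemma amp_mem_ampAlgebra [Nonempty ι] {M : VonNeumannAlgebra H} {x : H →L[ℂ] H} (hx : x ∈ M) :
    amp ι x ∈ ampAlgebra ι M := ⟨x, hx, rfl⟩

lemma wstar_image_amp [Nonempty ι] (S : Set (H →L[ℂ] H)) :
    wstar (amp ι '' S) = ampAlgebra ι (wstar S) := by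
  apply SetLike.coe_injective
  have h : star (amp ι '' S) = amp ι '' star S := by
    ext y
    constructor
    · rintro ⟨x, hx, h⟩
      exact ⟨star x, by simpa using hx, by rw [amp_star, h, star_star]⟩
    · rintro ⟨x, hx, rfl⟩
      exact ⟨star x, hx, amp_star _⟩
  rw [coe_ampAlgebra, coe_wstar, coe_wstar, h, ← Set.image_union]
  ext y
  exact ⟨mem_image_amp, by rintro ⟨x, hx, rfl⟩; exact amp_commute hx⟩

/-- `x ↦ ⊕ᵢ x`, as an isomorphism. -/
def ampEquiv (ι : Type*) [DecidableEq ι] [Nonempty ι] (M : VonNeumannAlgebra H) :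
    M.Elem ≃⋆ₐ[ℂ] (ampAlgebra ι M).Elem :=
  StarAlgEquiv.ofBijective
    (StarAlgHom.codRestrict ((ampHom ι).comp M.toStarSubalgebra.subtype)
      (ampAlgebra ι M).toStarSubalgebra fun x ↦ amp_mem_ampAlgebra x.2)
    ⟨fun x y h ↦ Subtype.ext (amp_injective (congrArg Subtype.val h)), by
      rintro ⟨_, x, hx, rfl⟩
      exact ⟨⟨x, hx⟩, rfl⟩⟩

lemma coe_ampEquiv [Nonempty ι] {M : VonNeumannAlgebra H} (x : M.Elem) :
    (ampEquiv ι M x : Amp ι H →L[ℂ] Amp ι H) = amp ι (x : H →L[ℂ] H) := rfl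

lemma IsStarSemigroup.image_amp {S : Set (H →L[ℂ] H)} (hS : IsStarSemigroup S) :
    IsStarSemigroup (amp ι '' S) where
  mul_mem := by
    rintro _ ⟨s, hs, rfl⟩ _ ⟨t, ht, rfl⟩
    exact ⟨s * t, hS.mul_mem s hs t ht, amp_mul _ _⟩
  star_mem := by
    rintro _ ⟨s, hs, rfl⟩
    exact ⟨star s, hS.star_mem s hs, amp_star _⟩

/-- A sum of two vector functionals which vanishes on a unital `*`-semigroup vanishes on its
bicommutant. -/
lemma inner_add_inner_eq_zero_of_mem_wstar {S : Set (H →L[ℂ] H)} (hS : IsStarSemigroup S)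
    (h1 : 1 ∈ S) {ξ η ξ' η' : H} (h : ∀ s ∈ S, ⟪η, s ξ⟫_ℂ + ⟪η', s ξ'⟫_ℂ = 0) {x : H →L[ℂ] H}
    (hx : x ∈ wstar S) : ⟪η, x ξ⟫_ℂ + ⟪η', x ξ'⟫_ℂ = 0 := by
  -- A sum of two vector functionals is a single vector functional on `H ⊕ H`.
  have key : ∀ y : H →L[ℂ] H, ⟪ampIncl H false η + ampIncl H true η',
      amp Bool y (ampIncl H false ξ + ampIncl H true ξ')⟫_ℂ = ⟪η, y ξ⟫_ℂ + ⟪η', y ξ'⟫_ℂ := by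
    intro y
    simp [lp.inner_single_left]
  rw [← key]
  refine inner_eq_zero_of_mem_wstar (hS.image_amp (ι := Bool)) ⟨1, h1, amp_one⟩ ?_ ?_
  · rintro _ ⟨s, hs, rfl⟩
    rw [key]; exact h s hs
  · rw [wstar_image_amp]
    exact amp_mem_ampAlgebra hx

end Amplification

/-! ### Normal states as vector states; state-preserving homomorphisms. -/

section NormalStates

variable {M : VonNeumannAlgebra H} {P : VonNeumannAlgebra L}

/-- A normal state is a vector state of the infinite amplification. -/
lemma IsNormalState.exists_vector {φ : M.Elem →ₗ[ℂ] ℂ} (hφ : IsNormalState M φ) :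
    ∃ Ξ : Amp ℕ H, ∀ x : M.Elem, φ x = ⟪Ξ, amp ℕ (x : H →L[ℂ] H) Ξ⟫_ℂ := by
  obtain ⟨ξ, hξ⟩ := hφ.normal
  -- The case `x = 1` shows that the vectors are square-summable, so they form one vector of the
  -- amplification.
  have h1 := (hξ 1).summable
  have h2 : Summable fun n ↦ ‖ξ n‖ ^ (2 : ℝ) := by
    have := (Complex.reCLM.hasSum h1.hasSum).summable
    refine this.congr fun n ↦ ?_
    simp [← Complex.ofReal_pow]
  refine ⟨⟨ξ, memℓp_gen (by simpa using h2)⟩, fun x ↦ ?_⟩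
  rw [lp.inner_eq_tsum, ← (hξ x).tsum_eq]
  simp

lemma IsFaithfulNormalState.separating {φ : M.Elem →ₗ[ℂ] ℂ} (hφ : IsFaithfulNormalState M φ)
    {Ξ : Amp ℕ H} (hΞ : ∀ x : M.Elem, φ x = ⟪Ξ, amp ℕ (x : H →L[ℂ] H) Ξ⟫_ℂ) :
    ∀ x ∈ ampAlgebra ℕ M, x Ξ = 0 → x = 0 := by
  rintro _ ⟨x, hx, rfl⟩ h
  have h' : amp ℕ x Ξ = 0 := h
  have := hφ.faithful ⟨x, hx⟩ (by
    rw [hΞ]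
    change ⟪Ξ, amp ℕ (star x * x) Ξ⟫_ℂ = 0
    rw [amp_mul, mul_apply_eq_comp, h', map_zero, inner_zero_right])
  change amp ℕ x = 0
  rw [show x = 0 from congrArg Subtype.val this, amp_zero]

/-- Two von Neumann algebras with faithful normal states are isomorphic if they have generating
`*`-semigroups with the same moments. -/
theorem exists_statePreserving_equiv {φ : M.Elem →ₗ[ℂ] ℂ} (hφ : IsFaithfulNormalState M φ)
    {ω : P.Elem →ₗ[ℂ] ℂ} (hω : IsFaithfulNormalState P ω) {G : Set (M.Elem × P.Elem)}
    (h1 : 1 ∈ G) (hmul : ∀ g ∈ G, ∀ h ∈ G, g * h ∈ G) (hstar : ∀ g ∈ G, star g ∈ G)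
    (hl : wstar ((fun g : M.Elem × P.Elem ↦ (g.1 : H →L[ℂ] H)) '' G) = M)
    (hr : wstar ((fun g : M.Elem × P.Elem ↦ (g.2 : L →L[ℂ] L)) '' G) = P)
    (hst : ∀ g ∈ G, φ g.1 = ω g.2) :
    ∃ α : M.Elem ≃⋆ₐ[ℂ] P.Elem, ∀ x, ω (α x) = φ x := by
  obtain ⟨ξ, hξ⟩ := hφ.exists_vector
  obtain ⟨η, hη⟩ := hω.exists_vector
  have hG : IsMatching (ampAlgebra ℕ M) (ampAlgebra ℕ P) ξ η
      ((fun g : M.Elem × P.Elem ↦ (amp ℕ (g.1 : H →L[ℂ] H), amp ℕ (g.2 : L →L[ℂ] L))) '' G) :=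
    { has_one := ⟨1, h1, Prod.ext amp_one amp_one⟩
      has_mul := by
        rintro _ ⟨g, hg, rfl⟩ _ ⟨h, hh, rfl⟩
        exact ⟨g * h, hmul g hg h hh, Prod.ext (amp_mul _ _) (amp_mul _ _)⟩
      has_star := by
        rintro _ ⟨g, hg, rfl⟩
        exact ⟨star g, hstar g hg, Prod.ext (amp_star _) (amp_star _)⟩
      left := by
        conv_rhs => rw [← hl]
        rw [← wstar_image_amp, Set.image_image, Set.image_image]
      right := by
        conv_rhs => rw [← hr]
        rw [← wstar_image_amp, Set.image_image, Set.image_image]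
      state := by
        rintro _ ⟨g, hg, rfl⟩
        exact ((hξ _).symm.trans (hst g hg)).trans (hη _) }
  obtain ⟨α, hα⟩ := hG.exists_equiv (hφ.separating hξ) (hω.separating hη)
  refine ⟨((ampEquiv ℕ M).trans α).trans (ampEquiv ℕ P).symm, fun x ↦ ?_⟩
  rw [hη, hξ, ← coe_ampEquiv, ← coe_ampEquiv, ← hα]
  simp

/-- A state-preserving `*`-homomorphism is normal: it maps the von Neumann algebra generated by `S`
to the one generated by the image of `S`. -/
lemma map_commute_of_statePreserving {χ : M.Elem →ₗ[ℂ] ℂ} (hχ : IsNormalState M χ)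
    {ω : P.Elem →ₗ[ℂ] ℂ} (hω : IsFaithfulNormalState P ω) (f : M.Elem →⋆ₐ[ℂ] P.Elem)
    (hf : ∀ x, ω (f x) = χ x) {S : Set (H →L[ℂ] H)} (hS : IsStarSemigroup S) (h1 : 1 ∈ S)
    (hgen : wstar S = M) {s : L →L[ℂ] L}
    (hs : ∀ a : M.Elem, (a : H →L[ℂ] H) ∈ S →
      s * (f a : L →L[ℂ] L) = (f a : L →L[ℂ] L) * s) (x : M.Elem) :
    s * (f x : L →L[ℂ] L) = (f x : L →L[ℂ] L) * s := by
  obtain ⟨ξ, hξ⟩ := hχ.exists_vector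
  obtain ⟨η, hη⟩ := hω.exists_vector
  have htot := commutant_total (hω.separating hη)
  obtain ⟨w, hw, -⟩ := exists_partialIsometry
    (u := fun x : M.Elem ↦ amp ℕ (x : H →L[ℂ] H) ξ) (v := fun x ↦ amp ℕ (f x : L →L[ℂ] L) η) (by
      intro x y
      have h2 : ω (star (f x) * f y) = χ (star x * y) := by rw [← hf, map_mul f, map_star f]
      rw [hξ, hη] at h2
      change ⟪η, amp ℕ (star (f x : L →L[ℂ] L) * (f y : L →L[ℂ] L)) η⟫_ℂ =
        ⟪ξ, amp ℕ (star (x : H →L[ℂ] H) * (y : H →L[ℂ] H)) ξ⟫_ℂ at h2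
      rw [amp_mul, amp_mul, amp_star, amp_star, mul_apply_eq_comp, mul_apply_eq_comp,
        inner_star_apply_right, inner_star_apply_right] at h2
      exact h2.symm)
  set X : Amp ℕ L →L[ℂ] Amp ℕ L := amp ℕ s
  have hcomm : ∀ t ∈ (ampAlgebra ℕ P).commutant, ∀ a : P.Elem, ∀ z,
      amp ℕ (a : L →L[ℂ] L) (t z) = t (amp ℕ (a : L →L[ℂ] L) z) := fun t ht a z ↦
    congr($(mem_commutant_iff.1 ht _ (amp_mem_ampAlgebra a.2)) z)
  -- Operators in the commutant move past `f a`, and `f a η = w (a ξ)`. Thus the matrix coefficients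
  -- of `s f(a)` and of `f(a) s` between the vectors `t η` and `t' η` become vector functionals of
  -- `a` on the source side, where the density lemma applies. Since `η` is separating, such vectors
  -- are total.
  have e1 : ∀ t ∈ (ampAlgebra ℕ P).commutant, ∀ t' ∈ (ampAlgebra ℕ P).commutant, ∀ a : M.Elem,
      ⟪t η, X (amp ℕ (f a : L →L[ℂ] L) (t' η))⟫_ℂ =
        ⟪w.adjoint (star t' (star X (t η))), amp ℕ (a : H →L[ℂ] H) ξ⟫_ℂ := by
    intro t ht t' ht' a
    rw [hcomm t' ht', ← inner_star_apply_left X, ← inner_star_apply_left t', ← hw a, ContinuousLinearMap.adjoint_inner_left]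
  have e2 : ∀ t ∈ (ampAlgebra ℕ P).commutant, ∀ t' ∈ (ampAlgebra ℕ P).commutant, ∀ a : M.Elem,
      ⟪t η, amp ℕ (f a : L →L[ℂ] L) (X (t' η))⟫_ℂ =
        ⟪ξ, amp ℕ (a : H →L[ℂ] H) (w.adjoint (star t (X (t' η))))⟫_ℂ := by
    intro t ht t' ht' a
    rw [← inner_star_apply_left (amp ℕ (f a : L →L[ℂ] L)), ← amp_star, show star (f a : L →L[ℂ] L) = (f (star a) : L →L[ℂ] L) by
      rw [map_star]; rfl, hcomm t ht, ← inner_star_apply_right t, ← hw (star a),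
      ← ContinuousLinearMap.adjoint_inner_right,
      show ((star a : M.Elem) : H →L[ℂ] H) = star (a : H →L[ℂ] H) from rfl, amp_star,
      inner_star_apply_left]
  have hSM : ∀ a ∈ S, a ∈ M := fun a ha ↦ by rw [← hgen]; exact subset_wstar _ ha
  have key : ∀ t ∈ (ampAlgebra ℕ P).commutant, ∀ t' ∈ (ampAlgebra ℕ P).commutant,
      ⟪t η, X (amp ℕ (f x : L →L[ℂ] L) (t' η))⟫_ℂ =
        ⟪t η, amp ℕ (f x : L →L[ℂ] L) (X (t' η))⟫_ℂ := by
    intro t ht t' ht'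
    rw [e1 t ht t' ht', e2 t ht t' ht', ← sub_eq_zero, sub_eq_add_neg, ← inner_neg_left]
    refine inner_add_inner_eq_zero_of_mem_wstar (hS.image_amp (ι := ℕ)) ⟨1, h1, amp_one⟩ ?_ ?_
    · rintro _ ⟨a, ha, rfl⟩
      have h3 := e1 t ht t' ht' ⟨a, hSM a ha⟩
      have h4 := e2 t ht t' ht' ⟨a, hSM a ha⟩
      have h5 := congr(amp ℕ $(hs ⟨a, hSM a ha⟩ ha) (t' η))
      rw [amp_mul, amp_mul, mul_apply_eq_comp, mul_apply_eq_comp] at h5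
      rw [inner_neg_left, ← h3, ← h4, h5, add_neg_cancel]
    · rw [wstar_image_amp]
      exact amp_mem_ampAlgebra (by rw [hgen]; exact x.2)
  apply amp_injective (ι := ℕ)
  rw [amp_mul, amp_mul]
  refine clm_eq_of_total (u := fun t : (ampAlgebra ℕ P).commutant ↦
    (t : Amp ℕ L →L[ℂ] Amp ℕ L) η) (fun z hz ↦ htot z fun t ht ↦ hz ⟨t, ht⟩) fun t' ↦ ?_
  refine sub_eq_zero.1 (htot _ fun t ht ↦ ?_)
  rw [inner_sub_right, mul_apply_eq_comp, mul_apply_eq_comp, key t ht t' t'.2, sub_self]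

end NormalStates

/-! ### Reduction to alternating centered words. -/

section AlternatingWords

variable {R ι : Type*} [Ring R] [Algebra ℂ R]

/-- Products of words whose letters come alternately from the sets `S i`. -/
def alternatingWords (S : ι → Set R) : Set R :=
  {x | ∃ l : List (ι × R), l.IsChain (fun a b ↦ a.1 ≠ b.1) ∧ (∀ a ∈ l, a.2 ∈ S a.1) ∧
    (l.map Prod.snd).prod = x}

/-- Letters are added on the left. A letter of the same type as the first one is merged with it;
then its scalar part is split off, which leaves the centered word and the rest of the word. -/
lemma closure_subset_span_alternatingWords {A S : ι → Set R}
    (hmul : ∀ i, ∀ a ∈ A i, ∀ b ∈ S i, a * b ∈ A i)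
    (hc : ∀ i, ∀ a ∈ A i, ∃ τ : ℂ, a - τ • 1 ∈ S i) {x : R}
    (hx : x ∈ Submonoid.closure (⋃ i, A i)) :
    x ∈ Submodule.span ℂ (alternatingWords S) := by
  have key : ∀ i, ∀ a ∈ A i, ∀ l : List (ι × R), l.IsChain (fun a b ↦ a.1 ≠ b.1) →
      (∀ a ∈ l, a.2 ∈ S a.1) → (∀ b ∈ l.head?, i ≠ b.1) →
      a * (l.map Prod.snd).prod ∈ Submodule.span ℂ (alternatingWords S) := by
    intro i a ha l hl hS hi
    obtain ⟨τ, hτ⟩ := hc i a ha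
    rw [show a * (l.map Prod.snd).prod = (a - τ • 1) * (l.map Prod.snd).prod +
      τ • (l.map Prod.snd).prod by simp [sub_mul]]
    refine add_mem (Submodule.subset_span ⟨(i, a - τ • 1) :: l, ?_, ?_, by simp⟩)
      (Submodule.smul_mem _ _ (Submodule.subset_span ⟨l, hl, hS, rfl⟩))
    · exact List.isChain_cons.2 ⟨hi, hl⟩
    · rintro b (_ | ⟨_, hb⟩)
      · exact hτ
      · exact hS b hb
  induction hx using Submonoid.closure_induction_left with
  | one => exact Submodule.subset_span ⟨[], List.isChain_nil, by simp, rfl⟩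
  | mul_left a ha y hy' hy =>
    clear hy'
    obtain ⟨i, hi⟩ := Set.mem_iUnion.1 ha
    induction hy using Submodule.span_induction with
    | zero => simp
    | add y z _ _ hy hz => rw [mul_add]; exact add_mem hy hz
    | smul c y _ hy => rw [mul_smul_comm]; exact Submodule.smul_mem _ _ hy
    | mem y hy =>
      obtain ⟨l, hl, hS, rfl⟩ := hy
      match l, hl, hS with
      | [], hl, hS => exact key i a hi [] hl hS (by simp)
      | b :: l, hl, hS =>
        by_cases hb : b.1 = i
        · have hab : a * b.2 ∈ A i := hmul i a hi b.2 (hb ▸ hS b (by simp))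
          rw [List.map_cons, List.prod_cons, ← mul_assoc]
          rw [List.isChain_cons] at hl
          exact key i _ hab l hl.2 (fun c hc ↦ hS c (by simp [hc])) (hb ▸ hl.1)
        · exact key i a hi (b :: l) hl hS (by simpa using Ne.symm hb)

end AlternatingWords

/-! ### Minimal projections: `e M e = ℂ e`, and density of `M e H` in a factor. -/

section MinimalProjections

variable {M : VonNeumannAlgebra H}

/-- If `e` is minimal then the range projection of an element of `eM` is `0` or `e`. -/
lemma IsMinimalProjection.eq_zero_or_forall {e : M.Elem} (he : IsMinimalProjection M e)
    {x : H →L[ℂ] H} (hx : x ∈ M) (hex : (e : H →L[ℂ] H) * x = x) :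
    x = 0 ∨ ∀ T : H →L[ℂ] H, T * x = 0 → T * (e : H →L[ℂ] H) = 0 := by
  have heP : IsStarProjection (e : H →L[ℂ] H) := he.isStarProjection.map M.toStarSubalgebra.subtype
  obtain ⟨r, hr1, hr2, hr3, hr4, hr5⟩ := exists_projection fun v ↦ x v
  have hrP : IsStarProjection r := ⟨hr2, hr1⟩
  -- The range of `x` is invariant under `M'`, so its projection lies in `M'' = M`.
  have hrM : r ∈ M := by
    rw [← commutant_commutant M, mem_commutant_iff]
    have hc : ∀ T ∈ M.commutant, ∀ v, T (x v) = x (T v) := fun T hT v ↦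
      (congr($(mem_commutant_iff.1 hT x hx) v)).symm
    intro T hT
    refine (hr5 T (fun v ↦ ?_) fun v ↦ ?_).symm
    · rw [hc T hT, hr3]
    · rw [hc _ (star_mem hT), hr3]
  have her : (e : H →L[ℂ] H) * r = r :=
    clm_eq_of_family (u := fun v ↦ x v) (fun v ↦ by
      rw [mul_apply_eq_comp, hr3]; exact congr($hex v)) fun z hz ↦ by
      rw [mul_apply_eq_comp, hr4 z hz, map_zero]
  have hrx : r * x = x := by ext v; exact hr3 v
  have hre : r ≤ (e : H →L[ℂ] H) := (hrP.le_iff_mul_eq_right heP).2 her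
  have hrE : IsStarProjection (⟨r, hrM⟩ : M.Elem) := ⟨Subtype.ext hr2, Subtype.ext hr1⟩
  rcases he.minimal ⟨r, hrM⟩ hrE hre with h | h
  · left
    have h' : r = 0 := congrArg Subtype.val h
    rw [← hrx, h', zero_mul]
  · right
    intro T hT
    rw [← h]
    exact clm_eq_of_family (u := fun v ↦ x v) (fun v ↦ by
      rw [mul_apply_eq_comp, hr3]; exact congr($hT v)) fun z hz ↦ by
      rw [mul_apply_eq_comp, hr4 z hz, map_zero, zero_apply]

lemma posPart_mem {x : H →L[ℂ] H} (hx : x ∈ M) : x⁺ ∈ M := by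
  rw [← commutant_commutant M, mem_commutant_iff]
  intro T hT
  have : Commute x T := mem_commutant_iff.1 hT x hx
  exact (this.cfcₙ_real _).eq.symm

lemma apply_eq_zero_of_nonneg {x : H →L[ℂ] H} (hx : 0 ≤ x) {v : H} (h : ⟪v, x v⟫_ℂ = 0) :
    x v = 0 := by
  have h1 := CFC.sqrt_mul_sqrt_self x hx
  have h2 : star (CFC.sqrt x) = CFC.sqrt x := (CFC.sqrt_nonneg x).isSelfAdjoint
  rw [← h1, mul_apply_eq_comp, ← inner_star_apply_left, h2, inner_self_eq_zero] at h
  rw [← h1, mul_apply_eq_comp, h, map_zero]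

/-- Fix `v = e u ≠ 0` and choose `c` so that `z = y - c e` has expectation `0` at `v`. The positive
and negative parts of `z` lie in `e M` and have product `0`; as their range projections are `0` or
`e`, one part vanishes. So `z` has a definite sign and `⟪v, z v⟫ = 0` forces `z v = 0`. Then the
range projection of `z` is not `e`, and `z = 0`. -/
lemma IsMinimalProjection.exists_eq_smul_of_isSelfAdjoint {e : M.Elem}
    (he : IsMinimalProjection M e) {y : H →L[ℂ] H} (hy : y ∈ M) (hys : star y = y)
    (hey : (e : H →L[ℂ] H) * y = y) : ∃ c : ℂ, y = c • (e : H →L[ℂ] H) := by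
  have heP : IsStarProjection (e : H →L[ℂ] H) := he.isStarProjection.map M.toStarSubalgebra.subtype
  have hes : star (e : H →L[ℂ] H) = e := heP.isSelfAdjoint
  have hee : (e : H →L[ℂ] H) * e = e := heP.isIdempotentElem
  obtain ⟨u, hu⟩ : ∃ u, (e : H →L[ℂ] H) u ≠ 0 := by
    by_contra! h
    exact he.ne_zero (Subtype.ext (by ext u; exact h u))
  set v := (e : H →L[ℂ] H) u with hv
  have hev : (e : H →L[ℂ] H) v = v := congr($hee u)
  set c : ℂ := ⟪v, y v⟫_ℂ / ⟪v, v⟫_ℂ with hc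
  have hvv : ⟪v, v⟫_ℂ ≠ 0 := inner_self_ne_zero.2 hu
  have hcr : star c = c := by
    rw [hc, star_div₀]
    congr 1
    · change (starRingEnd ℂ) _ = _
      rw [inner_conj_symm, ← inner_star_apply_right, hys]
    · exact inner_self_conj _
  set z := y - c • (e : H →L[ℂ] H) with hz
  have hzM : z ∈ M := sub_mem hy (M.toStarSubalgebra.smul_mem e.2 c)
  have hzs : star z = z := by rw [hz, star_sub, star_smul, hys, hes, hcr]
  have hez : (e : H →L[ℂ] H) * z = z := by rw [hz, mul_sub, mul_smul_comm, hey, hee]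
  have hvz : ⟪v, z v⟫_ℂ = 0 := by
    rw [hz, sub_apply, smul_apply, hev, inner_sub_right, inner_smul_right, hc,
      div_mul_cancel₀ _ hvv, sub_self]
  suffices h : z = 0 from ⟨c, sub_eq_zero.1 h⟩
  have hsub := CFC.posPart_sub_negPart z hzs
  have hpn := CFC.posPart_mul_negPart z
  have hnp := CFC.negPart_mul_posPart z
  have hps : star z⁺ = z⁺ := (CFC.posPart_nonneg z).isSelfAdjoint
  have hns : star z⁻ = z⁻ := (CFC.negPart_nonneg z).isSelfAdjoint
  -- For `x = z⁺` or `z⁻` one has `z x = ± x²`, so `(1 - e) x² = 0`, and the C*-identity applied to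
  -- `(1 - e) x` gives `e x = x`.
  have habs : ∀ x : H →L[ℂ] H, star x = x → z * x = x * x ∨ z * x = - (x * x) →
      (e : H →L[ℂ] H) * x = x := by
    intro x hxs hx
    have h1 : (1 - (e : H →L[ℂ] H)) * (x * x) = 0 := by
      have h2 : (1 - (e : H →L[ℂ] H)) * (z * x) = 0 := by
        rw [← mul_assoc, sub_mul, one_mul, hez, sub_self, zero_mul]
      rcases hx with hx | hx
      · rw [← hx, h2]
      · rw [hx, mul_neg, neg_eq_zero] at h2; exact h2
    have h3 : ((1 - (e : H →L[ℂ] H)) * x) * star ((1 - (e : H →L[ℂ] H)) * x) = 0 := by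
      rw [star_mul, hxs, mul_assoc, ← mul_assoc x, ← mul_assoc, h1, zero_mul]
    have h4 := CStarRing.mul_star_self_eq_zero_iff _ |>.1 h3
    rw [sub_mul, one_mul, sub_eq_zero] at h4
    exact h4.symm
  have hep : (e : H →L[ℂ] H) * z⁺ = z⁺ := habs _ hps (Or.inl (by
    calc z * z⁺ = (z⁺ - z⁻) * z⁺ := by rw [hsub]
      _ = z⁺ * z⁺ := by rw [sub_mul, hnp, sub_zero]))
  have hen : (e : H →L[ℂ] H) * z⁻ = z⁻ := habs _ hns (Or.inr (by
    calc z * z⁻ = (z⁺ - z⁻) * z⁻ := by rw [hsub]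
      _ = -(z⁻ * z⁻) := by rw [sub_mul, hpn, zero_sub]))
  have hzv : z v = 0 := by
    rcases he.eq_zero_or_forall (posPart_mem hzM) hep with h | h
    · rw [h, zero_sub] at hsub
      have h1 : ⟪v, z⁻ v⟫_ℂ = 0 := by
        rw [← hsub, neg_apply, inner_neg_right, neg_eq_zero] at hvz
        exact hvz
      rw [← hsub, neg_apply,
        apply_eq_zero_of_nonneg (CFC.negPart_nonneg z) h1, neg_zero]
    · have h1 : z⁻ = 0 := by
        have := congrArg star (h _ hnp)
        rwa [star_mul, hes, hns, hen, star_zero] at this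
      rw [h1, sub_zero] at hsub
      rw [← hsub] at hvz ⊢
      rw [hsub]
      have := apply_eq_zero_of_nonneg (CFC.posPart_nonneg z) hvz
      rwa [hsub] at this
  rcases he.eq_zero_or_forall hzM hez with h | h
  · exact h
  · exfalso
    -- The rank-one operator `w ↦ ⟪v, w⟫ v` annihilates `z` because `z v = 0`, but it does not
    -- annihilate `e`.
    have h1 := h ((innerSL ℂ v).smulRight v) (by
      ext w
      simp only [mul_apply_eq_comp, ContinuousLinearMap.smulRight_apply, innerSL_apply_apply,
        zero_apply]
      rw [← inner_star_apply_left, hzs, hzv, inner_zero_left, zero_smul])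
    have h2 := congr($h1 v)
    simp only [mul_apply_eq_comp, ContinuousLinearMap.smulRight_apply, innerSL_apply_apply,
        zero_apply, hev] at h2
    exact (smul_ne_zero hvv hu) h2

/-- If `e` is minimal then `e M e = ℂ e`. -/
lemma IsMinimalProjection.exists_eq_smul {e : M.Elem} (he : IsMinimalProjection M e)
    (a : M.Elem) : ∃ c : ℂ, e * a * e = c • e := by
  have hes : star e = e := he.isStarProjection.isSelfAdjoint
  have hee : e * e = e := he.isStarProjection.isIdempotentElem
  have key : ∀ b : M.Elem, star b = b → ∃ c : ℂ, e * b * e = c • e := by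
    intro b hb
    obtain ⟨c, hc⟩ := he.exists_eq_smul_of_isSelfAdjoint (y := ((e * b * e : M.Elem) : H →L[ℂ] H))
      (e * b * e).2 (congrArg Subtype.val (show star (e * b * e) = e * b * e by
        rw [star_mul, star_mul, hes, hb, mul_assoc]))
      (congrArg Subtype.val (show e * (e * b * e) = e * b * e by
        rw [← mul_assoc, ← mul_assoc, hee]))
    exact ⟨c, Subtype.ext hc⟩
  obtain ⟨c, hc⟩ := key (a + star a) (by rw [star_add, star_star, add_comm])
  obtain ⟨d, hd⟩ := key (Complex.I • (a - star a)) (by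
    rw [star_smul, star_sub, star_star, Complex.star_def, Complex.conj_I, neg_smul, ← smul_neg,
      neg_sub])
  refine ⟨(1 / 2 : ℂ) * (c - Complex.I * d), ?_⟩
  have h : a = (1 / 2 : ℂ) • ((a + star a) - Complex.I • (Complex.I • (a - star a))) := by
    rw [smul_smul, Complex.I_mul_I, neg_one_smul, sub_neg_eq_add, add_add_sub_cancel, ← two_smul ℂ a,
      smul_smul]
    norm_num
  conv_lhs => rw [h]
  rw [mul_smul_comm, smul_mul_assoc, mul_sub, sub_mul, hc, mul_smul_comm, smul_mul_assoc, hd,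
    smul_smul, ← sub_smul, smul_smul]

/-- In a factor `A ⊆ B(H)`, the vectors `a e v` span a dense subspace, for `e ≠ 0`. -/
lemma IsFactor.total (hM : M.IsFactor) {e : M.Elem} (he : e ≠ 0) {z : H}
    (hz : ∀ (a : M.Elem) (v : H), ⟪(a : H →L[ℂ] H) ((e : H →L[ℂ] H) v), z⟫_ℂ = 0) : z = 0 := by
  obtain ⟨q, hq1, hq2, hq3, hq4, hq5⟩ := exists_projection
    fun i : M.Elem × H ↦ (i.1 : H →L[ℂ] H) ((e : H →L[ℂ] H) i.2)
  -- The closure of `M e H` is invariant under `M` and under `M'`, so `q` is central, hence a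
  -- scalar; it is `1` because it fixes some `e v ≠ 0`.
  have hqM' : q ∈ M.commutant := by
    rw [mem_commutant_iff]
    intro g hg
    exact (hq5 g (fun i ↦ hq3 ((⟨g, hg⟩ : M.Elem) * i.1, i.2)) fun i ↦
      hq3 ((⟨star g, star_mem hg⟩ : M.Elem) * i.1, i.2)).symm
  have hqM : q ∈ M := by
    rw [← commutant_commutant M, mem_commutant_iff]
    have hc : ∀ T ∈ M.commutant, ∀ (a : M.Elem) v, T ((a : H →L[ℂ] H) v) = (a : H →L[ℂ] H) (T v) :=
      fun T hT a v ↦ (congr($(mem_commutant_iff.1 hT _ a.2) v)).symm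
    intro T hT
    refine (hq5 T (fun i ↦ ?_) fun i ↦ ?_).symm
    · rw [hc T hT, hc T hT]; exact hq3 (i.1, T i.2)
    · rw [hc _ (star_mem hT), hc _ (star_mem hT)]; exact hq3 (i.1, star T i.2)
  obtain ⟨c, hc⟩ := hM q hqM hqM'
  obtain ⟨v, hv⟩ : ∃ v, (e : H →L[ℂ] H) v ≠ 0 := by
    by_contra! h
    exact he (Subtype.ext (by ext u; exact h u))
  have h1 := hq3 (1, v)
  change q ((e : H →L[ℂ] H) v) = (e : H →L[ℂ] H) v at h1
  rw [hc, smul_apply, one_apply_eq_self] at h1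
  have h2 : c = 1 := by
    have : (c - 1) • (e : H →L[ℂ] H) v = 0 := by rw [sub_smul, h1, one_smul, sub_self]
    exact sub_eq_zero.1 ((smul_eq_zero.1 this).resolve_right hv)
  have h3 := hq4 z fun i ↦ hz i.1 i.2
  rwa [hc, h2, one_smul, one_apply_eq_self] at h3

end MinimalProjections

/-! ### Algebra of words that start or end in `𝔹`. -/

section CornerWords

variable {R : Type*} [Ring R] [Algebra ℂ R]

/-- Alternating products `y₁ x₁ y₂ ⋯ xₙ₋₁ yₙ` which start and end with a letter in `Y`. -/
inductive CoreWord (X Y : Set R) : R → Prop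
  | base {y : R} : y ∈ Y → CoreWord X Y y
  | cons {y x m : R} : y ∈ Y → x ∈ X → CoreWord X Y m → CoreWord X Y (y * x * m)

/-- Alternating products which start with a letter in `Y`. -/
inductive StartWord (X Y : Set R) : R → Prop
  | base {y : R} : y ∈ Y → StartWord X Y y
  | pair {y x : R} : y ∈ Y → x ∈ X → StartWord X Y (y * x)
  | cons {y x u : R} : y ∈ Y → x ∈ X → StartWord X Y u → StartWord X Y (y * x * u)

/-- The elements of `S` on which `ψ` vanishes. -/
def centered (ψ : R →ₗ[ℂ] ℂ) (S : Subalgebra ℂ R) : Set R := {x | x ∈ S ∧ ψ x = 0}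

variable {ψ : R →ₗ[ℂ] ℂ} {𝔸 𝔹 𝔻 : Subalgebra ℂ R}

lemma centered_mono (h : 𝔸 ≤ 𝔻) : centered ψ 𝔸 ⊆ centered ψ 𝔻 := fun _ hx ↦ ⟨h hx.1, hx.2⟩

lemma sub_smul_one_mem_centered (h1 : ψ 1 = 1) {x : R} (hx : x ∈ 𝔸) :
    x - ψ x • 1 ∈ centered ψ 𝔸 :=
  ⟨sub_mem hx (𝔸.smul_mem (one_mem _) _), by simp [h1]⟩

/-- As `m` ends in `𝔹`, the centered part of `x` may be appended as a further letter; the scalar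
part only rescales `m`. -/
lemma CoreWord.mul_mem_span (h1 : ψ 1 = 1) (h𝔸 : 𝔸 ≤ 𝔻) {m : R}
    (hm : CoreWord (centered ψ 𝔸) (centered ψ 𝔹) m) {x : R} (hx : x ∈ 𝔻) :
    m * x ∈ Submodule.span ℂ {u | StartWord (centered ψ 𝔻) (centered ψ 𝔹) u} := by
  have key : ∀ m : R, StartWord (centered ψ 𝔻) (centered ψ 𝔹) m →
      (∀ z ∈ centered ψ 𝔻, StartWord (centered ψ 𝔻) (centered ψ 𝔹) (m * z)) →
      m * x ∈ Submodule.span ℂ {u | StartWord (centered ψ 𝔻) (centered ψ 𝔹) u} := by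
    intro m h h'
    rw [show m * x = m * (x - ψ x • 1) + ψ x • m by simp [mul_sub]]
    exact add_mem (Submodule.subset_span (h' _ (sub_smul_one_mem_centered h1 hx)))
      (Submodule.smul_mem _ _ (Submodule.subset_span h))
  suffices h : StartWord (centered ψ 𝔻) (centered ψ 𝔹) m ∧
      ∀ z ∈ centered ψ 𝔻, StartWord (centered ψ 𝔻) (centered ψ 𝔹) (m * z) from key m h.1 h.2
  induction hm with
  | base hy => exact ⟨.base hy, fun z hz ↦ .pair hy hz⟩
  | cons hy hx' _ ih =>
    refine ⟨.cons hy (centered_mono h𝔸 hx') ih.1, fun z hz ↦ ?_⟩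
    rw [mul_assoc _ _ z]
    exact .cons hy (centered_mono h𝔸 hx') (ih.2 z hz)

lemma CoreWord.mul_startWord (h𝔸 : 𝔸 ≤ 𝔻) {m : R}
    (hm : CoreWord (centered ψ 𝔸) (centered ψ 𝔹) m) {x : R} (hx : x ∈ centered ψ 𝔻) {u : R}
    (hu : StartWord (centered ψ 𝔻) (centered ψ 𝔹) u) :
    StartWord (centered ψ 𝔻) (centered ψ 𝔹) (m * x * u) := by
  induction hm with
  | base hy => exact .cons hy hx hu
  | cons hy hx' _ ih =>
    rw [mul_assoc _ _ x, mul_assoc _ _ u]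
    exact .cons hy (centered_mono h𝔸 hx') ih

lemma StartWord.exists_list {X Y : Set R} {u : R} (hu : StartWord X Y u) :
    ∃ l : List (Fin 2 × R), l.IsChain (fun a b ↦ a.1 ≠ b.1) ∧ (∀ a ∈ l, a.2 ∈ ![X, Y] a.1) ∧
      (∀ b ∈ l.head?, b.1 = 1) ∧ l ≠ [] ∧ (l.map Prod.snd).prod = u := by
  induction hu with
  | @base y hy => exact ⟨[(1, y)], by simp, by simpa using hy, by simp, by simp, by simp⟩
  | @pair y x hy hx =>
    exact ⟨[(1, y), (0, x)], by simp, by simp [hx, hy], by simp, by simp, by simp⟩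
  | @cons y x u hy hx _ ih =>
    obtain ⟨l, h1, h2, h3, h4, rfl⟩ := ih
    refine ⟨(1, y) :: (0, x) :: l, ?_, ?_, by simp, by simp, by simp [mul_assoc]⟩
    · rw [List.isChain_cons_cons, List.isChain_cons]
      exact ⟨by simp, fun b hb ↦ by simp [h3 b hb], h1⟩
    · rintro a (_ | ⟨_, _ | ⟨_, ha⟩⟩)
      · exact hy
      · exact hx
      · exact h2 a ha

lemma StartWord.map_eq_zero (hfree : IsFree ψ ![(𝔻 : Set R), (𝔹 : Set R)]) {u : R}
    (hu : StartWord (centered ψ 𝔻) (centered ψ 𝔹) u) :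
    ψ u = 0 ∧ ∀ d ∈ centered ψ 𝔻, ψ (d * u) = 0 := by
  obtain ⟨l, h1, h2, h3, h4, rfl⟩ := hu.exists_list
  have h2' : ∀ a ∈ l, a.2 ∈ ![(𝔻 : Set R), (𝔹 : Set R)] a.1 ∧ ψ a.2 = 0 := by
    intro a ha
    have := h2 a ha
    obtain ⟨i, x⟩ := a
    fin_cases i
    · exact this
    · exact this
  refine ⟨hfree l h4 h1 h2', fun d hd ↦ ?_⟩
  have := hfree ((0, d) :: l) (by simp)
    (List.isChain_cons.2 ⟨fun b hb ↦ by simp [h3 b hb], h1⟩) (by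
      rintro a (_ | ⟨_, ha⟩)
      · exact hd
      · exact h2' a ha)
  simpa using this

lemma map_mul_startWord (h1 : ψ 1 = 1) (hfree : IsFree ψ ![(𝔻 : Set R), (𝔹 : Set R)]) {u : R}
    (hu : StartWord (centered ψ 𝔻) (centered ψ 𝔹) u) {d : R} (hd : d ∈ 𝔻) : ψ (d * u) = 0 := by
  obtain ⟨h2, h3⟩ := hu.map_eq_zero hfree
  rw [show d * u = (d - ψ d • 1) * u + ψ d • u by simp [sub_mul], map_add, map_smul, h2,
    h3 _ (sub_smul_one_mem_centered h1 hd), smul_zero, add_zero]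

/-- The products `a m a'` with `a, a' ∈ 𝔸` and `m` an alternating word that starts and ends in
`𝔹`. -/
def sandwich (ψ : R →ₗ[ℂ] ℂ) (𝔸 𝔹 : Subalgebra ℂ R) : Set R :=
  {w | ∃ a ∈ 𝔸, ∃ m, CoreWord (centered ψ 𝔸) (centered ψ 𝔹) m ∧ ∃ a' ∈ 𝔸, w = a * m * a'}

lemma mul_mem_span_sandwich {a : R} (ha : a ∈ 𝔸) {a' : R} (ha' : a' ∈ 𝔸) {x : R}
    (hx : x ∈ Submodule.span ℂ (sandwich ψ 𝔸 𝔹)) :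
    a * x * a' ∈ Submodule.span ℂ (sandwich ψ 𝔸 𝔹) := by
  induction hx using Submodule.span_induction with
  | zero => simp
  | add y z _ _ hy hz => rw [mul_add, add_mul]; exact add_mem hy hz
  | smul c y _ hy =>
    rw [mul_smul_comm, smul_mul_assoc]; exact Submodule.smul_mem _ _ hy
  | mem y hy =>
    obtain ⟨b, hb, m, hm, b', hb', rfl⟩ := hy
    exact Submodule.subset_span ⟨a * b, mul_mem ha hb, m, hm, b' * a', mul_mem hb' ha',
      by simp only [mul_assoc]⟩

/-- The algebra generated by `𝔸` and `𝔹` is spanned by `𝔸` and `sandwich ψ 𝔸 𝔹`. -/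
lemma closure_subset_span_sandwich (h1 : ψ 1 = 1) {x : R}
    (hx : x ∈ Submonoid.closure ((𝔸 : Set R) ∪ 𝔹)) :
    ∃ a ∈ 𝔸, ∃ y ∈ Submodule.span ℂ (sandwich ψ 𝔸 𝔹), x = a + y := by
  set V : Submodule ℂ R := Subalgebra.toSubmodule 𝔸 ⊔ Submodule.span ℂ (sandwich ψ 𝔸 𝔹) with hV
  have h𝔸V : ∀ a ∈ 𝔸, a ∈ V := fun a ha ↦ Submodule.mem_sup_left ha
  have hSV : ∀ a ∈ sandwich ψ 𝔸 𝔹, a ∈ V := fun a ha ↦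
    Submodule.mem_sup_right (Submodule.subset_span ha)
  suffices h : x ∈ V by
    obtain ⟨a, ha, y, hy, rfl⟩ := Submodule.mem_sup.1 h
    exact ⟨a, ha, y, hy, rfl⟩
  have hAm : ∀ a ∈ 𝔸, ∀ m, CoreWord (centered ψ 𝔸) (centered ψ 𝔹) m → ∀ a' ∈ 𝔸, a * m * a' ∈ V :=
    fun a ha m hm a' ha' ↦ hSV _ ⟨a, ha, m, hm, a', ha', rfl⟩
  have hm' : ∀ m, CoreWord (centered ψ 𝔸) (centered ψ 𝔹) m → ∀ a' ∈ 𝔸, m * a' ∈ V :=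
    fun m hm a' ha' ↦ by simpa using hAm 1 (one_mem _) m hm a' ha'
  -- The letter `b` merges with the first letter `y` of `m`; the scalar part of `b y` deletes that
  -- letter and exposes the next one, which lies in `𝔸`.
  have hBm : ∀ b ∈ 𝔹, ∀ m, CoreWord (centered ψ 𝔸) (centered ψ 𝔹) m → ∀ a' ∈ 𝔸,
      b * m * a' ∈ V := by
    intro b hb m hm a' ha'
    cases hm with
    | base hy =>
      have hby := mul_mem hb hy.1
      rw [show b * m * a' = (b * m - ψ (b * m) • 1) * a' + ψ (b * m) • a' by simp [sub_mul]]
      exact add_mem (hm' _ (.base (sub_smul_one_mem_centered h1 hby)) a' ha')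
        (Submodule.smul_mem _ _ (h𝔸V _ ha'))
    | @cons y x m hy hx hm =>
      have hby := mul_mem hb hy.1
      rw [show b * (y * x * m) * a' = (b * y - ψ (b * y) • 1) * x * m * a' +
        ψ (b * y) • (x * m * a') by simp [sub_mul, mul_assoc]]
      exact add_mem (hm' _ (.cons (sub_smul_one_mem_centered h1 hby) hx hm) a' ha')
        (Submodule.smul_mem _ _ (hAm x hx.1 m hm a' ha'))
  have hBa : ∀ b ∈ 𝔹, ∀ a ∈ 𝔸, b * a ∈ V := by
    intro b hb a ha
    rw [show b * a = (b - ψ b • 1) * a + ψ b • a by simp [sub_mul]]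
    exact add_mem (hm' _ (.base (sub_smul_one_mem_centered h1 hb)) a ha)
      (Submodule.smul_mem _ _ (h𝔸V _ ha))
  have hBs : ∀ b ∈ 𝔹, ∀ s ∈ sandwich ψ 𝔸 𝔹, b * s ∈ V := by
    rintro b hb _ ⟨a, ha, m, hm, a', ha', rfl⟩
    rw [show b * (a * m * a') = (b - ψ b • 1) * (a - ψ a • 1) * m * a' +
      ψ a • ((b - ψ b • 1) * m * a') + ψ b • (a * m * a') by
      simp [sub_mul, mul_sub, mul_assoc]]
    have hbc := sub_smul_one_mem_centered h1 hb
    exact add_mem (add_mem (hm' _ (.cons hbc (sub_smul_one_mem_centered h1 ha) hm) a' ha')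
      (Submodule.smul_mem _ _ (hBm _ hbc.1 m hm a' ha')))
      (Submodule.smul_mem _ _ (hAm a ha m hm a' ha'))
  induction hx using Submonoid.closure_induction_left with
  | one => exact h𝔸V 1 (one_mem _)
  | mul_left b hb y hy' hy =>
    clear hy'
    obtain ⟨a, ha, z, hz, rfl⟩ := Submodule.mem_sup.1 hy
    rw [mul_add]
    rcases hb with hb | hb
    · refine add_mem (h𝔸V _ (mul_mem hb ha)) (Submodule.mem_sup_right ?_)
      simpa using mul_mem_span_sandwich hb (one_mem 𝔸) hz
    · refine add_mem (hBa b hb a ha) ?_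
      clear hy
      induction hz using Submodule.span_induction with
      | zero => simp
      | add y z _ _ hy hz => rw [mul_add]; exact add_mem hy hz
      | smul c y _ hy => rw [mul_smul_comm]; exact Submodule.smul_mem _ _ hy
      | mem s hs => exact hBs b hb s hs

variable {𝒞 : Set R}

/-- The span of the products of `𝔸` with alternating words in `𝔻` and `𝔹` which start in `𝔹`. -/
def leftSpan (ψ : R →ₗ[ℂ] ℂ) (𝔸 𝔹 𝔻 : Subalgebra ℂ R) : Submodule ℂ R :=
  Submodule.span ℂ {x | ∃ a ∈ 𝔸, ∃ u, StartWord (centered ψ 𝔻) (centered ψ 𝔹) u ∧ x = a * u}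

/-- The span of `𝒞` and of the products of `𝒞` with alternating words in `𝔻` and `𝔹` which start
in `𝔹`. -/
def rightSpan (ψ : R →ₗ[ℂ] ℂ) (𝔹 𝔻 : Subalgebra ℂ R) (𝒞 : Set R) : Submodule ℂ R :=
  Submodule.span ℂ (𝒞 ∪
    {x | ∃ c ∈ 𝒞, ∃ u, StartWord (centered ψ 𝔻) (centered ψ 𝔹) u ∧ x = c * u})

lemma mul_mem_leftSpan (h1 : ψ 1 = 1) (h𝔸 : 𝔸 ≤ 𝔻) {a m x : R} (ha : a ∈ 𝔸)
    (hm : CoreWord (centered ψ 𝔸) (centered ψ 𝔹) m) (hx : x ∈ 𝔻) :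
    a * (m * x) ∈ leftSpan ψ 𝔸 𝔹 𝔻 := by
  have := hm.mul_mem_span h1 h𝔸 hx
  generalize m * x = z at this ⊢
  induction this using Submodule.span_induction with
  | zero => simp
  | add y z _ _ hy hz => rw [mul_add]; exact add_mem hy hz
  | smul c y _ hy => rw [mul_smul_comm]; exact Submodule.smul_mem _ _ hy
  | mem s hs => exact Submodule.subset_span ⟨a, ha, s, hs, rfl⟩

lemma sandwich_subset_leftSpan (h1 : ψ 1 = 1) (h𝔸 : 𝔸 ≤ 𝔻) {w : R} (hw : w ∈ sandwich ψ 𝔸 𝔹) :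
    w ∈ leftSpan ψ 𝔸 𝔹 𝔻 := by
  obtain ⟨a, ha, m, hm, a', ha', rfl⟩ := hw
  rw [mul_assoc]
  exact mul_mem_leftSpan h1 h𝔸 ha hm (h𝔸 ha')

/-- The junction `a' c` lies in `𝒞`, so it is already centered in `𝔻` and no scalar term appears
between the two letters of `𝔹` around it. This is where the module structure of `𝒞` enters. -/
lemma sandwich_mul_rightSpan (h1 : ψ 1 = 1) (h𝔸 : 𝔸 ≤ 𝔻) (h𝒞 : 𝒞 ⊆ centered ψ 𝔻)
    (h𝔸𝒞 : ∀ a ∈ 𝔸, ∀ c ∈ 𝒞, a * c ∈ 𝒞) {w : R} (hw : w ∈ sandwich ψ 𝔸 𝔹) {x : R}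
    (hx : x ∈ rightSpan ψ 𝔹 𝔻 𝒞) : w * x ∈ leftSpan ψ 𝔸 𝔹 𝔻 := by
  obtain ⟨a, ha, m, hm, a', ha', rfl⟩ := hw
  induction hx using Submodule.span_induction with
  | zero => simp
  | add y z _ _ hy hz => rw [mul_add]; exact add_mem hy hz
  | smul c y _ hy => rw [mul_smul_comm]; exact Submodule.smul_mem _ _ hy
  | mem s hs =>
    rcases hs with hs | ⟨c, hc, u, hu, rfl⟩
    · rw [mul_assoc, mul_assoc]
      exact mul_mem_leftSpan h1 h𝔸 ha hm (h𝒞 (h𝔸𝒞 _ ha' _ hs)).1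
    · rw [show a * m * a' * (c * u) = a * (m * (a' * c) * u) by simp only [mul_assoc]]
      exact Submodule.subset_span
        ⟨a, ha, _, hm.mul_startWord h𝔸 (h𝒞 (h𝔸𝒞 _ ha' _ hc)) hu, rfl⟩

lemma mul_leftSpan (h𝒞𝔸 : ∀ c ∈ 𝒞, ∀ a ∈ 𝔸, c * a ∈ 𝒞) {c : R} (hc : c ∈ 𝒞) {x : R}
    (hx : x ∈ leftSpan ψ 𝔸 𝔹 𝔻) : c * x ∈ rightSpan ψ 𝔹 𝔻 𝒞 := by
  induction hx using Submodule.span_induction with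
  | zero => simp
  | add y z _ _ hy hz => rw [mul_add]; exact add_mem hy hz
  | smul c y _ hy => rw [mul_smul_comm]; exact Submodule.smul_mem _ _ hy
  | mem s hs =>
    obtain ⟨a, ha, u, hu, rfl⟩ := hs
    exact Submodule.subset_span (Or.inr ⟨c * a, h𝒞𝔸 c hc a ha, u, hu, by rw [mul_assoc]⟩)

lemma map_leftSpan (h1 : ψ 1 = 1) (hfree : IsFree ψ ![(𝔻 : Set R), (𝔹 : Set R)]) (h𝔸 : 𝔸 ≤ 𝔻)
    {x : R} (hx : x ∈ leftSpan ψ 𝔸 𝔹 𝔻) : ψ x = 0 := by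
  have : leftSpan ψ 𝔸 𝔹 𝔻 ≤ LinearMap.ker ψ := Submodule.span_le.2 (by
    rintro _ ⟨a, ha, u, hu, rfl⟩
    exact map_mul_startWord h1 hfree hu (h𝔸 ha))
  exact this hx

lemma map_rightSpan (h1 : ψ 1 = 1) (hfree : IsFree ψ ![(𝔻 : Set R), (𝔹 : Set R)])
    (h𝒞 : 𝒞 ⊆ centered ψ 𝔻) {x : R} (hx : x ∈ rightSpan ψ 𝔹 𝔻 𝒞) : ψ x = 0 := by
  have : rightSpan ψ 𝔹 𝔻 𝒞 ≤ LinearMap.ker ψ := Submodule.span_le.2 (by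
    rintro _ (hc | ⟨c, hc, u, hu, rfl⟩)
    · exact (h𝒞 hc).2
    · exact map_mul_startWord h1 hfree hu (h𝒞 hc).1)
  exact this hx

/-- For `x = a + y` with `y` in the span of sandwiches, `p a p` is a multiple of `p` and `ψ (p y p)
= 0`, which forces that multiple to be `ψ (p x p) / ψ p`. -/
lemma compress_sub_mem_span_sandwich (h1 : ψ 1 = 1)
    (hfree : IsFree ψ ![(𝔻 : Set R), (𝔹 : Set R)]) (h𝔸 : 𝔸 ≤ 𝔻) {p : R} (hp : p ∈ 𝔸)
    (hψp : ψ p ≠ 0) (hpa : ∀ a ∈ 𝔸, ∃ c : ℂ, p * a * p = c • p) {x : R}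
    (hx : x ∈ Submonoid.closure ((𝔸 : Set R) ∪ 𝔹)) :
    p * x * p - (ψ (p * x * p) / ψ p) • p ∈ Submodule.span ℂ (sandwich ψ 𝔸 𝔹) := by
  obtain ⟨a, ha, y, hy, rfl⟩ := closure_subset_span_sandwich h1 hx
  have hpy := mul_mem_span_sandwich hp hp hy
  have hy0 : ψ (p * y * p) = 0 := map_leftSpan h1 hfree h𝔸
    (Submodule.span_le.2 (fun w hw ↦ sandwich_subset_leftSpan h1 h𝔸 hw) hpy)
  obtain ⟨c, hc⟩ := hpa a ha
  rw [mul_add, add_mul, map_add, hy0, hc, map_smul, add_zero, smul_eq_mul,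
    mul_div_cancel_right₀ _ hψp, add_sub_cancel_left]
  exact hpy

end CornerWords

/-! ### Passage to limits in the freeness argument. -/

section CornerFreeness

variable {M : VonNeumannAlgebra H}

lemma star_mem_closure {R : Type*} [Ring R] [StarRing R] {S : Set R} (hS : ∀ x ∈ S, star x ∈ S)
    {x : R} (hx : x ∈ Submonoid.closure S) : star x ∈ Submonoid.closure S := by
  induction hx using Submonoid.closure_induction with
  | mem x hx => exact Submonoid.subset_closure (hS x hx)
  | one => rw [star_one]; exact one_mem _
  | mul x y _ _ hx hy => rw [star_mul]; exact mul_mem hy hx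

lemma isStarSemigroup_closure {S : Set M.Elem} (hS : ∀ x ∈ S, star x ∈ S) :
    IsStarSemigroup ((fun x : M.Elem ↦ (x : H →L[ℂ] H)) '' Submonoid.closure S) where
  mul_mem := by
    rintro _ ⟨x, hx, rfl⟩ _ ⟨y, hy, rfl⟩
    exact ⟨x * y, mul_mem hx hy, rfl⟩
  star_mem := by
    rintro _ ⟨x, hx, rfl⟩
    exact ⟨star x, star_mem_closure hS hx, rfl⟩

lemma wstar_mono {S T : Set (H →L[ℂ] H)} (h : S ⊆ T) {x : H →L[ℂ] H} (hx : x ∈ wstar S) :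
    x ∈ wstar T :=
  wstar_le (h.trans (subset_wstar T)) hx

variable {ψ : M.Elem →ₗ[ℂ] ℂ} {Ψ : Amp ℕ H} {𝔸 𝔹 𝔻 : Subalgebra ℂ M.Elem} {p : M.Elem}

/-- The density argument: the elements of `pNp` with `ψ y = 0` are limits of linear combinations of
`sandwich ψ 𝔸 𝔹`, where `N` is generated by `𝔸` and `𝔹`. -/
lemma inner_eq_zero_of_sandwich (hΨ : ∀ x : M.Elem, ψ x = ⟪Ψ, amp ℕ (x : H →L[ℂ] H) Ψ⟫_ℂ)
    (h1 : ψ 1 = 1) (hfree : IsFree ψ ![(𝔻 : Set M.Elem), (𝔹 : Set M.Elem)]) (h𝔸 : 𝔸 ≤ 𝔻)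
    (hstar : ∀ x ∈ (𝔸 : Set M.Elem) ∪ 𝔹, star x ∈ (𝔸 : Set M.Elem) ∪ 𝔹) (hp : p ∈ 𝔸)
    (hps : star p = p) (hψp : ψ p ≠ 0) (hpa : ∀ a ∈ 𝔸, ∃ c : ℂ, p * a * p = c • p) {y : M.Elem}
    (hy : (y : H →L[ℂ] H) ∈
      wstar ((fun x : M.Elem ↦ (x : H →L[ℂ] H)) '' ((𝔸 : Set M.Elem) ∪ 𝔹)))
    (hpy : p * y * p = y) (hψy : ψ y = 0) {η ζ : Amp ℕ H}
    (h : ∀ w ∈ sandwich ψ 𝔸 𝔹, ⟪η, amp ℕ (w : H →L[ℂ] H) ζ⟫_ℂ = 0) :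
    ⟪η, amp ℕ (y : H →L[ℂ] H) ζ⟫_ℂ = 0 := by
  set P := amp ℕ (p : H →L[ℂ] H) with hP
  have hPs : star P = P := by
    rw [hP, ← amp_star]; exact congrArg (fun x : M.Elem ↦ amp ℕ (x : H →L[ℂ] H)) hps
  have hPx : ∀ (x : M.Elem) a b, ⟪P a, amp ℕ (x : H →L[ℂ] H) (P b)⟫_ℂ =
      ⟪a, amp ℕ ((p * x * p : M.Elem) : H →L[ℂ] H) b⟫_ℂ := by
    intro x a b
    conv_lhs => rw [← hPs, inner_star_apply_left, hPs]
    rw [show ((p * x * p : M.Elem) : H →L[ℂ] H) = (p : H →L[ℂ] H) * x * p from rfl, amp_mul,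
      amp_mul]
    rfl
  -- With this `k`, the functional `x ↦ ⟪η, (p x p - (ψ (p x p) / ψ p) p) ζ⟫` is a sum of two vector
  -- functionals of `x`: the subtracted term is `k ψ (p x p)`, a vector functional at `P Ψ`.
  set k : ℂ := ⟪η, P ζ⟫_ℂ / ψ p with hk
  have key : ∀ x : M.Elem, ⟪P η, amp ℕ (x : H →L[ℂ] H) (P ζ)⟫_ℂ +
      ⟪P Ψ, amp ℕ (x : H →L[ℂ] H) (-k • P Ψ)⟫_ℂ =
      ⟪η, amp ℕ ((p * x * p - (ψ (p * x * p) / ψ p) • p : M.Elem) : H →L[ℂ] H) ζ⟫_ℂ := by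
    intro x
    have e1 : amp ℕ ((p * x * p - (ψ (p * x * p) / ψ p) • p : M.Elem) : H →L[ℂ] H) ζ =
        amp ℕ ((p * x * p : M.Elem) : H →L[ℂ] H) ζ - (ψ (p * x * p) / ψ p) • P ζ := by
      change amp ℕ (((p * x * p : M.Elem) : H →L[ℂ] H) -
        (ψ (p * x * p) / ψ p) • (p : H →L[ℂ] H)) ζ = _
      rw [amp_sub, amp_smul]
      rfl
    rw [map_smul, inner_smul_right, hPx, hPx, ← hΨ, e1, inner_sub_right, inner_smul_right, hk]
    ring
  have hS : IsStarSemigroup ((fun x : M.Elem ↦ (x : H →L[ℂ] H)) ''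
      Submonoid.closure ((𝔸 : Set M.Elem) ∪ 𝔹)) := isStarSemigroup_closure hstar
  have hyS := wstar_mono (Set.image_mono Submonoid.subset_closure) hy
  have := inner_add_inner_eq_zero_of_mem_wstar (x := amp ℕ (y : H →L[ℂ] H)) (hS.image_amp (ι := ℕ))
    ⟨1, ⟨1, one_mem _, rfl⟩, amp_one⟩ (ξ := P ζ) (η := P η) (ξ' := -k • P Ψ) (η' := P Ψ) (by
      rintro _ ⟨_, ⟨x, hx, rfl⟩, rfl⟩
      rw [key]
      have hmem := compress_sub_mem_span_sandwich h1 hfree h𝔸 hp hψp hpa hx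
      generalize p * x * p - (ψ (p * x * p) / ψ p) • p = z at hmem
      induction hmem using Submodule.span_induction with
      | mem w hw => exact h w hw
      | zero =>
        change ⟪η, amp ℕ (0 : H →L[ℂ] H) ζ⟫_ℂ = 0
        rw [amp_zero, zero_apply, inner_zero_right]
      | add a b _ _ ha hb =>
        rw [show amp ℕ ((a + b : M.Elem) : H →L[ℂ] H) ζ =
          amp ℕ (a : H →L[ℂ] H) ζ + amp ℕ (b : H →L[ℂ] H) ζ by ext i; simp, inner_add_right, ha, hb,
          add_zero]
      | smul c a _ ha =>
        rw [show amp ℕ ((c • a : M.Elem) : H →L[ℂ] H) ζ =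
          c • amp ℕ (a : H →L[ℂ] H) ζ by ext i; simp, inner_smul_right, ha, mul_zero])
    (by rw [wstar_image_amp]; exact amp_mem_ampAlgebra hyS)
  rw [key, hpy, hψy, zero_div, zero_smul, sub_zero] at this
  exact this

/-- `ζ` lies in the closure of `T Ψ`. -/
def MemClosure (Ψ : Amp ℕ H) (T : Submodule ℂ M.Elem) (ζ : Amp ℕ H) : Prop :=
  ∀ η, (∀ x ∈ T, ⟪η, amp ℕ (x : H →L[ℂ] H) Ψ⟫_ℂ = 0) → ⟪η, ζ⟫_ℂ = 0

lemma MemClosure.inner_apply_eq_zero {T : Submodule ℂ M.Elem} {ζ η : Amp ℕ H}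
    (hζ : MemClosure Ψ T ζ) {w : M.Elem}
    (h : ∀ x ∈ T, ⟪η, amp ℕ ((w * x : M.Elem) : H →L[ℂ] H) Ψ⟫_ℂ = 0) :
    ⟪η, amp ℕ (w : H →L[ℂ] H) ζ⟫_ℂ = 0 := by
  rw [← inner_star_apply_left]
  refine hζ _ fun x hx ↦ ?_
  rw [inner_star_apply_left, ← h x hx,
    show ((w * x : M.Elem) : H →L[ℂ] H) = (w : H →L[ℂ] H) * x from rfl, amp_mul]
  rfl

variable {𝒞 : Set M.Elem}

/-- A product of several limits is awkward, so the vector obtained by applying the product to `Ψ` is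
built from the right. If the leftmost letter is in `𝒞` the vector lies in the closure of `rightSpan`
applied to `Ψ`; if it is in `pNp`, in that of `leftSpan`. Each step approximates a single letter
acting on a fixed vector. Since `ψ` vanishes on both spans, the vector is orthogonal to `Ψ`. -/
theorem map_prod_eq_zero_of_corner (hψ : IsNormalState M ψ)
    (hfree : IsFree ψ ![(𝔻 : Set M.Elem), (𝔹 : Set M.Elem)]) (h𝔸 : 𝔸 ≤ 𝔻)
    (hstar : ∀ x ∈ (𝔸 : Set M.Elem) ∪ 𝔹, star x ∈ (𝔸 : Set M.Elem) ∪ 𝔹) (hp : p ∈ 𝔸)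
    (hps : star p = p) (hψp : ψ p ≠ 0) (hpa : ∀ a ∈ 𝔸, ∃ c : ℂ, p * a * p = c • p)
    (h𝒞 : 𝒞 ⊆ centered ψ 𝔻) (h𝔸𝒞 : ∀ a ∈ 𝔸, ∀ c ∈ 𝒞, a * c ∈ 𝒞)
    (h𝒞𝔸 : ∀ c ∈ 𝒞, ∀ a ∈ 𝔸, c * a ∈ 𝒞) (l : List (Fin 2 × M.Elem)) (hl : l ≠ [])
    (hchain : l.IsChain fun a b ↦ a.1 ≠ b.1)
    (hmem : ∀ a ∈ l, a.2 ∈ ![𝒞, {y | (y : H →L[ℂ] H) ∈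
      wstar ((fun x : M.Elem ↦ (x : H →L[ℂ] H)) '' ((𝔸 : Set M.Elem) ∪ 𝔹)) ∧
      p * y * p = y ∧ ψ y = 0}] a.1) :
    ψ (l.map Prod.snd).prod = 0 := by
  obtain ⟨Ψ, hΨ⟩ := hψ.exists_vector
  have h1 := hψ.map_one
  have key : ∀ (a : Fin 2 × M.Elem) (l : List (Fin 2 × M.Elem)),
      (a :: l).IsChain (fun a b ↦ a.1 ≠ b.1) →
      (∀ b ∈ a :: l, b.2 ∈ ![𝒞, {y | (y : H →L[ℂ] H) ∈
        wstar ((fun x : M.Elem ↦ (x : H →L[ℂ] H)) '' ((𝔸 : Set M.Elem) ∪ 𝔹)) ∧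
        p * y * p = y ∧ ψ y = 0}] b.1) →
      MemClosure Ψ (![rightSpan ψ 𝔹 𝔻 𝒞, leftSpan ψ 𝔸 𝔹 𝔻] a.1)
        (amp ℕ (((a :: l).map Prod.snd).prod : H →L[ℂ] H) Ψ) := by
    intro a l
    induction l generalizing a with
    | nil =>
      intro _ h
      have ha := h a (by simp)
      obtain ⟨i, x⟩ := a
      simp only [List.map_cons, List.map_nil, List.prod_cons, List.prod_nil, mul_one]
      fin_cases i
      · exact fun η hη ↦ hη _ (Submodule.subset_span (Or.inl ha))
      · exact fun η hη ↦ inner_eq_zero_of_sandwich hΨ h1 hfree h𝔸 hstar hp hps hψp hpa ha.1 ha.2.1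
          ha.2.2 fun w hw ↦ hη _ (sandwich_subset_leftSpan h1 h𝔸 hw)
    | cons b l ih =>
      intro hc h
      rw [List.isChain_cons_cons] at hc
      have ha := h a (by simp)
      have hb := ih b hc.2 fun c hc ↦ h c (List.mem_cons_of_mem _ hc)
      have hab := hc.1
      rw [List.map_cons, List.prod_cons]
      generalize ((b :: l).map Prod.snd).prod = z at hb
      rw [show ((a.2 * z : M.Elem) : H →L[ℂ] H) = (a.2 : H →L[ℂ] H) * z from rfl, amp_mul,
        mul_apply_eq_comp]
      generalize amp ℕ (z : H →L[ℂ] H) Ψ = ζ at hb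
      obtain ⟨i, x⟩ := a
      obtain ⟨i', x'⟩ := b
      fin_cases i
      · have hi' : i' = 1 := by
          fin_cases i'
          · exact absurd rfl hab
          · rfl
        subst hi'
        exact fun η hη ↦ hb.inner_apply_eq_zero fun y hy ↦ hη _ (mul_leftSpan h𝒞𝔸 ha hy)
      · have hi' : i' = 0 := by
          fin_cases i'
          · rfl
          · exact absurd rfl hab
        subst hi'
        exact fun η hη ↦ inner_eq_zero_of_sandwich hΨ h1 hfree h𝔸 hstar hp hps hψp hpa ha.1 ha.2.1
          ha.2.2 fun w hw ↦ hb.inner_apply_eq_zero fun y hy ↦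
            hη _ (sandwich_mul_rightSpan h1 h𝔸 h𝒞 h𝔸𝒞 hw hy)
  match l, hl with
  | a :: l, _ =>
    have h2 := key a l hchain hmem
    rw [hΨ]
    refine h2 Ψ fun x hx ↦ ?_
    rw [← hΨ]
    obtain ⟨i, y⟩ := a
    fin_cases i
    · exact map_rightSpan h1 hfree h𝒞 hx
    · exact map_leftSpan h1 hfree h𝔸 hx

end CornerFreeness

/-! ### Density of `j(A) j(e) H` and extension of operators from the corner. -/

section Generation

/-- If a state-preserving homomorphism `j` maps a factor `A` into `M`, then the vectors `j(a) j(e) v`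
span a dense subspace, for every `e ≠ 0`. -/
lemma total_of_statePreserving {A : VonNeumannAlgebra K} {M : VonNeumannAlgebra H}
    {φ : A.Elem →ₗ[ℂ] ℂ} (hφ : IsNormalState A φ) {ψ : M.Elem →ₗ[ℂ] ℂ}
    (hψ : IsFaithfulNormalState M ψ) {j : A.Elem →⋆ₐ[ℂ] M.Elem} (hj : ∀ a, ψ (j a) = φ a)
    (hA : A.IsFactor) {e : A.Elem} (he : e ≠ 0) (hes : star e = e) {z : H}
    (hz : ∀ a v, ⟪(j a : H →L[ℂ] H) ((j e : H →L[ℂ] H) v), z⟫_ℂ = 0) : z = 0 := by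
  obtain ⟨ξ, hξ⟩ := hφ.exists_vector
  obtain ⟨η, hη⟩ := hψ.exists_vector
  obtain ⟨Q, hQ1, hQ2, hQ3, hQ4, hQ5⟩ := exists_projection
    fun i : A.Elem × H ↦ (j i.1 : H →L[ℂ] H) ((j e : H →L[ℂ] H) i.2)
  have hQM : Q ∈ M := by
    rw [← commutant_commutant M, mem_commutant_iff]
    have hc : ∀ T ∈ M.commutant, ∀ (a : M.Elem) v, T ((a : H →L[ℂ] H) v) = (a : H →L[ℂ] H) (T v) :=
      fun T hT a v ↦ (congr($(mem_commutant_iff.1 hT _ a.2) v)).symm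
    intro T hT
    refine (hQ5 T (fun i ↦ ?_) fun i ↦ ?_).symm
    · rw [hc T hT, hc T hT]; exact hQ3 (i.1, T i.2)
    · rw [hc _ (star_mem hT), hc _ (star_mem hT)]; exact hQ3 (i.1, star T i.2)
  obtain ⟨w, hw, -⟩ := exists_partialIsometry
    (u := fun x : A.Elem ↦ amp ℕ (x : K →L[ℂ] K) ξ) (v := fun x ↦ amp ℕ (j x : H →L[ℂ] H) η) (by
      intro x y
      have h2 : ψ (star (j x) * j y) = φ (star x * y) := by rw [← hj, map_mul j, map_star j]
      rw [hξ, hη] at h2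
      change ⟪η, amp ℕ (star (j x : H →L[ℂ] H) * (j y : H →L[ℂ] H)) η⟫_ℂ =
        ⟪ξ, amp ℕ (star (x : K →L[ℂ] K) * (y : K →L[ℂ] K)) ξ⟫_ℂ at h2
      rw [amp_mul, amp_mul, amp_star, amp_star, mul_apply_eq_comp, mul_apply_eq_comp,
        inner_star_apply_right, inner_star_apply_right] at h2
      exact h2.symm)
  have hS : IsStarSemigroup (Set.range fun i : A.Elem × A.Elem ↦
      amp ℕ ((i.1 * e * i.2 : A.Elem) : K →L[ℂ] K)) :=
    { mul_mem := by
        rintro _ ⟨⟨a, b⟩, rfl⟩ _ ⟨⟨c, d⟩, rfl⟩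
        refine ⟨(a, b * (c * e * d)), ?_⟩
        rw [← amp_mul]
        exact congrArg (fun x : A.Elem ↦ amp ℕ (x : K →L[ℂ] K))
          (show a * e * (b * (c * e * d)) = a * e * b * (c * e * d) by simp only [mul_assoc])
      star_mem := by
        rintro _ ⟨⟨a, b⟩, rfl⟩
        refine ⟨(star b, star a), ?_⟩
        rw [← amp_star]
        exact congrArg (fun x : A.Elem ↦ amp ℕ (x : K →L[ℂ] K))
          (show star b * e * star a = star (a * e * b) by simp only [star_mul, hes, mul_assoc]) }
  obtain ⟨q, hq1, hq2, hq3, hq4, hq5⟩ := exists_cyclic_projection hS ξ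
  -- Each `e a*` kills `ξ - q ξ`, so every coordinate of this vector is orthogonal to the vectors `a
  -- e v`, which are total because `A` is a factor.
  have hqξ : q ξ = ξ := by
    symm
    rw [← sub_eq_zero]
    ext n
    refine hA.total he fun a v ↦ ?_
    have h1 := hq5 _ ⟨(1, star a), rfl⟩
    have h2 : amp ℕ ((1 * e * star a : A.Elem) : K →L[ℂ] K) (ξ - q ξ) = 0 := by
      have h3 := congr($h1 ξ)
      simp only [mul_apply_eq_comp] at h3
      rw [map_sub, ← h3, hq3 _ ⟨(1, star a), rfl⟩, sub_self]
    have h4 : ((e * star a : A.Elem) : K →L[ℂ] K) ((ξ - q ξ : Amp ℕ K) n) = 0 := by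
      rw [one_mul] at h2
      rw [← amp_apply, h2]
      rfl
    have h5 : (a : K →L[ℂ] K) ((e : K →L[ℂ] K) v) =
        star ((e * star a : A.Elem) : K →L[ℂ] K) v := by
      change ((a * e : A.Elem) : K →L[ℂ] K) v = ((star (e * star a) : A.Elem) : K →L[ℂ] K) v
      rw [star_mul, star_star, hes]
    rw [h5, inner_star_apply_left, h4, inner_zero_right]
  -- This transports `q ξ = ξ` through `w` to `Q η = η` in the amplification, without assuming `j`
  -- normal; as `η` is separating and `Q ∈ M`, it follows that `Q = 1`.
  have hQw : (amp ℕ Q ∘L w) ∘L q = w ∘L q := by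
    refine clm_eq_of_family (u := fun i : A.Elem × A.Elem ↦
      amp ℕ ((i.1 * e * i.2 : A.Elem) : K →L[ℂ] K) ξ) (fun i ↦ ?_) fun z hz ↦ ?_
    · simp only [ContinuousLinearMap.comp_apply]
      rw [hq3 _ ⟨i, rfl⟩, hw]
      ext n
      rw [amp_apply, amp_apply, map_mul, map_mul]
      exact hQ3 (i.1, (j i.2 : H →L[ℂ] H) (η n))
    · have : q z = 0 := hq4 z (by rintro _ ⟨i, rfl⟩; exact hz i)
      simp only [ContinuousLinearMap.comp_apply, this, map_zero]
  have hwξ : w ξ = η := by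
    have := hw 1
    rw [map_one] at this
    simpa [amp_one] using this
  have hQη : amp ℕ Q η = η := by
    have := congr($hQw ξ)
    simpa only [ContinuousLinearMap.comp_apply, hqξ, hwξ] using this
  have h1 := hψ.separating hη (amp ℕ (1 - Q)) (amp_mem_ampAlgebra (sub_mem (one_mem M) hQM)) (by
    rw [amp_sub, amp_one, sub_apply, hQη]; simp)
  have h2 : 1 - Q = 0 := amp_injective (ι := ℕ) (h1.trans amp_zero.symm)
  have h3 := hQ4 z fun i ↦ hz i.1 i.2
  rwa [← sub_eq_zero.1 h2] at h3

/-- Partial isometries `T` on `pH` which commute with `pNp` extend to operators on `H` which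
commute with `N`. -/
lemma corner_commute {M N : VonNeumannAlgebra H} {p : H →L[ℂ] H}
    {J 𝒞 : Set (H →L[ℂ] H)} (hJ : J ⊆ N)
    (htot : ∀ z, (∀ a ∈ J, ∀ v, ⟪a (p v), z⟫_ℂ = 0) → z = 0)
    (h𝒞p : ∀ c ∈ 𝒞, c * p = p * c) (h𝒞J : ∀ c ∈ 𝒞, ∀ a ∈ J, c * a = a * c)
    (hgen : ∀ T : H →L[ℂ] H, (∀ x ∈ N, T * x = x * T) → (∀ c ∈ 𝒞, T * c = c * T) →
      ∀ y ∈ M, T * y = y * T)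
    {T : H →L[ℂ] H} (hpT : p * T = T) (hTp : T * p = T) (hTT : star T * T = p)
    (hTN : ∀ x ∈ N, T * (p * x * p) = (p * x * p) * T) (hT𝒞 : ∀ c ∈ 𝒞, T * c = c * T)
    {y : H →L[ℂ] H} (hy : y ∈ M) (hyp : y * p = y) (hpy : p * y = y) : T * y = y * T := by
  have hps : star p = p := by rw [← hTT, star_mul, star_star]
  -- The extension is `x p v ↦ x T v`. Gram matrices agree because `T* x* x' T = T* (p x* x' p) T =
  -- p x* x' p`.
  obtain ⟨w, hw, -⟩ := exists_partialIsometry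
    (u := fun i : N × H ↦ (i.1 : H →L[ℂ] H) (p i.2)) (v := fun i ↦ (i.1 : H →L[ℂ] H) (T i.2)) (by
      rintro ⟨x, v⟩ ⟨x', v'⟩
      have h1 : star T * (star (x : H →L[ℂ] H) * x') * T =
          star p * (star (x : H →L[ℂ] H) * x') * p := by
        have h2 := hTN _ (mul_mem (star_mem x.2) x'.2)
        calc star T * (star (x : H →L[ℂ] H) * x') * T
            = star (p * T) * (star (x : H →L[ℂ] H) * x') * (p * T) := by rw [hpT]
          _ = star T * (p * (star (x : H →L[ℂ] H) * x') * p * T) := by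
            rw [star_mul, hps]; simp only [mul_assoc]
          _ = (star T * T) * p * (star (x : H →L[ℂ] H) * x') * p := by
            rw [← h2]; simp only [mul_assoc]
          _ = star p * (star (x : H →L[ℂ] H) * x') * p := by
            rw [mul_assoc (star T), hTp, hTT, hps]
      have h3 := congr(⟪v, $h1 v'⟫_ℂ)
      simp only [mul_apply_eq_comp, inner_star_apply_right] at h3
      exact h3.symm)
  have htot' : ∀ z, (∀ i : N × H, ⟪(i.1 : H →L[ℂ] H) (p i.2), z⟫_ℂ = 0) → z = 0 :=
    fun z hz ↦ htot z fun a ha v ↦ hz (⟨a, hJ ha⟩, v)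
  have hwN : ∀ x ∈ N, w * x = x * w := by
    intro x hx
    refine clm_eq_of_total htot' fun i ↦ ?_
    have h1 := hw (⟨x * i.1, mul_mem hx i.1.2⟩, i.2)
    have h2 := hw i
    simp only [mul_apply_eq_comp] at h1 h2 ⊢
    rw [h1, h2]
  have hw𝒞 : ∀ c ∈ 𝒞, w * c = c * w := by
    intro c hc
    -- The smaller family indexed by `J` is used because `c` commutes with `J` but not with all of
    -- `N`: here `c a p v = a p c v`.
    refine clm_eq_of_total (u := fun i : J × H ↦ (i.1 : H →L[ℂ] H) (p i.2))
      (fun z hz ↦ htot z fun a ha v ↦ hz (⟨a, ha⟩, v)) fun i ↦ ?_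
    have h1 := hw (⟨i.1, hJ i.1.2⟩, c i.2)
    have h2 := hw (⟨i.1, hJ i.1.2⟩, i.2)
    have e1 := fun v ↦ congr($(h𝒞J c hc i.1 i.1.2) v)
    have e2 := fun v ↦ congr($(h𝒞p c hc) v)
    have e3 := fun v ↦ congr($(hT𝒞 c hc) v)
    simp only [mul_apply_eq_comp] at h1 h2 e1 e2 e3 ⊢
    rw [e1, e2, h1, h2, e3, e1]
  have hwy := hgen w hwN hw𝒞 y hy
  have hwp : w * p = T := by
    ext v
    exact hw (1, v)
  calc T * y = w * (p * y) := by rw [← mul_assoc, hwp]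
    _ = w * (y * p) := by rw [hpy, hyp]
    _ = y * w * p := by rw [← mul_assoc, hwy]
    _ = y * T := by rw [mul_assoc, hwp]

end Generation

/-! ### Uniqueness of the free product. -/

section FreeProducts

variable {M₁ : VonNeumannAlgebra H} {M₂ : VonNeumannAlgebra K}

lemma IsFree.swap {R : Type*} [Ring R] {φ : R → ℂ} {S T : Set R} (h : IsFree φ ![S, T]) :
    IsFree φ ![T, S] := by
  intro l hl hc hm
  have := h (l.map fun a ↦ (Equiv.swap 0 1 a.1, a.2)) (by simpa using hl)
    (by
      rw [List.isChain_map]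
      exact hc.imp fun a b hab ↦ (Equiv.swap (0 : Fin 2) 1).injective.ne hab)
    (by
      intro a ha
      obtain ⟨⟨i, x⟩, hb, rfl⟩ := List.mem_map.1 ha
      have := hm _ hb
      fin_cases i
      · simpa using this
      · simpa using this)
  simpa [Function.comp_def] using this

lemma generatedBy_comm {M : VonNeumannAlgebra L} (f : M₁.Elem →⋆ₐ[ℂ] M.Elem)
    (g : M₂.Elem →⋆ₐ[ℂ] M.Elem) : generatedBy f g = generatedBy g f := by
  rw [generatedBy, generatedBy, Set.union_comm]

/-- The free product is unique up to state-preserving isomorphism. -/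
theorem IsFreeProduct.exists_equiv {φ₁ : M₁.Elem →ₗ[ℂ] ℂ} {φ₂ : M₂.Elem →ₗ[ℂ] ℂ}
    {M : VonNeumannAlgebra L} {φ : M.Elem →ₗ[ℂ] ℂ}
    {ι₁ : M₁.Elem →⋆ₐ[ℂ] M.Elem} {ι₂ : M₂.Elem →⋆ₐ[ℂ] M.Elem}
    (h : IsFreeProduct φ₁ φ₂ φ ι₁ ι₂)
    {E : Type*} [NormedAddCommGroup E] [InnerProductSpace ℂ E] [CompleteSpace E]
    {P : VonNeumannAlgebra E} {ω : P.Elem →ₗ[ℂ] ℂ}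
    {κ₁ : M₁.Elem →⋆ₐ[ℂ] P.Elem} {κ₂ : M₂.Elem →⋆ₐ[ℂ] P.Elem}
    (h' : IsFreeProduct φ₁ φ₂ ω κ₁ κ₂) :
    ∃ α : M.Elem ≃⋆ₐ[ℂ] P.Elem, ∀ x, ω (α x) = φ x := by
  -- Working with pairs reduces words in `M` and in `P` simultaneously. Centering the first
  -- coordinate also centers the second, as both embeddings preserve the states.
  set A : Fin 2 → Set (M.Elem × P.Elem) :=
    ![Set.range fun x ↦ (ι₁ x, κ₁ x), Set.range fun y ↦ (ι₂ y, κ₂ y)] with hA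
  set S : Fin 2 → Set (M.Elem × P.Elem) := fun i ↦ {g | g ∈ A i ∧ φ g.1 = 0} with hS
  have hφω : ∀ i, ∀ g ∈ A i, φ g.1 = ω g.2 := by
    intro i
    fin_cases i
    · rintro _ ⟨x, rfl⟩; exact (h.map_left x).trans (h'.map_left x).symm
    · rintro _ ⟨x, rfl⟩; exact (h.map_right x).trans (h'.map_right x).symm
  have hmul : ∀ i, ∀ a ∈ A i, ∀ b ∈ S i, a * b ∈ A i := by
    intro i
    fin_cases i
    · rintro _ ⟨x, rfl⟩ _ ⟨⟨y, rfl⟩, -⟩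
      exact ⟨x * y, Prod.ext (map_mul _ _ _) (map_mul _ _ _)⟩
    · rintro _ ⟨x, rfl⟩ _ ⟨⟨y, rfl⟩, -⟩
      exact ⟨x * y, Prod.ext (map_mul _ _ _) (map_mul _ _ _)⟩
  have hc : ∀ i, ∀ a ∈ A i, ∃ τ : ℂ, a - τ • 1 ∈ S i := by
    intro i a ha
    refine ⟨φ a.1, ?_, ?_⟩
    · fin_cases i
      · obtain ⟨x, rfl⟩ := ha
        exact ⟨x - φ (ι₁ x) • 1, Prod.ext (by simp) (by simp)⟩
      · obtain ⟨x, rfl⟩ := ha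
        exact ⟨x - φ (ι₂ x) • 1, Prod.ext (by simp) (by simp)⟩
    · simp [h.state.map_one]
  have hstarA : ∀ g ∈ ⋃ i, A i, star g ∈ ⋃ i, A i := by
    intro g hg
    obtain ⟨i, hi⟩ := Set.mem_iUnion.1 hg
    refine Set.mem_iUnion.2 ⟨i, ?_⟩
    fin_cases i
    · obtain ⟨x, rfl⟩ := hi
      exact ⟨star x, Prod.ext (map_star _ _) (map_star _ _)⟩
    · obtain ⟨x, rfl⟩ := hi
      exact ⟨star x, Prod.ext (map_star _ _) (map_star _ _)⟩
  have hl1 : ∀ x, (ι₁ x, κ₁ x) ∈ Submonoid.closure (⋃ i, A i) := fun x ↦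
    Submonoid.subset_closure (Set.mem_iUnion.2 ⟨0, x, rfl⟩)
  have hl2 : ∀ x, (ι₂ x, κ₂ x) ∈ Submonoid.closure (⋃ i, A i) := fun x ↦
    Submonoid.subset_closure (Set.mem_iUnion.2 ⟨1, x, rfl⟩)
  refine exists_statePreserving_equiv h.state h'.state (one_mem (Submonoid.closure (⋃ i, A i)))
    (fun g hg k hk ↦ mul_mem hg hk) (fun g hg ↦ star_mem_closure hstarA hg) ?_ ?_ ?_
  · refine SetLike.coe_injective (Set.Subset.antisymm (wstar_le ?_) ?_)
    · rintro _ ⟨g, -, rfl⟩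
      exact g.1.2
    · conv_lhs => rw [← h.generate]
      refine wstar_le ?_
      rintro _ (⟨x, rfl⟩ | ⟨x, rfl⟩)
      · exact subset_wstar _ ⟨_, hl1 x, rfl⟩
      · exact subset_wstar _ ⟨_, hl2 x, rfl⟩
  · refine SetLike.coe_injective (Set.Subset.antisymm (wstar_le ?_) ?_)
    · rintro _ ⟨g, -, rfl⟩
      exact g.2.2
    · conv_lhs => rw [← h'.generate]
      refine wstar_le ?_
      rintro _ (⟨x, rfl⟩ | ⟨x, rfl⟩)
      · exact subset_wstar _ ⟨_, hl1 x, rfl⟩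
      · exact subset_wstar _ ⟨_, hl2 x, rfl⟩
  · intro g hg
    have hspan := closure_subset_span_alternatingWords hmul hc hg
    clear hg
    induction hspan using Submodule.span_induction with
    | zero => simp
    | add x y _ _ hx hy => rw [Prod.fst_add, Prod.snd_add, map_add, map_add, hx, hy]
    | smul c x _ hx => rw [Prod.smul_fst, Prod.smul_snd, map_smul, map_smul, hx]
    | mem x hx =>
      obtain ⟨l, hl, hm, rfl⟩ := hx
      have e1 : ((l.map Prod.snd).prod).1 =
          ((l.map fun a ↦ (a.1, a.2.1)).map Prod.snd).prod := by
        rw [List.map_map]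
        exact (map_list_prod (MonoidHom.fst M.Elem P.Elem) _).trans (by rw [List.map_map]; rfl)
      have e2 : ((l.map Prod.snd).prod).2 =
          ((l.map fun a ↦ (a.1, a.2.2)).map Prod.snd).prod := by
        rw [List.map_map]
        exact (map_list_prod (MonoidHom.snd M.Elem P.Elem) _).trans (by rw [List.map_map]; rfl)
      by_cases hl0 : l = []
      · subst hl0
        simp [h.state.map_one, h'.state.map_one]
      · rw [e1, e2, h.free _ (by simpa using hl0) (by rw [List.isChain_map]; exact hl) ?_,
          h'.free _ (by simpa using hl0) (by rw [List.isChain_map]; exact hl) ?_]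
        · intro a ha
          obtain ⟨⟨i, g⟩, hb, rfl⟩ := List.mem_map.1 ha
          obtain ⟨hg1, hg2⟩ := hm _ hb
          refine ⟨?_, (hφω i g hg1).symm.trans hg2⟩
          fin_cases i
          · obtain ⟨x, rfl⟩ := hg1; exact ⟨x, rfl⟩
          · obtain ⟨x, rfl⟩ := hg1; exact ⟨x, rfl⟩
        · intro a ha
          obtain ⟨⟨i, g⟩, hb, rfl⟩ := List.mem_map.1 ha
          obtain ⟨hg1, hg2⟩ := hm _ hb
          refine ⟨?_, hg2⟩
          fin_cases i
          · obtain ⟨x, rfl⟩ := hg1; exact ⟨x, rfl⟩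
          · obtain ⟨x, rfl⟩ := hg1; exact ⟨x, rfl⟩

end FreeProducts

/-! ### Arithmetic of elementary tensors. -/

section Tensor

variable {C : VonNeumannAlgebra H} {A : VonNeumannAlgebra K}

lemma opTensor_add_left (x x' : H →L[ℂ] H) (y : K →L[ℂ] K) :
    opTensor (x + x') y = opTensor x y + opTensor x' y := by
  apply opTensor_ext
  intro t
  rw [add_apply, opTensor_coe, opTensor_coe, opTensor_coe,
    TensorProduct.mapL_add_left, add_apply, UniformSpace.Completion.coe_add]

lemma opTensor_smul_left (c : ℂ) (x : H →L[ℂ] H) (y : K →L[ℂ] K) :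
    opTensor (c • x) y = c • opTensor x y := by
  apply opTensor_ext
  intro t
  rw [smul_apply, opTensor_coe, opTensor_coe,
    TensorProduct.mapL_smul_left, smul_apply,
    UniformSpace.Completion.coe_smul]

lemma tmul_mul_tmul (c c' : C.Elem) (a a' : A.Elem) :
    tmul c a * tmul c' a' = tmul (c * c') (a * a') :=
  Subtype.ext (opTensor_mul _ _ _ _).symm

lemma star_tmul (c : C.Elem) (a : A.Elem) : star (tmul c a) = tmul (star c) (star a) :=
  Subtype.ext (opTensor_star _ _).symm

lemma tmul_add_left (c c' : C.Elem) (a : A.Elem) : tmul (c + c') a = tmul c a + tmul c' a :=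
  Subtype.ext (opTensor_add_left _ _ _)

lemma tmul_smul_left (k : ℂ) (c : C.Elem) (a : A.Elem) : tmul (k • c) a = k • tmul c a :=
  Subtype.ext (opTensor_smul_left _ _ _)

end Tensor

/-! ### Homomorphisms and states on corners. -/

section Corners

variable {M : VonNeumannAlgebra H} {p : H →L[ℂ] H}

/-- A non-unital `*`-homomorphism into `M` with `1 ↦ p`, viewed as a unital `*`-homomorphism into
the corner `pMp`. -/
lemma exists_corner_hom {C : VonNeumannAlgebra K} (hp : IsStarProjection p) (hpM : p ∈ M)
    {g : C.Elem → M.Elem} (hadd : ∀ x y, g (x + y) = g x + g y)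
    (hsmul : ∀ (c : ℂ) x, g (c • x) = c • g x) (hmul : ∀ x y, g (x * y) = g x * g y)
    (hstar : ∀ x, g (star x) = star (g x)) (h1 : (g 1 : H →L[ℂ] H) = p) :
    ∃ ρ : C.Elem →⋆ₐ[ℂ] (M.corner hp hpM).Elem, ∀ c, cornerIncl M hp hpM (ρ c) = g c := by
  have hlift : ∀ x, cornerLift p (compress p (g x)) = g x := fun x ↦ by
    rw [cornerLift_compress hp, ← h1]
    exact congrArg Subtype.val (show g 1 * g x * g 1 = g x by rw [← hmul, ← hmul, one_mul, mul_one])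
  have hmem : ∀ x, compress p (g x) ∈ (M.corner hp hpM).toStarSubalgebra := fun x ↦ by
    change cornerLift p (compress p (g x)) ∈ M.toStarSubalgebra
    rw [hlift]; exact (g x).2
  have hone : compress p (g 1 : H →L[ℂ] H) = 1 := cornerLift_injective p (by
    rw [hlift, h1, cornerLift_one hp])
  have hzero : g 0 = 0 := by simpa using hsmul 0 0
  refine ⟨
    { toFun := fun x ↦ ⟨compress p (g x), hmem x⟩
      map_one' := Subtype.ext hone
      map_mul' := fun x y ↦ Subtype.ext (cornerLift_injective p (by
        change cornerLift p (compress p (g (x * y))) =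
          cornerLift p (compress p (g x) * compress p (g y))
        rw [cornerLift_mul, hlift, hlift, hlift, hmul]; rfl))
      map_zero' := Subtype.ext (cornerLift_injective p (by
        change cornerLift p (compress p (g 0)) = cornerLift p 0
        rw [hlift, hzero]; ext; simp [cornerLift]))
      map_add' := fun x y ↦ Subtype.ext (cornerLift_injective p (by
        change cornerLift p (compress p (g (x + y))) =
          cornerLift p (compress p (g x) + compress p (g y))
        rw [cornerLift_add, hlift, hlift, hlift, hadd]; rfl))
      commutes' := fun c ↦ Subtype.ext (cornerLift_injective p (by
        change cornerLift p (compress p (g (algebraMap ℂ _ c))) =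
          cornerLift p (algebraMap ℂ (cornerSpace p →L[ℂ] cornerSpace p) c)
        rw [Algebra.algebraMap_eq_smul_one, Algebra.algebraMap_eq_smul_one, cornerLift_smul, hlift,
          hsmul, cornerLift_one hp, ← h1]; rfl))
      map_star' := fun x ↦ Subtype.ext (cornerLift_injective p (by
        change cornerLift p (compress p (g (star x))) = cornerLift p (star (compress p (g x)))
        rw [cornerLift_star, hlift, hlift, hstar]; rfl)) },
    fun c ↦ Subtype.ext (hlift c)⟩

lemma cornerIncl_mul (hp : IsStarProjection p) (hpM : p ∈ M) (x y : (M.corner hp hpM).Elem) :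
    cornerIncl M hp hpM (x * y) = cornerIncl M hp hpM x * cornerIncl M hp hpM y :=
  Subtype.ext (cornerLift_mul p _ _)

lemma cornerIncl_star (hp : IsStarProjection p) (hpM : p ∈ M) (x : (M.corner hp hpM).Elem) :
    cornerIncl M hp hpM (star x) = star (cornerIncl M hp hpM x) :=
  Subtype.ext (cornerLift_star p _)

lemma cornerIncl_one (hp : IsStarProjection p) (hpM : p ∈ M) :
    cornerIncl M hp hpM 1 = ⟨p, hpM⟩ :=
  Subtype.ext (cornerLift_one hp)

lemma cornerIncl_list_prod (hp : IsStarProjection p) (hpM : p ∈ M)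
    {l : List (M.corner hp hpM).Elem} (hl : l ≠ []) :
    cornerIncl M hp hpM l.prod = (l.map (cornerIncl M hp hpM)).prod := by
  induction l with
  | nil => exact absurd rfl hl
  | cons a l ih =>
    by_cases h : l = []
    · subst h; simp
    · rw [List.prod_cons, List.map_cons, List.prod_cons, cornerIncl_mul, ih h]

lemma IsFaithfulNormalState.map_projection_ne_zero {φ : M.Elem →ₗ[ℂ] ℂ}
    (hφ : IsFaithfulNormalState M φ) {e : M.Elem} (he : IsStarProjection e) (h0 : e ≠ 0) :
    φ e ≠ 0 := fun h ↦ h0 (hφ.faithful e (by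
      rw [he.isSelfAdjoint.star_eq, he.isIdempotentElem.eq, h]))

lemma IsFaithfulNormalState.cornerState {φ : M.Elem →ₗ[ℂ] ℂ} (hφ : IsFaithfulNormalState M φ)
    (hp : IsStarProjection p) (hpM : p ∈ M) (h0 : φ ⟨p, hpM⟩ ≠ 0) :
    IsFaithfulNormalState (M.corner hp hpM) (cornerState φ hp hpM) where
  nonneg x := by
    have h1 := hφ.nonneg ⟨p, hpM⟩
    have h2 := hφ.nonneg (cornerIncl M hp hpM x)
    rw [show star (⟨p, hpM⟩ : M.Elem) * ⟨p, hpM⟩ = ⟨p, hpM⟩ from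
      Subtype.ext (by
        change star p * p = p
        rw [hp.isSelfAdjoint.star_eq, hp.isIdempotentElem.eq])] at h1
    change 0 ≤ (φ ⟨p, hpM⟩)⁻¹ * φ (cornerIncl M hp hpM (star x * x))
    rw [cornerIncl_mul, cornerIncl_star]
    exact mul_nonneg (inv_nonneg.2 h1) h2
  map_one := by
    change (φ ⟨p, hpM⟩)⁻¹ * φ (cornerIncl M hp hpM 1) = 1
    rw [cornerIncl_one, inv_mul_cancel₀ h0]
  normal := by
    obtain ⟨ξ, hξ⟩ := hφ.normal
    have h1 := hφ.nonneg ⟨p, hpM⟩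
    rw [show star (⟨p, hpM⟩ : M.Elem) * ⟨p, hpM⟩ = ⟨p, hpM⟩ from
      Subtype.ext (by
        change star p * p = p
        rw [hp.isSelfAdjoint.star_eq, hp.isIdempotentElem.eq])] at h1
    obtain ⟨r, hr0, hr⟩ : ∃ r : ℝ, 0 ≤ r ∧ φ ⟨p, hpM⟩ = r :=
      ⟨_, (Complex.nonneg_iff.1 h1).1, (Complex.eq_re_of_ofReal_le h1)⟩
    -- Vectors for the normalized state are the original ones compressed to `pH` and scaled by
    -- `φ(p)^(-1/2)`.
    set s : ℂ := ((Real.sqrt r : ℝ) : ℂ)⁻¹ with hs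
    refine ⟨fun n ↦ s • ContinuousLinearMap.adjoint (cornerSpace p).subtypeL (ξ n), fun x ↦ ?_⟩
    change HasSum _ ((φ ⟨p, hpM⟩)⁻¹ * φ (cornerIncl M hp hpM x))
    refine ((hξ (cornerIncl M hp hpM x)).mul_left (φ ⟨p, hpM⟩)⁻¹).congr_fun ?_
    intro n
    have hss : (starRingEnd ℂ) s * s = (φ ⟨p, hpM⟩)⁻¹ := by
      rw [hs, map_inv₀, Complex.conj_ofReal, ← mul_inv, ← Complex.ofReal_mul, Real.mul_self_sqrt hr0,
        hr]
    rw [map_smul, inner_smul_left, inner_smul_right, ← mul_assoc, hss,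
      ContinuousLinearMap.adjoint_inner_left]
    rfl
  faithful x hx := by
    change (φ ⟨p, hpM⟩)⁻¹ * φ (cornerIncl M hp hpM (star x * x)) = 0 at hx
    rw [cornerIncl_mul, cornerIncl_star] at hx
    have := hφ.faithful _ ((mul_eq_zero.1 hx).resolve_left (inv_ne_zero h0))
    refine Subtype.ext (cornerLift_injective p ((congrArg Subtype.val this).trans ?_))
    ext v
    simp [cornerLift]

end Corners

/-! ### Pulling back freeness. -/

section FreeFamilies

/-- Multiplicativity is asked only on nonempty products, so that the non-unital inclusion of a
corner is allowed. -/
lemma IsFree.comp {R R' ι : Type*} [Ring R] [Ring R'] {φ : R' → ℂ} {S : ι → Set R'}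
    (h : IsFree φ S) {f : R → R'} (hf : ∀ l ≠ [], f l.prod = (l.map f).prod) {S' : ι → Set R}
    (hS : ∀ i, ∀ x ∈ S' i, f x ∈ S i) : IsFree (fun x ↦ φ (f x)) S' := by
  intro l hl hc hm
  have := h (l.map fun a ↦ (a.1, f a.2)) (mt List.map_eq_nil_iff.1 hl)
    (by rw [List.isChain_map]; exact hc)
    (by
      intro a ha
      obtain ⟨b, hb, rfl⟩ := List.mem_map.1 ha
      exact ⟨hS _ _ (hm b hb).1, (hm b hb).2⟩)
  dsimp only
  rw [hf _ (mt List.map_eq_nil_iff.1 hl), List.map_map]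
  rwa [List.map_map] at this

lemma IsFree.const_mul {R ι : Type*} [Ring R] {φ : R → ℂ} {S : ι → Set R}
    (h : IsFree φ S) {k : ℂ} (hk : k ≠ 0) : IsFree (fun x ↦ k * φ x) S := fun l hl hc hm ↦
  mul_eq_zero_of_right _ (h l hl hc fun a ha ↦
    ⟨(hm a ha).1, (mul_eq_zero.1 (hm a ha).2).resolve_left hk⟩)

lemma isFreeProduct_toGenerated {M₁ : VonNeumannAlgebra H} {M₂ : VonNeumannAlgebra K}
    {M : VonNeumannAlgebra L} {φ₁ : M₁.Elem →ₗ[ℂ] ℂ} {φ₂ : M₂.Elem →ₗ[ℂ] ℂ} {ψ : M.Elem →ₗ[ℂ] ℂ}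
    {f : M₁.Elem →⋆ₐ[ℂ] M.Elem} {g : M₂.Elem →⋆ₐ[ℂ] M.Elem} (hψ : IsFaithfulNormalState M ψ)
    (hf : ∀ x, ψ (f x) = φ₁ x) (hg : ∀ y, ψ (g y) = φ₂ y)
    (hfg : IsFree ψ ![Set.range f, Set.range g]) :
    IsFreeProduct φ₁ φ₂
      (ψ ∘ₗ (StarSubalgebra.inclusion (generatedBy_le f g)).toAlgHom.toLinearMap)
      (toGeneratedLeft f g) (toGeneratedRight f g) where
  state :=
    { nonneg := fun x ↦ by
        have := hψ.nonneg (StarSubalgebra.inclusion (generatedBy_le f g) x)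
        rwa [← map_star, ← map_mul] at this
      map_one := by
        have := hψ.map_one
        rwa [← map_one (StarSubalgebra.inclusion (generatedBy_le f g))] at this
      normal := by
        obtain ⟨ξ, hξ⟩ := hψ.normal
        exact ⟨ξ, fun x ↦ hξ (StarSubalgebra.inclusion (generatedBy_le f g) x)⟩
      faithful := fun x hx ↦ by
        have := hψ.faithful (StarSubalgebra.inclusion (generatedBy_le f g) x) (by
          rw [← map_star, ← map_mul]; exact hx)
        exact Subtype.ext (congrArg (fun y : M.Elem ↦ (y : L →L[ℂ] L)) this) }
  map_left := hf
  map_right := hg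
  free := by
    refine hfg.comp (f := StarSubalgebra.inclusion (generatedBy_le f g))
      (fun l _ ↦ map_list_prod _ l) fun i ↦ ?_
    match i with
    | 0 => rintro _ ⟨x, rfl⟩; exact ⟨x, rfl⟩
    | 1 => rintro _ ⟨x, rfl⟩; exact ⟨x, rfl⟩
  generate := rfl

lemma IsFree.corner {M : VonNeumannAlgebra H} {ψ : M.Elem →ₗ[ℂ] ℂ} {p : H →L[ℂ] H}
    (hp : IsStarProjection p) (hpM : p ∈ M) (h0 : ψ ⟨p, hpM⟩ ≠ 0) {S T : Set M.Elem}
    (h : IsFree ψ ![S, T]) {S' T' : Set (M.corner hp hpM).Elem}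
    (hS : ∀ x ∈ S', cornerIncl M hp hpM x ∈ S) (hT : ∀ x ∈ T', cornerIncl M hp hpM x ∈ T) :
    IsFree (cornerState ψ hp hpM) ![S', T'] := by
  refine (h.comp (f := cornerIncl M hp hpM) (S' := ![S', T'])
    (fun l hl ↦ cornerIncl_list_prod hp hpM hl) fun i ↦ ?_).const_mul (inv_ne_zero h0)
  match i with
  | 0 => exact hS
  | 1 => exact hT

end FreeFamilies

/-! ### Freeness and generation in the corner of `(C ⊗ A) ∗ B`. -/

section Main

variable {E F : Type*} [NormedAddCommGroup E] [InnerProductSpace ℂ E] [CompleteSpace E]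
  [NormedAddCommGroup F] [InnerProductSpace ℂ F] [CompleteSpace F]
  {A : VonNeumannAlgebra K} {B : VonNeumannAlgebra E} {C : VonNeumannAlgebra H}
  {φA : A.Elem →ₗ[ℂ] ℂ} {φB : B.Elem →ₗ[ℂ] ℂ} {φC : C.Elem →ₗ[ℂ] ℂ}
  {χ : (C.tensor A).Elem →ₗ[ℂ] ℂ} {M : VonNeumannAlgebra F} {ψ : M.Elem →ₗ[ℂ] ℂ}
  {ι₁ : (C.tensor A).Elem →⋆ₐ[ℂ] M.Elem} {ι₂ : B.Elem →⋆ₐ[ℂ] M.Elem}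

/-- The embedding `a ↦ 1 ⊗ a` of `A` into `M`. -/
abbrev embedRight (ι₁ : (C.tensor A).Elem →⋆ₐ[ℂ] M.Elem) : A.Elem →⋆ₐ[ℂ] M.Elem :=
  ι₁.comp (tensorRight C A)

lemma map_embedRight (hφC : φC 1 = 1) (hχ : IsProductState φC φA χ)
    (hM : IsFreeProduct χ φB ψ ι₁ ι₂) (a : A.Elem) : ψ (embedRight ι₁ a) = φA a := by
  change ψ (ι₁ (tmul 1 a)) = φA a
  rw [hM.map_left, hχ.map_tmul, hφC, one_mul]

lemma isFree_tmul_corner (hφA : IsFaithfulNormalState A φA) (hφC : φC 1 = 1)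
    (hχ : IsProductState φC φA χ) (hM : IsFreeProduct χ φB ψ ι₁ ι₂) {e : A.Elem}
    (he : A.IsMinimalProjection e) :
    IsFree ψ ![Set.range fun c : C.Elem ↦ ι₁ (tmul c e),
      {y : M.Elem | (y : F →L[ℂ] F) ∈ generatedBy (embedRight ι₁) ι₂ ∧
        embedRight ι₁ e * y * embedRight ι₁ e = y}] := by
  have hpe : ψ (embedRight ι₁ e) = φA e := map_embedRight hφC hχ hM e
  have hφe : φA e ≠ 0 := hφA.map_projection_ne_zero he.isStarProjection he.ne_zero
  have hmul : ∀ c c' a a', ι₁ (tmul c a) * ι₁ (tmul c' a') = ι₁ (tmul (c * c') (a * a')) :=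
    fun c c' a a' ↦ by rw [← map_mul, tmul_mul_tmul]
  have hj : ∀ a, embedRight ι₁ a = ι₁ (tmul 1 a) := fun a ↦ rfl
  intro l hl hc hm
  -- The set `𝒞` contains `c ⊗ a` for every `a`, not only for `a = e`, so as to be stable under
  -- multiplication by `𝔸`; its elements are centered because `χ` is a product state.
  refine map_prod_eq_zero_of_corner (𝔸 := (embedRight ι₁).toAlgHom.range)
    (𝔹 := ι₂.toAlgHom.range) (𝔻 := ι₁.toAlgHom.range) (p := embedRight ι₁ e)
    (𝒞 := {x | ∃ c a, φC c = 0 ∧ x = ι₁ (tmul c a)}) hM.state.toIsNormalState hM.free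
    ?_ ?_ ⟨e, rfl⟩ ?_ (hpe ▸ hφe) ?_ ?_ ?_ ?_ l hl hc ?_
  · rintro _ ⟨a, rfl⟩
    exact ⟨tensorRight C A a, rfl⟩
  · rintro _ (⟨a, rfl⟩ | ⟨b, rfl⟩)
    · exact Or.inl ⟨star a, map_star (embedRight ι₁) a⟩
    · exact Or.inr ⟨star b, map_star ι₂ b⟩
  · rw [← map_star, he.isStarProjection.isSelfAdjoint.star_eq]
  · rintro _ ⟨a, rfl⟩
    obtain ⟨c, hc⟩ := he.exists_eq_smul a
    refine ⟨c, ?_⟩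
    rw [← map_smul, ← hc, map_mul, map_mul]
    rfl
  · rintro _ ⟨c, a, hc, rfl⟩
    exact ⟨⟨_, rfl⟩, by rw [hM.map_left, hχ.map_tmul, hc, zero_mul]⟩
  · rintro _ ⟨a, rfl⟩ _ ⟨c, a', hc, rfl⟩
    exact ⟨c, a * a', hc, (hmul 1 c a a').trans (by rw [one_mul])⟩
  · rintro _ ⟨c, a', hc, rfl⟩ _ ⟨a, rfl⟩
    exact ⟨c, a' * a, hc, (hmul c 1 a' a).trans (by rw [mul_one])⟩
  · rintro ⟨i, x⟩ ha
    obtain ⟨h1, h2⟩ := hm _ ha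
    dsimp only at h1 h2 ⊢
    match i, h1 with
    | 0, h1 =>
      obtain ⟨c, rfl⟩ := h1
      rw [hM.map_left, hχ.map_tmul] at h2
      exact ⟨c, e, (mul_eq_zero.1 h2).resolve_right hφe, rfl⟩
    | 1, h1 =>
      refine ⟨wstar_mono ?_ h1.1, h1.2, h2⟩
      rintro _ (⟨a, rfl⟩ | ⟨b, rfl⟩)
      · exact ⟨_, Or.inl ⟨a, rfl⟩, rfl⟩
      · exact ⟨_, Or.inr ⟨b, rfl⟩, rfl⟩

/-- Since `c ⊗ a = (c ⊗ 1)(1 ⊗ a)`, `T` commutes with the images of elementary tensors. These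
generate `C ⊗ A` only as a von Neumann algebra, and the normality needed of `ι₁` comes from
preservation of the states. -/
lemma generate_commute (hχ : IsProductState φC φA χ) (hM : IsFreeProduct χ φB ψ ι₁ ι₂)
    {T : F →L[ℂ] F} (hN : ∀ x ∈ generatedBy (embedRight ι₁) ι₂, T * x = x * T)
    (hC : ∀ c : C.Elem, T * (ι₁ (tmul c 1) : F →L[ℂ] F) = (ι₁ (tmul c 1) : F →L[ℂ] F) * T)
    {y : F →L[ℂ] F} (hy : y ∈ M) : T * y = y * T := by
  have hS : IsStarSemigroup {t | ∃ x ∈ C, ∃ y ∈ A, t = opTensor x y} :=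
    { mul_mem := by
        rintro _ ⟨x, hx, y, hy, rfl⟩ _ ⟨x', hx', y', hy', rfl⟩
        exact ⟨x * x', mul_mem hx hx', y * y', mul_mem hy hy', (opTensor_mul _ _ _ _).symm⟩
      star_mem := by
        rintro _ ⟨x, hx, y, hy, rfl⟩
        exact ⟨star x, star_mem hx, star y, star_mem hy, (opTensor_star _ _).symm⟩ }
  have h1 : ∀ x : (C.tensor A).Elem, T * (ι₁ x : F →L[ℂ] F) = (ι₁ x : F →L[ℂ] F) * T := by
    refine map_commute_of_statePreserving hχ.state hM.state ι₁ hM.map_left hS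
      ⟨1, one_mem C, 1, one_mem A, opTensor_one_one.symm⟩ rfl ?_
    rintro ⟨_, _⟩ ⟨c, hc, a, ha, rfl⟩
    have h2 : ι₁ (tmul ⟨c, hc⟩ ⟨a, ha⟩) =
        ι₁ (tmul ⟨c, hc⟩ 1) * embedRight ι₁ (⟨a, ha⟩ : A.Elem) := by
      change _ = ι₁ (tmul _ 1) * ι₁ (tmul 1 _)
      rw [← map_mul, tmul_mul_tmul, mul_one, one_mul]
    change T * (ι₁ (tmul ⟨c, hc⟩ ⟨a, ha⟩) : F →L[ℂ] F) =
      (ι₁ (tmul ⟨c, hc⟩ ⟨a, ha⟩) : F →L[ℂ] F) * T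
    rw [h2]
    change T * ((ι₁ (tmul ⟨c, hc⟩ 1) : F →L[ℂ] F) * (embedRight ι₁ (⟨a, ha⟩ : A.Elem) : F →L[ℂ] F)) =
      ((ι₁ (tmul ⟨c, hc⟩ 1) : F →L[ℂ] F) * (embedRight ι₁ (⟨a, ha⟩ : A.Elem) : F →L[ℂ] F)) * T
    rw [← mul_assoc, hC, mul_assoc, hN _ (left_mem_generatedBy _ _ _), mul_assoc]
  rw [← hM.generate] at hy
  have hy' := hy
  rw [generatedBy, ← SetLike.mem_coe, coe_wstar] at hy'
  refine hy' T ?_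
  rintro x (hx | hx)
  · rcases hx with ⟨a, rfl⟩ | ⟨b, rfl⟩
    · exact (h1 a).symm
    · exact (hN _ (right_mem_generatedBy _ _ _)).symm
  · rcases hx with ⟨a, ha⟩ | ⟨b, hb⟩
    · have : x = (ι₁ (star a) : F →L[ℂ] F) := by
        rw [map_star, ← star_star x]; exact congrArg star ha.symm
      rw [this]
      exact (h1 _).symm
    · have : x = (ι₂ (star b) : F →L[ℂ] F) := by
        rw [map_star, ← star_star x]; exact congrArg star hb.symm
      rw [this]
      exact (hN _ (right_mem_generatedBy _ _ _)).symm

/-- By the bicommutant theorem and linearity it is enough that `y` commutes with each unitary of the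
commutant of `S`; `corner_commute` applies to its extension by `0`, where unitarity gives `T* T =
p`. -/
lemma corner_subset_wstar (hφA : IsFaithfulNormalState A φA) (hφC : φC 1 = 1)
    (hχ : IsProductState φC φA χ) (hM : IsFreeProduct χ φB ψ ι₁ ι₂) (hA : A.IsFactor) {e : A.Elem}
    (he : A.IsMinimalProjection e) (hp : IsStarProjection (embedRight ι₁ e : F →L[ℂ] F))
    (hpM : (embedRight ι₁ e : F →L[ℂ] F) ∈ M)
    {S : Set (cornerSpace (embedRight ι₁ e : F →L[ℂ] F) →L[ℂ]
      cornerSpace (embedRight ι₁ e : F →L[ℂ] F))}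
    (hSC : ∀ c : C.Elem, ∃ x ∈ S,
      cornerLift (embedRight ι₁ e : F →L[ℂ] F) x = (ι₁ (tmul c e) : F →L[ℂ] F))
    (hSN : ∀ x, cornerLift (embedRight ι₁ e : F →L[ℂ] F) x ∈ generatedBy (embedRight ι₁) ι₂ →
      x ∈ S) {y} (hy : y ∈ M.corner hp hpM) : y ∈ wstar S := by
  generalize hpe : (embedRight ι₁ e : F →L[ℂ] F) = p at hp hpM S y
  have hpN : p ∈ generatedBy (embedRight ι₁) ι₂ := hpe ▸ left_mem_generatedBy (embedRight ι₁) ι₂ e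
  rw [← commutant_commutant (wstar S), mem_commutant_iff]
  intro T hT
  have hT' := mem_span_unitary hT
  clear hT
  induction hT' using Submodule.span_induction with
  | zero => rw [zero_mul, mul_zero]
  | add a b _ _ ha hb => rw [add_mul, mul_add, ha, hb]
  | smul c a _ ha => rw [smul_mul_assoc, mul_smul_comm, ha]
  | mem T hT =>
    obtain ⟨hT, hTu⟩ := hT
    have hTS : ∀ x ∈ S, T * x = x * T := fun x hx ↦
      ((mem_commutant_iff.1 hT) x (subset_wstar S hx)).symm
    have hce : ∀ c : C.Elem, (ι₁ (tmul c 1) : F →L[ℂ] F) * p = ι₁ (tmul c e) := fun c ↦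
      hpe ▸ congrArg Subtype.val (show ι₁ (tmul c 1) * ι₁ (tmul 1 e) = ι₁ (tmul c e) by
        rw [← map_mul, tmul_mul_tmul, one_mul, mul_one])
    have hec : ∀ c : C.Elem, p * (ι₁ (tmul c 1) : F →L[ℂ] F) = ι₁ (tmul c e) := fun c ↦
      hpe ▸ congrArg Subtype.val (show ι₁ (tmul 1 e) * ι₁ (tmul c 1) = ι₁ (tmul c e) by
        rw [← map_mul, tmul_mul_tmul, one_mul, mul_one])
    apply cornerLift_injective p
    rw [cornerLift_mul, cornerLift_mul]
    refine corner_commute (M := M) (N := generatedBy (embedRight ι₁) ι₂) (p := p)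
      (J := Set.range fun a : A.Elem ↦ (embedRight ι₁ a : F →L[ℂ] F))
      (𝒞 := Set.range fun c : C.Elem ↦ (ι₁ (tmul c 1) : F →L[ℂ] F)) ?_ ?_ ?_ ?_ ?_
      (proj_mul_cornerLift hp T) (cornerLift_mul_proj hp T) ?_ ?_ ?_ hy
      (cornerLift_mul_proj hp y) (proj_mul_cornerLift hp y)
    · rintro _ ⟨a, rfl⟩
      exact left_mem_generatedBy _ _ a
    · intro z hz
      exact total_of_statePreserving hφA.toIsNormalState hM.state (map_embedRight hφC hχ hM) hA
        he.ne_zero he.isStarProjection.isSelfAdjoint fun a v ↦ by rw [hpe]; exact hz _ ⟨a, rfl⟩ v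
    · rintro _ ⟨c, rfl⟩
      exact (hce c).trans (hec c).symm
    · rintro _ ⟨c, rfl⟩ _ ⟨a, rfl⟩
      exact congrArg Subtype.val
        (show ι₁ (tmul c 1) * ι₁ (tmul 1 a) = ι₁ (tmul 1 a) * ι₁ (tmul c 1) by
          rw [← map_mul, ← map_mul, tmul_mul_tmul, tmul_mul_tmul, one_mul, one_mul, mul_one,
            mul_one])
    · intro T' h1 h2 y' hy'
      exact generate_commute hχ hM h1 (fun c ↦ h2 _ ⟨c, rfl⟩) hy'
    · rw [← cornerLift_star, ← cornerLift_mul, hTu, cornerLift_one hp]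
    · intro x hx
      have h1 := hTS (compress p x) (hSN _ (by
        rw [cornerLift_compress hp]; exact mul_mem (mul_mem hpN hx) hpN))
      have h2 := congrArg (cornerLift p) h1
      rwa [cornerLift_mul, cornerLift_mul, cornerLift_compress hp] at h2
    · rintro _ ⟨c, rfl⟩
      obtain ⟨x, hx, hxc⟩ := hSC c
      have h2 := congrArg (cornerLift p) (hTS x hx)
      rw [cornerLift_mul, cornerLift_mul, hxc] at h2
      change cornerLift p T * (ι₁ (tmul c 1) : F →L[ℂ] F) =
        (ι₁ (tmul c 1) : F →L[ℂ] F) * cornerLift p T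
      -- On operators supported on `p`, multiplication by `c ⊗ 1` agrees with multiplication by `c ⊗
      -- e`, and the latter comes from `S`.
      rw [← cornerLift_mul_proj hp T, mul_assoc, hec, h2, cornerLift_mul_proj hp T, ← hce,
        mul_assoc, proj_mul_cornerLift hp]

end Main

end VonNeumannAlgebra

end

open VonNeumannAlgebra in
theorem proposition3p7
    {HA HB HC HM : Type*}
    [NormedAddCommGroup HA] [InnerProductSpace ℂ HA] [CompleteSpace HA]
    [NormedAddCommGroup HB] [InnerProductSpace ℂ HB] [CompleteSpace HB]
    [NormedAddCommGroup HC] [InnerProductSpace ℂ HC] [CompleteSpace HC]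
    [NormedAddCommGroup HM] [InnerProductSpace ℂ HM] [CompleteSpace HM]
    (A : VonNeumannAlgebra HA) (B : VonNeumannAlgebra HB) (C : VonNeumannAlgebra HC)
    (φA : A.Elem →ₗ[ℂ] ℂ) (hφA : A.IsFaithfulNormalState φA)
    (φB : B.Elem →ₗ[ℂ] ℂ) (hφB : B.IsFaithfulNormalState φB)
    (φC : C.Elem →ₗ[ℂ] ℂ) (hφC : C.IsFaithfulNormalState φC)
    (hA : A.IsTypeIFactor)
    -- the product state on `C ⊗ A`
    (χ : (C.tensor A).Elem →ₗ[ℂ] ℂ) (hχ : IsProductState φC φA χ)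
    -- `(M, ψ) = (C ⊗ A) ∗ B`
    (M : VonNeumannAlgebra HM) (ψ : M.Elem →ₗ[ℂ] ℂ)
    (ι₁ : (C.tensor A).Elem →⋆ₐ[ℂ] M.Elem) (ι₂ : B.Elem →⋆ₐ[ℂ] M.Elem)
    (hM : IsFreeProduct χ φB ψ ι₁ ι₂)
    (e : A.Elem) (he : A.IsMinimalProjection e) :
    -- `j : A → M` is the embedding `a ↦ 1 ⊗ a`, and `N` is generated by `A` and `B` inside `M`
    let j : A.Elem →⋆ₐ[ℂ] M.Elem := ι₁.comp (tensorRight C A)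
    let N : VonNeumannAlgebra HM := generatedBy j ι₂
    let ψN : N.Elem →ₗ[ℂ] ℂ :=
      ψ ∘ₗ (StarSubalgebra.inclusion (generatedBy_le j ι₂)).toAlgHom.toLinearMap
    -- the minimal projection `e`, viewed in `N ⊆ M`
    let p : HM →L[ℂ] HM := j e
    have hp : IsStarProjection p :=
      he.isStarProjection.map (M.toStarSubalgebra.subtype.comp j)
    have hpM : p ∈ M := (j e).2
    have hpN : p ∈ N := left_mem_generatedBy j ι₂ e
    -- the corners `eMe` and `eNe` with their normalized states
    let eMe := M.corner hp hpM
    let eNe := N.corner hp hpN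
    let ψe : eMe.Elem →ₗ[ℂ] ℂ := cornerState ψ hp hpM
    let ψNe : eNe.Elem →ₗ[ℂ] ℂ := cornerState ψN hp hpN
    -- `(N, ψ) = A ∗ B`
    IsFreeProduct φA φB ψN (toGeneratedLeft j ι₂) (toGeneratedRight j ι₂) ∧
    ∃ (ρC : C.Elem →⋆ₐ[ℂ] eMe.Elem) (ρN : eNe.Elem →⋆ₐ[ℂ] eMe.Elem),
      -- `ρC` is `c ↦ c ⊗ e` and `ρN` is the inclusion of `eNe` in `eMe`
      (∀ c : C.Elem, cornerIncl M hp hpM (ρC c) = ι₁ (tmul c e)) ∧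
      (∀ x : eNe.Elem,
        (ρN x : cornerSpace p →L[ℂ] cornerSpace p) = (x : cornerSpace p →L[ℂ] cornerSpace p)) ∧
      -- `eNe` and `C ⊗ e` are free with respect to `ψe`, and together they generate `eMe`
      IsFree ψe ![Set.range ρN, Set.range ρC] ∧
      generatedBy ρN ρC = eMe ∧
      -- `(eMe, ψe)` is the free product `(C, φC) ∗ (eNe, ψe)`
      IsFreeProduct φC ψNe ψe ρC ρN ∧
      ∀ (HP : Type*) [NormedAddCommGroup HP] [InnerProductSpace ℂ HP] [CompleteSpace HP]
        (P : VonNeumannAlgebra HP) (φP : P.Elem →ₗ[ℂ] ℂ)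
        (κC : C.Elem →⋆ₐ[ℂ] P.Elem) (κN : eNe.Elem →⋆ₐ[ℂ] P.Elem),
        IsFreeProduct φC ψNe φP κC κN →
        ∃ α : eMe.Elem ≃⋆ₐ[ℂ] P.Elem, ∀ x, φP (α x) = ψe x := by
  intro j N ψN p hp hpM hpN eMe eNe ψe ψNe
  have hC1 : φC 1 = 1 := hφC.map_one
  have hj : ∀ a, ψ (j a) = φA a := map_embedRight hC1 hχ hM
  have hee : e * e = e := he.isStarProjection.isIdempotentElem.eq
  have hes : star e = e := he.isStarProjection.isSelfAdjoint.star_eq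
  have hφe : φA e ≠ 0 := hφA.map_projection_ne_zero he.isStarProjection he.ne_zero
  have hψp : ψ ⟨p, hpM⟩ = φA e := hj e
  have hN := isFreeProduct_toGenerated (f := j) (g := ι₂) hM.state hj hM.map_right
    (hM.free.comp (f := id) (fun l _ ↦ by simp) fun i ↦ match i with
      | 0 => by rintro _ ⟨a, rfl⟩; exact ⟨tensorRight C A a, rfl⟩
      | 1 => fun x hx ↦ hx)
  obtain ⟨ρC, hρC⟩ := exists_corner_hom (C := C) (g := fun c ↦ ι₁ (tmul c e)) hp hpM
    (fun x y ↦ by rw [tmul_add_left, map_add]) (fun c x ↦ by rw [tmul_smul_left, map_smul])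
    (fun x y ↦ by rw [← map_mul, tmul_mul_tmul, hee])
    (fun x ↦ by rw [← map_star, star_tmul, hes]) rfl
  have hle : eNe.toStarSubalgebra ≤ eMe.toStarSubalgebra := fun x hx ↦ generatedBy_le j ι₂ hx
  let ρN : eNe.Elem →⋆ₐ[ℂ] eMe.Elem := StarSubalgebra.inclusion hle
  have hfree : IsFree ψe ![Set.range ρC, Set.range ρN] := by
    refine (isFree_tmul_corner hφA hC1 hχ hM he).corner hp hpM (hψp ▸ hφe) ?_ ?_
    · rintro _ ⟨c, rfl⟩
      exact ⟨c, (hρC c).symm⟩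
    · rintro _ ⟨x, rfl⟩
      refine ⟨x.2, Subtype.ext ?_⟩
      change p * cornerLift p (x : cornerSpace p →L[ℂ] cornerSpace p) * p = cornerLift p x
      rw [proj_mul_cornerLift hp, cornerLift_mul_proj hp]
  have hgen : generatedBy ρN ρC = eMe := by
    refine SetLike.ext fun y ↦ ⟨fun hy ↦ generatedBy_le ρN ρC hy, fun hy ↦ ?_⟩
    refine corner_subset_wstar hφA hC1 hχ hM hA.1 he hp hpM (fun c ↦ ?_) (fun x hx ↦ ?_) hy
    · exact ⟨_, Or.inr ⟨c, rfl⟩, congrArg Subtype.val (hρC c)⟩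
    · exact Or.inl ⟨⟨x, hx⟩, rfl⟩
  have hprod : IsFreeProduct φC ψNe ψe ρC ρN :=
    { state := hM.state.cornerState hp hpM (hψp ▸ hφe)
      map_left := fun c ↦ by
        change (ψ ⟨p, hpM⟩)⁻¹ * ψ (cornerIncl M hp hpM (ρC c)) = φC c
        rw [hρC, hM.map_left, hχ.map_tmul, hψp, mul_comm, mul_inv_cancel_right₀ hφe]
      map_right := fun x ↦ rfl
      free := hfree
      generate := by rw [generatedBy_comm, hgen] }
  refine ⟨hN, ρC, ρN, hρC, fun x ↦ rfl, hfree.swap, hgen, hprod, ?_⟩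
  intro HP _ _ _ P φP κC κN hP
  exact hprod.exists_equiv hP
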